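/- Let $k$ be an algebraic extension of $\mathbf F_2$ (for example $k=\mathbf F_2$, $\mathbf F_8$ or $\overline{\mathbf F}_2$). For $i\ge 0$ let $C_i$ be the smooth projective curve over $k$ with function field $k(C_i)=k(x_0,x_1,\dots,x_i)$, where $x_0$ is transcendental over $k$ and $$x_{j+1}^2+x_{j+1}=x_j+1+\frac1{x_j}\qquad (0\le j<i).$$ Then the genus $g(C_i)$ (the maximum of $\deg D+1-\dim_k L(D)$ over all divisors $D$ on $C_i$, where $L(D)$ is the Riemann–Roch space of $D$) is given for all $i\ge 0$ by $$g(C_i)=2^{i+2}+1-\begin{cases}(i+10)\,2^{\,i/2-1} & \text{if } i \text{ is even},\\ \bigl(i+2\lfloor i/4\rfloor+15\bigr)\,2^{(i-3)/2} & \text{if } i \text{ is odd}.\end{cases}$$ -/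

import Mathlib

noncomputable section

namespace CurveTower

open IsLocalRing

/-- A closed point of the smooth projective curve over `k` with function field `K` (a place of
`K / k`): a valuation ring of `K` that contains `k` and is different from `K`. -/
structure Place (k K : Type*) [Field k] [Field K] [Algebra k K] where
  /-- The local ring of the point. -/
  ring : ValuationSubring K
  algebraMap_mem : ∀ a : k, algebraMap k K a ∈ ring
  ne_top : ring ≠ ⊤

section

variable {k K : Type*} [Field k] [Field K] [Algebra k K]

instance Place.instAlgebra (P : Place k K) : Algebra k P.ring :=
  ((algebraMap k K).codRestrict P.ring P.algebraMap_mem).toAlgebra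

/-- The degree of a point: the degree of its residue field over `k`. -/
def Place.degree (P : Place k K) : ℕ := Module.finrank k (ResidueField P.ring)

/-- A uniformizer (local parameter) at `P`: a generator of the maximal ideal of the local ring. -/
def Place.IsUniformizer (P : Place k K) (t : P.ring) : Prop :=
  maximalIdeal P.ring = Ideal.span {t}

end

/-- Divisors: finite formal `ℤ`-linear combinations of points. -/
abbrev Divisor (k K : Type*) [Field k] [Field K] [Algebra k K] := Place k K →₀ ℤ

section

variable {k K : Type*} [Field k] [Field K] [Algebra k K]

/-- The degree of a divisor, `∑ D(P) · deg P`. -/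
def Divisor.degree (D : Divisor k K) : ℤ := D.sum fun P n => n * (P.degree : ℤ)

/-- The Riemann–Roch space `L(D)` of all `f` with `f = 0` or `ord_P f ≥ - D(P)` at all points `P`.
For a uniformizer `t` at `P` this condition says that `f * t ^ D(P)` lies in the local ring. -/
def Divisor.riemannRochSpace (D : Divisor k K) : Submodule k K where
  carrier := {f | ∀ (P : Place k K) (t : P.ring), P.IsUniformizer t →
    f * (t : K) ^ (D P) ∈ P.ring}
  add_mem' := fun hf hg P t ht => by
    rw [add_mul]
    exact P.ring.add_mem _ _ (hf P t ht) (hg P t ht)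
  zero_mem' := fun P t _ => by
    rw [zero_mul]
    exact P.ring.zero_mem
  smul_mem' := fun c f hf P t ht => by
    rw [Algebra.smul_def, mul_assoc]
    exact P.ring.mul_mem _ _ (P.algebraMap_mem c) (hf P t ht)

/-- `ℓ(D) = dim_k L(D)`. -/
def Divisor.ell (D : Divisor k K) : ℕ := Module.finrank k D.riemannRochSpace

end

/-- `g` is the genus of the function field `K / k`, i.e. of the smooth projective curve over `k`
with function field `K`: the maximum of `deg D + 1 - ℓ(D)` over all divisors `D`. -/
def IsGenus (k K : Type*) [Field k] [Field K] [Algebra k K] (g : ℤ) : Prop :=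
  IsGreatest (Set.range fun D : Divisor k K => D.degree + 1 - (D.ell : ℤ)) g

/-- `K = k(x₀, …, xᵢ)` is the function field of the curve `Cᵢ` over `k`: `x₀` is a coordinate on the
projective line, and each `xⱼ₊₁` satisfies the recursive Artin–Schreier equation
`xⱼ₊₁² + xⱼ₊₁ = xⱼ + 1 + 1 / xⱼ`. -/
structure IsTowerFunctionField (k : Type*) {K : Type*} [Field k] [Field K] [Algebra k K] (i : ℕ)
    (x : Fin (i + 1) → K) : Prop where
  transcendental : Transcendental k (x 0)
  equation : ∀ j : Fin i,
    x j.succ ^ 2 + x j.succ = x j.castSucc + 1 + 1 / x j.castSucc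
  adjoin_eq_top : IntermediateField.adjoin k (Set.range x) = ⊤

/-- The function field of `Cᵢ` exists over every field `k`. -/
theorem exists_isTowerFunctionField (k : Type*) [Field k] (i : ℕ) :
    ∃ (K : IntermediateField k (AlgebraicClosure (RatFunc k))) (x : Fin (i + 1) → K),
      IsTowerFunctionField k i x := by
  have hroot : ∀ a : AlgebraicClosure (RatFunc k), ∃ y, y ^ 2 + y = a + 1 + 1 / a := by
    intro a
    have hd : (Polynomial.X ^ 2 + Polynomial.X - Polynomial.C (a + 1 + 1 / a) :
        Polynomial (AlgebraicClosure (RatFunc k))).degree = 2 := by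
      compute_degree!
    obtain ⟨y, hy⟩ := IsAlgClosed.exists_root _ (by rw [hd]; decide)
    refine ⟨y, ?_⟩
    simpa [Polynomial.IsRoot, sub_eq_zero] using hy
  choose next hnext using hroot
  let y : ℕ → AlgebraicClosure (RatFunc k) := fun n =>
    Nat.rec (algebraMap (RatFunc k) _ RatFunc.X) (fun _ a => next a) n
  let s : Set (AlgebraicClosure (RatFunc k)) := Set.range fun j : Fin (i + 1) => y j
  let x : Fin (i + 1) → IntermediateField.adjoin k s :=
    fun j => ⟨y j, IntermediateField.subset_adjoin k s ⟨j, rfl⟩⟩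
  refine ⟨IntermediateField.adjoin k s, x, ?_, ?_, ?_⟩
  · have h1 : Transcendental k (RatFunc.X : RatFunc k) := RatFunc.transcendental_X
    have h2 : Transcendental k (algebraMap (RatFunc k) (AlgebraicClosure (RatFunc k)) RatFunc.X) :=
      (transcendental_algebraMap_iff (algebraMap (RatFunc k) _).injective).2 h1
    exact (transcendental_algebraMap_iff
      (algebraMap (IntermediateField.adjoin k s) (AlgebraicClosure (RatFunc k))).injective).1 h2
  · intro j
    apply Subtype.ext
    exact hnext (y j)
  · apply IntermediateField.lift_injective
    rw [IntermediateField.lift_adjoin, IntermediateField.lift_top, ← Set.range_comp]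
    rfl

end CurveTower

end

/-! Each step of the tower is a quadratic Artin–Schreier extension y² + y = u with u = x_i + 1 +
1/x_i. Suppose that at every point some substitution y ↦ y + w makes u + w² + w either regular or of
pole order one. Then the points of the second kind are exactly the ramified ones, each has different
exponent 2, and Riemann–Hurwitz reads g' = 2g − 1 + deg R, where R is the set of points of the lower
curve that ramify. It remains to find R and its degree at every level.

The genus step is done without differentials. In coordinates f = a + b y a local integral basis is
1, y + w at an unramified point and 1, t (y + w) at a ramified one. With E the sum of the ramified
points, f ↦ b therefore maps L(π*D) to L(D − E) with kernel L(D). For large D it is onto by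
approximation, so ℓ(π*D) = ℓ(D) + ℓ(D − E) (`ell_pullback`, `HasGenus.of_isFiber`). Since deg D −
ℓ(D) is monotone, the genus can be read off on a cofinal family of divisors (`HasGenus.isGenus`).
The projective line starts the recursion (`IsCoordinate.hasGenus`).

For R: a pole of u lies over x_0 = ∞ or over a zero of exactly one x_n. Over ∞ the pole of u is
always simple, so there is always ramification. At a zero of x_n the earlier coordinates x_{n-1},
x_{n-2}, … are alternately primitive cube roots of unity and 1, and all later coordinates have
poles. With y = x_{n-1} and W = 1/(x_{n-2} + 1) one finds 1/x_n ≡ y (W² + W) modulo regular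
functions, while (y² + y + 1) W² is regular. Iteration gives a chain of ⌊n/2⌋ links ending in a
simple pole (`Place.EvenStage`). The shift by (y + 1) W replaces y (W² + W) by W, so by descent the
step ramifies. Its root is (y + 1)(W'² + W') + W' with W'² + W' ≡ W (`Place.OddStage`). The shift by
y W' kills this pole, so the next step is unramified, and afterwards the chain is one link shorter.
Thus the step b levels after the zero ramifies if b is even or the chain is used up (`Ramifies`).

`TowerLevel.succ` carries these facts and the degrees of the relevant sets of points from level to
level. Summing the degrees gives a recursion with period four for deg R, and solving it gives the
closed formula. -/

noncomputable section

namespace CurveTower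

open IsLocalRing

/-! ### Valuations and local parameters at a point -/

section Places

variable {k K : Type*} [Field k] [Field K] [Algebra k K]

/-- The valuation of a place. -/
abbrev Place.v (P : Place k K) : Valuation K P.ring.ValueGroup := P.ring.valuation

theorem Place.eq_of_ring_eq {P Q : Place k K} (h : P.ring = Q.ring) : P = Q := by
  cases P; cases Q; cases h; rfl

theorem Place.mem_ring {P : Place k K} {f : K} : f ∈ P.ring ↔ P.v f ≤ 1 :=
  (P.ring.valuation_le_one_iff f).symm

theorem Place.v_algebraMap_le (P : Place k K) (a : k) : P.v (algebraMap k K a) ≤ 1 :=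
  Place.mem_ring.1 (P.algebraMap_mem a)

theorem Place.v_algebraMap (P : Place k K) {a : k} (ha : a ≠ 0) : P.v (algebraMap k K a) = 1 := by
  refine le_antisymm (P.v_algebraMap_le a) ?_
  have h := P.v_algebraMap_le a⁻¹
  rw [map_inv₀, map_inv₀] at h
  have h0 : P.v (algebraMap k K a) ≠ 0 := by simpa using ha
  exact (inv_le_one₀ (zero_lt_iff.2 h0)).1 h

theorem Place.exists_one_lt (P : Place k K) : ∃ f : K, 1 < P.v f := by
  by_contra! h
  exact P.ne_top (by
    ext f
    simpa using Place.mem_ring.2 (h f))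

/-- A local parameter that generates the value group. -/
def Place.IsParam (P : Place k K) (t : K) : Prop :=
  P.v t < 1 ∧ ∀ f : K, f ≠ 0 → ∃ n : ℤ, P.v f = P.v t ^ n

namespace Place.IsParam

variable {P : Place k K} {t : K}

/-- Otherwise all values would be 0 or 1, while some function has a pole. -/
theorem ne_zero (h : P.IsParam t) : t ≠ 0 := by
  rintro rfl
  obtain ⟨f, hf⟩ := P.exists_one_lt
  obtain ⟨n, hn⟩ := h.2 f (by rintro rfl; simp at hf)
  rw [hn, map_zero] at hf
  rcases eq_or_ne n 0 with rfl | hn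
  · simp at hf
  · rw [zero_zpow n hn] at hf
    simp at hf

theorem v_pos (h : P.IsParam t) : 0 < P.v t := by
  simpa [zero_lt_iff] using h.ne_zero

theorem congr (h : P.IsParam t) {s : K} (hs : P.v s = P.v t) : P.IsParam s := by
  unfold Place.IsParam
  rw [hs]
  exact h

theorem zpow_le_zpow (h : P.IsParam t) {m n : ℤ} : P.v t ^ m ≤ P.v t ^ n ↔ n ≤ m :=
  (zpow_right_strictAnti₀ h.v_pos h.1).le_iff_ge

theorem zpow_le_one (h : P.IsParam t) {n : ℤ} : P.v t ^ n ≤ 1 ↔ 0 ≤ n := by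
  rw [← h.zpow_le_zpow, zpow_zero]

theorem zpow_lt_one (h : P.IsParam t) {n : ℤ} : P.v t ^ n < 1 ↔ 0 < n := by
  rw [← not_le, ← not_le, ← h.zpow_le_zpow, zpow_zero]

theorem zpow_inj (h : P.IsParam t) {m n : ℤ} : P.v t ^ m = P.v t ^ n ↔ m = n :=
  (zpow_right_strictAnti₀ h.v_pos h.1).injective.eq_iff

theorem lt_one_iff (h : P.IsParam t) {f : K} : P.v f < 1 ↔ P.v f ≤ P.v t := by
  rcases eq_or_ne f 0 with rfl | hf
  · simp
  obtain ⟨n, hn⟩ := h.2 f hf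
  rw [hn, h.zpow_lt_one]
  have h1 := h.zpow_le_zpow (m := n) (n := 1)
  rw [zpow_one] at h1
  rw [h1]
  omega

theorem v_eq (h : P.IsParam t) {s : K} (hs : P.IsParam s) : P.v s = P.v t :=
  le_antisymm (h.lt_one_iff.1 hs.1) (hs.lt_one_iff.1 h.1)

/-- Links generators of the maximal ideal, on which Riemann–Roch spaces are defined, to generators
of the value group, with which all later computations are done. -/
theorem isUniformizer_iff (h : P.IsParam t) {s : P.ring} :
    P.IsUniformizer s ↔ P.v (s : K) = P.v t := by
  unfold Place.IsUniformizer
  constructor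
  · intro hs
    apply le_antisymm
    · apply h.lt_one_iff.1
      rw [← ValuationSubring.valuation_lt_one_iff, hs]
      exact Ideal.mem_span_singleton_self s
    · have ht : (⟨t, Place.mem_ring.2 h.1.le⟩ : P.ring) ∈ maximalIdeal P.ring := by
        rw [ValuationSubring.valuation_lt_one_iff]
        exact h.1
      rw [hs, Ideal.mem_span_singleton] at ht
      obtain ⟨c, hc⟩ := ht
      have hc' : t = s * c := congrArg Subtype.val hc
      rw [hc', map_mul]
      exact mul_le_of_le_one_right' (P.ring.valuation_le_one c)
  · intro hs
    have hs' := h.congr hs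
    ext a
    rw [ValuationSubring.valuation_lt_one_iff, Ideal.mem_span_singleton]
    constructor
    · intro ha
      have ha' := hs'.lt_one_iff.1 ha
      obtain ⟨c, hc⟩ := (P.ring.valuation_le_iff _ _).1 ha'
      exact ⟨c, Subtype.ext (by rw [← hc, mul_comm]; rfl)⟩
    · rintro ⟨c, rfl⟩
      refine lt_of_le_of_lt ?_ hs'.1
      change P.v ((s : K) * c) ≤ _
      rw [map_mul]
      exact mul_le_of_le_one_right' (P.ring.valuation_le_one c)

end Place.IsParam

/-- The properties of the points of a smooth projective curve over `k` that the theory of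
Riemann–Roch spaces needs. -/
structure IsCurve (k K : Type*) [Field k] [Field K] [Algebra k K] : Prop where
  exists_isParam : ∀ P : Place k K, ∃ t, P.IsParam t
  finite_residueField : ∀ P : Place k K, Module.Finite k (ResidueField P.ring)
  finite_poles : ∀ f : K, {P : Place k K | f ∉ P.ring}.Finite

theorem mem_riemannRochSpace (h : IsCurve k K) {D : Divisor k K} {f : K} :
    f ∈ D.riemannRochSpace ↔ ∀ (P : Place k K) (t : K), P.IsParam t → P.v f * P.v t ^ (D P) ≤ 1 := by
  constructor
  · intro hf P t ht
    have h1 := hf P ⟨t, Place.mem_ring.2 ht.1.le⟩ (ht.isUniformizer_iff.2 rfl)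
    rw [Place.mem_ring, map_mul, map_zpow₀] at h1
    exact h1
  · intro hf P t ht
    obtain ⟨s, hs⟩ := h.exists_isParam P
    rw [Place.mem_ring, map_mul, map_zpow₀]
    exact hf P t (hs.congr (hs.isUniformizer_iff.1 ht))

/-- The functions `f` with `ord_P f ≥ -n`. -/
def Place.polar (P : Place k K) (t : K) (n : ℤ) : Submodule k K where
  carrier := {f | P.v (f * t ^ n) ≤ 1}
  add_mem' := fun {a b} ha hb => by
    rw [Set.mem_ofPred_eq, add_mul]
    exact P.v.map_add_le ha hb
  zero_mem' := by simp
  smul_mem' := fun c f hf => by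
    rw [Set.mem_ofPred_eq, Algebra.smul_def, mul_assoc, map_mul]
    exact mul_le_one' (P.v_algebraMap_le c) hf

theorem Place.mem_polar {P : Place k K} {t : K} {n : ℤ} {f : K} :
    f ∈ P.polar t n ↔ P.v f * P.v t ^ n ≤ 1 := by
  rw [← map_zpow₀, ← map_mul]
  exact Iff.rfl

theorem mem_riemannRochSpace_iff_polar (h : IsCurve k K) {D : Divisor k K} {f : K}
    {t : Place k K → K} (ht : ∀ P : Place k K, P.IsParam (t P)) :
    f ∈ D.riemannRochSpace ↔ ∀ P : Place k K, f ∈ P.polar (t P) (D P) := by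
  rw [mem_riemannRochSpace h]
  refine forall_congr' fun P => ?_
  rw [Place.mem_polar]
  exact ⟨fun hf => hf _ (ht P), fun hf s hs => by rwa [(ht P).v_eq hs]⟩

theorem Place.polar_mono {P : Place k K} {t : K} (ht : P.IsParam t) {m n : ℤ} (hmn : m ≤ n) :
    P.polar t m ≤ P.polar t n := by
  intro f hf
  rw [Place.mem_polar] at hf ⊢
  exact le_trans (mul_le_mul_right (ht.zpow_le_zpow.2 hmn) _) hf

theorem Place.exists_mem_polar {P : Place k K} {t : K} (ht : P.IsParam t) (f : K) (m : ℤ) :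
    ∃ N : ℕ, f ∈ P.polar t (m + N) := by
  rcases eq_or_ne f 0 with rfl | hf
  · exact ⟨0, zero_mem _⟩
  obtain ⟨n, hn⟩ := ht.2 f hf
  refine ⟨(-n - m).toNat, ?_⟩
  rw [Place.mem_polar, hn, ← zpow_add₀ ht.v_pos.ne', ht.zpow_le_one]
  have := Int.self_le_toNat (-n - m)
  omega

/-- The leading coefficient of a function with `ord_P f ≥ -n`. -/
def Place.leadingCoeff (P : Place k K) (t : K) (n : ℤ) :
    P.polar t n →ₗ[k] ResidueField P.ring where
  toFun f := residue P.ring ⟨f * t ^ n, Place.mem_ring.2 f.2⟩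
  map_add' f g := by
    rw [← map_add]
    congr 1
    exact Subtype.ext (add_mul _ _ _)
  map_smul' c f := by
    rw [RingHom.id_apply, Algebra.smul_def]
    change _ = residue P.ring (algebraMap k P.ring c) * _
    rw [← map_mul]
    congr 1
    refine Subtype.ext ?_
    change (c • (f : K)) * t ^ n = algebraMap k K c * (f * t ^ n)
    rw [Algebra.smul_def, mul_assoc]

theorem Place.residue_eq_zero_iff {P : Place k K} {f : P.ring} :
    residue P.ring f = 0 ↔ P.v (f : K) < 1 := by
  rw [IsLocalRing.residue_eq_zero_iff, ValuationSubring.valuation_lt_one_iff]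

/-- No value lies strictly between that of t and 1, so vanishing of the residue lowers the pole
order by a full unit. -/
theorem Place.leadingCoeff_eq_zero {P : Place k K} {t : K} (ht : P.IsParam t) {n : ℤ}
    {f : P.polar t (n + 1)} : P.leadingCoeff t (n + 1) f = 0 ↔ (f : K) ∈ P.polar t n := by
  change residue P.ring _ = 0 ↔ _
  rw [Place.residue_eq_zero_iff, Place.mem_polar, ht.lt_one_iff]
  change P.v ((f : K) * t ^ (n + 1)) ≤ P.v t ↔ _
  rw [map_mul, map_zpow₀, zpow_add_one₀ ht.v_pos.ne', ← mul_assoc]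
  nth_rewrite 3 [← one_mul (P.v t)]
  exact mul_le_mul_iff_left₀ ht.v_pos

end Places

/-! ### Riemann–Roch spaces, genus and approximation -/

section RiemannRoch

variable {k K : Type*} [Field k] [Field K] [Algebra k K]

theorem Divisor.degree_add (D D' : Divisor k K) : (D + D').degree = D.degree + D'.degree :=
  Finsupp.sum_add_index' (by simp) (by intros; ring)

theorem Divisor.degree_single (P : Place k K) (n : ℤ) :
    Divisor.degree (Finsupp.single P n) = n * P.degree :=
  Finsupp.sum_single_index (by simp)

theorem Divisor.degree_zero : Divisor.degree (0 : Divisor k K) = 0 := Finsupp.sum_zero_index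

theorem Divisor.degree_neg (D : Divisor k K) : (-D).degree = -D.degree := by
  have := Divisor.degree_add D (-D)
  rw [add_neg_cancel, Divisor.degree_zero] at this
  omega

theorem Divisor.degree_sub (D D' : Divisor k K) : (D - D').degree = D.degree - D'.degree := by
  rw [sub_eq_add_neg, Divisor.degree_add, Divisor.degree_neg, sub_eq_add_neg]

theorem Divisor.single_nonneg (P : Place k K) {n : ℤ} (hn : 0 ≤ n) :
    (0 : Divisor k K) ≤ Finsupp.single P n := by
  intro Q
  classical
  rw [Finsupp.single_apply]
  split_ifs <;> simp [hn]

/-- A property of divisors that is preserved when a point is added holds for all larger divisors. -/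
theorem Divisor.induction_ge {p : Divisor k K → Prop} {D : Divisor k K} (hD : p D)
    (step : ∀ D', D ≤ D' → ∀ P, p D' → p (D' + Finsupp.single P 1)) {D' : Divisor k K}
    (h : D ≤ D') : p D' := by
  classical
  -- A coefficient n at one point is added as n single points; the difference D' − D is then built
  -- up over its support.
  have multi : ∀ (n : ℕ) (D' : Divisor k K), D ≤ D' → ∀ P, p D' → p (D' + Finsupp.single P (n : ℤ)) := by
    intro n
    induction n with
    | zero => intro D' _ P hp; simpa using hp
    | succ n ih =>
      intro D' hD' P hp
      have h1 := step _ (hD'.trans (le_add_of_nonneg_right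
        (Divisor.single_nonneg P (Int.natCast_nonneg n)))) P (ih D' hD' P hp)
      rwa [add_assoc, ← Finsupp.single_add, ← Nat.cast_succ] at h1
  suffices H : ∀ A : Divisor k K, 0 ≤ A → p (D + A) by
    simpa using H (D' - D) (sub_nonneg.2 h)
  intro A
  induction A using Finsupp.induction with
  | zero => intro _; simpa using hD
  | single_add P n f hP hn ih =>
    intro hA
    have hf : 0 ≤ f := by
      intro Q
      by_cases hQ : Q = P
      · subst hQ
        rw [Finsupp.notMem_support_iff.1 hP]
        rfl
      · have := hA Q
        rwa [Finsupp.add_apply, Finsupp.single_eq_of_ne hQ, zero_add] at this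
    have hn0 : 0 ≤ n := by
      have := hA P
      rwa [Finsupp.add_apply, Finsupp.single_eq_same, Finsupp.notMem_support_iff.1 hP,
        add_zero] at this
    obtain ⟨m, rfl⟩ := Int.eq_ofNat_of_zero_le hn0
    have := multi m (D + f) (le_add_of_nonneg_right hf) P (ih hf)
    rwa [add_assoc, add_comm f] at this

theorem riemannRochSpace_mono (h : IsCurve k K) {D D' : Divisor k K} (hD : D ≤ D') :
    D.riemannRochSpace ≤ D'.riemannRochSpace := by
  choose t ht using h.exists_isParam
  intro f hf
  rw [mem_riemannRochSpace_iff_polar h ht] at hf ⊢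
  exact fun P => Place.polar_mono (ht P) (hD P) (hf P)

theorem riemannRochSpace_add_single_le_polar (h : IsCurve k K) (D : Divisor k K) {P : Place k K}
    {t : K} (ht : P.IsParam t) :
    (D + Finsupp.single P 1).riemannRochSpace ≤ P.polar t (D P + 1) := by
  intro f hf
  rw [mem_riemannRochSpace h] at hf
  rw [Place.mem_polar]
  have := hf P t ht
  rwa [Finsupp.add_apply, Finsupp.single_eq_same] at this

/-- The leading coefficient at `P` on `L(D + P)`. -/
def leadingCoeffMap (h : IsCurve k K) (D : Divisor k K) {P : Place k K} {t : K}
    (ht : P.IsParam t) : (D + Finsupp.single P 1).riemannRochSpace →ₗ[k] ResidueField P.ring :=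
  P.leadingCoeff t (D P + 1) ∘ₗ
    Submodule.inclusion (riemannRochSpace_add_single_le_polar h D ht)

theorem leadingCoeffMap_eq_zero (h : IsCurve k K) (D : Divisor k K) {P : Place k K} {t : K}
    (ht : P.IsParam t) {f : (D + Finsupp.single P 1).riemannRochSpace} :
    leadingCoeffMap h D ht f = 0 ↔ (f : K) ∈ D.riemannRochSpace := by
  classical
  refine (Place.leadingCoeff_eq_zero ht).trans ?_
  rw [mem_riemannRochSpace h]
  have hf := (mem_riemannRochSpace h).1 f.2
  constructor
  · intro hP Q s hs
    by_cases hQ : Q = P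
    · subst hQ
      rw [ht.v_eq hs]
      exact Place.mem_polar.1 hP
    · have := hf Q s hs
      rwa [Finsupp.add_apply, Finsupp.single_eq_of_ne hQ, add_zero] at this
  · intro hf
    exact Place.mem_polar.2 (hf P t ht)

/-- Rank–nullity for the leading coefficient at P, whose kernel is L(D). -/
theorem finite_riemannRochSpace_add_single (h : IsCurve k K) {D : Divisor k K} (P : Place k K)
    (hD : Module.Finite k D.riemannRochSpace) :
    Module.Finite k (D + Finsupp.single P 1).riemannRochSpace ∧
      ∀ (t : K) (ht : P.IsParam t), (D + Finsupp.single P 1).ell = D.ell +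
        Module.finrank k (LinearMap.range (leadingCoeffMap h D ht)) := by
  have key : ∀ (t : K) (ht : P.IsParam t),
      Module.Finite k (D + Finsupp.single P 1).riemannRochSpace ∧
      (D + Finsupp.single P 1).ell = D.ell +
        Module.finrank k (LinearMap.range (leadingCoeffMap h D ht)) := by
    intro t ht
    have := h.finite_residueField P
    have hle : D.riemannRochSpace ≤ (D + Finsupp.single P 1).riemannRochSpace :=
      riemannRochSpace_mono h (le_add_of_nonneg_right (Divisor.single_nonneg P zero_le_one))
    have hker : LinearMap.ker (leadingCoeffMap h D ht) =
        LinearMap.range (Submodule.inclusion hle) := by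
      ext f
      rw [LinearMap.mem_ker, leadingCoeffMap_eq_zero, Submodule.range_inclusion,
        Submodule.mem_comap, Submodule.subtype_apply]
    have e : D.riemannRochSpace ≃ₗ[k] LinearMap.ker (leadingCoeffMap h D ht) :=
      (LinearEquiv.ofInjective _ (Submodule.inclusion_injective hle)).trans
        (LinearEquiv.ofEq _ _ hker.symm)
    have hkf : Module.Finite k (LinearMap.ker (leadingCoeffMap h D ht)) := Module.Finite.equiv e
    have := Module.Finite.equiv (LinearMap.quotKerEquivRange (leadingCoeffMap h D ht)).symm
    have hfin : Module.Finite k (D + Finsupp.single P 1).riemannRochSpace :=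
      Module.Finite.of_submodule_quotient (LinearMap.ker (leadingCoeffMap h D ht))
    refine ⟨hfin, ?_⟩
    rw [Divisor.ell, Divisor.ell, ← LinearMap.finrank_range_add_finrank_ker (leadingCoeffMap h D ht),
      e.finrank_eq, add_comm]
  obtain ⟨t, ht⟩ := h.exists_isParam P
  exact ⟨(key t ht).1, fun t ht => (key t ht).2⟩

theorem ell_add_single_le (h : IsCurve k K) {D : Divisor k K} (P : Place k K)
    (hD : Module.Finite k D.riemannRochSpace) :
    (D + Finsupp.single P 1).ell ≤ D.ell + P.degree := by
  obtain ⟨t, ht⟩ := h.exists_isParam P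
  have := h.finite_residueField P
  rw [(finite_riemannRochSpace_add_single h P hD).2 t ht]
  exact Nat.add_le_add_left (Submodule.finrank_le _) _

/-- Exchanges a dimension count for the existence of functions with prescribed leading coefficient.
Approximation uses one direction, the projective line the other. -/
theorem ell_add_single_eq (h : IsCurve k K) {D : Divisor k K} {P : Place k K} {t : K}
    (ht : P.IsParam t) (hD : Module.Finite k D.riemannRochSpace) :
    (D + Finsupp.single P 1).ell = D.ell + P.degree ↔
      Function.Surjective (leadingCoeffMap h D ht) := by
  have := h.finite_residueField P
  rw [(finite_riemannRochSpace_add_single h P hD).2 t ht, Nat.add_left_cancel_iff,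
    ← LinearMap.range_eq_top, Place.degree]
  exact ⟨Submodule.eq_top_of_finrank_eq, fun h => by rw [h, finrank_top]⟩

/-- `deg D - ℓ(D)` is a monotone function of `D`. -/
theorem degree_sub_ell_mono (h : IsCurve k K) {D D' : Divisor k K} (hD : D ≤ D')
    (hfin : Module.Finite k D.riemannRochSpace) :
    Module.Finite k D'.riemannRochSpace ∧
      D.degree - (D.ell : ℤ) ≤ D'.degree - (D'.ell : ℤ) := by
  refine Divisor.induction_ge (p := fun D' => Module.Finite k D'.riemannRochSpace ∧
      D.degree - (D.ell : ℤ) ≤ D'.degree - (D'.ell : ℤ)) ⟨hfin, le_rfl⟩ ?_ hD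
  intro D' _ P ih
  refine ⟨(finite_riemannRochSpace_add_single h P ih.1).1, ih.2.trans ?_⟩
  have := ell_add_single_le h P ih.1
  rw [Divisor.degree_add, Divisor.degree_single]
  zify at this
  linarith

/-- The genus as the value of `deg D + 1 - ℓ(D)` on a cofinal set of divisors. -/
def HasGenus (k K : Type*) [Field k] [Field K] [Algebra k K] (g : ℤ) : Prop :=
  ∀ D : Divisor k K, ∃ D', D ≤ D' ∧ Module.Finite k D'.riemannRochSpace ∧
    D'.degree + 1 - (D'.ell : ℤ) = g

theorem HasGenus.finite {g : ℤ} (h : IsCurve k K) (hg : HasGenus k K g) (D : Divisor k K) :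
    Module.Finite k D.riemannRochSpace := by
  obtain ⟨D', hD, hfin, -⟩ := hg D
  exact Submodule.finiteDimensional_of_le (riemannRochSpace_mono h hD)

/-- Monotonicity of deg D − ℓ(D) turns a constant value on a cofinal family into the maximum. -/
theorem HasGenus.isGenus {g : ℤ} (h : IsCurve k K) (hg : HasGenus k K g) : IsGenus k K g := by
  constructor
  · obtain ⟨D, -, -, hD⟩ := hg 0
    exact ⟨D, hD⟩
  · rintro _ ⟨D, rfl⟩
    obtain ⟨D', hD, -, rfl⟩ := hg D
    have := (degree_sub_ell_mono h hD (hg.finite h D)).2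
    dsimp only
    linarith

/-- A divisor above D₀ is squeezed between D₀ and a member of the cofinal family, both of value g.
-/
theorem HasGenus.exists_forall_ge {g : ℤ} (h : IsCurve k K) (hg : HasGenus k K g) :
    ∃ D₀ : Divisor k K, ∀ D, D₀ ≤ D → D.degree + 1 - (D.ell : ℤ) = g := by
  obtain ⟨D₀, -, -, h0⟩ := hg 0
  refine ⟨D₀, fun D hD => ?_⟩
  obtain ⟨D', hD', -, h'⟩ := hg D
  have h1 := (degree_sub_ell_mono h hD (hg.finite h D₀)).2
  have h2 := (degree_sub_ell_mono h hD' (hg.finite h D)).2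
  linarith

/-- Approximation at one point by functions that are regular relative to `D` elsewhere. -/
theorem exists_approx_at {g : ℤ} (h : IsCurve k K) (hg : HasGenus k K g) {D₀ : Divisor k K}
    (h0 : ∀ D, D₀ ≤ D → D.degree + 1 - (D.ell : ℤ) = g) {t : Place k K → K}
    (ht : ∀ P : Place k K, P.IsParam (t P)) {D : Divisor k K} (hD : D₀ ≤ D)
    (P : Place k K) (f : K) :
    ∃ a : K, a - f ∈ P.polar (t P) (D P) ∧ ∀ Q ≠ P, a ∈ Q.polar (t Q) (D Q) := by
  obtain ⟨N, hN⟩ := Place.exists_mem_polar (ht P) f (D P)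
  induction N generalizing f with
  | zero =>
    refine ⟨0, ?_, fun Q _ => zero_mem _⟩
    rw [zero_sub]
    exact neg_mem (by simpa using hN)
  | succ N ih =>
    set D' : Divisor k K := D + Finsupp.single P (N : ℤ) with hD'
    have hDD' : D ≤ D' := le_add_of_nonneg_right (Divisor.single_nonneg P (Int.natCast_nonneg N))
    have hD'P : D' P = D P + N := by rw [hD', Finsupp.add_apply, Finsupp.single_eq_same]
    -- Above D₀ the number deg D − ℓ(D) is constant, so adding P raises ℓ by all of deg P. The
    -- leading term of f can then be removed by some b in L(D' + P), and the pole order of f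
    -- relative to D drops.
    have hsurj : Function.Surjective (leadingCoeffMap h D' (ht P)) := by
      rw [← ell_add_single_eq h (ht P) (hg.finite h D')]
      have h1 := h0 D' (hD.trans hDD')
      have h2 := h0 (D' + Finsupp.single P 1) ((hD.trans hDD').trans
        (le_add_of_nonneg_right (Divisor.single_nonneg P zero_le_one)))
      rw [Divisor.degree_add, Divisor.degree_single] at h2
      zify
      linarith
    have hf : f ∈ P.polar (t P) (D' P + 1) := by
      rw [hD'P, add_assoc]
      exact_mod_cast hN
    obtain ⟨b, hb⟩ := hsurj (P.leadingCoeff (t P) (D' P + 1) ⟨f, hf⟩)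
    have hbf : f - b ∈ P.polar (t P) (D P + N) := by
      rw [← hD'P]
      have hbP := riemannRochSpace_add_single_le_polar h D' (ht P) b.2
      refine (Place.leadingCoeff_eq_zero (ht P) (f := ⟨f, hf⟩ - ⟨(b : K), hbP⟩)).1 ?_
      rw [map_sub, ← hb, sub_eq_zero]
      rfl
    obtain ⟨a, ha, ha'⟩ := ih (f - b) hbf
    refine ⟨a + b, by convert ha using 1; ring, fun Q hQ => add_mem (ha' Q hQ) ?_⟩
    have := (mem_riemannRochSpace_iff_polar h ht).1 b.2 Q
    have hQD : (D' + Finsupp.single P 1 : Divisor k K) Q = D Q := by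
      rw [hD', Finsupp.add_apply, Finsupp.add_apply, Finsupp.single_eq_of_ne hQ,
        Finsupp.single_eq_of_ne hQ, add_zero, add_zero]
    rwa [hQD] at this

/-- Approximation at finitely many points. -/
theorem exists_approx {g : ℤ} (h : IsCurve k K) (hg : HasGenus k K g) {D₀ : Divisor k K}
    (h0 : ∀ D, D₀ ≤ D → D.degree + 1 - (D.ell : ℤ) = g) {t : Place k K → K}
    (ht : ∀ P : Place k K, P.IsParam (t P)) {D : Divisor k K} (hD : D₀ ≤ D)
    (f : Place k K → K) (hf : {P | f P ≠ 0}.Finite) :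
    ∃ a : K, ∀ P, a - f P ∈ P.polar (t P) (D P) := by
  classical
  choose a ha ha' using fun P => exists_approx_at h hg h0 ht hD P (f P)
  refine ⟨∑ P ∈ hf.toFinset, a P, fun P => ?_⟩
  by_cases hP : P ∈ hf.toFinset
  · rw [← Finset.add_sum_erase _ _ hP, add_sub_right_comm]
    refine add_mem (ha P) (sum_mem fun Q hQ => ha' Q P ?_)
    exact (Finset.ne_of_mem_erase hQ).symm
  · have hP0 : f P = 0 := by simpa using hP
    rw [hP0, sub_zero]
    refine sum_mem fun Q hQ => ha' Q P ?_
    rintro rfl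
    exact hP hQ

end RiemannRoch

/-! ### Points in an algebraic extension -/

section Extension

variable {k K K' : Type*} [Field k] [Field K] [Field K'] [Algebra k K] [Algebra k K']
  [Algebra K K'] [IsScalarTower k K K'] [Algebra.IsAlgebraic K K']

/-- The image of a point under the morphism of curves given by `K ⊆ K'`. -/
def Place.under (K : Type*) [Field K] [Algebra k K] [Algebra K K'] [IsScalarTower k K K']
    [Algebra.IsAlgebraic K K'] (Q : Place k K') : Place k K where
  ring := Q.ring.comap (algebraMap K K')
  algebraMap_mem a := by
    rw [ValuationSubring.mem_comap, ← IsScalarTower.algebraMap_apply]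
    exact Q.algebraMap_mem a
  -- If the ring of Q contained K, every f would be integral over it; valuation rings are integrally
  -- closed.
  ne_top h := Q.ne_top (by
    have hK : ∀ a : K, algebraMap K K' a ∈ Q.ring := fun a => by
      rw [← ValuationSubring.mem_comap, h]
      exact ValuationSubring.mem_top a
    ext f
    refine ⟨fun _ => ValuationSubring.mem_top f, fun _ => ?_⟩
    have hf : IsIntegral K f := (Algebra.IsAlgebraic.isAlgebraic f).isIntegral
    let φ : K →+* Q.ring := (algebraMap K K').codRestrict Q.ring hK
    obtain ⟨p, hp, hpf⟩ := hf
    have hf' : IsIntegral Q.ring f := ⟨p.map φ, hp.map φ, by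
      rw [Polynomial.eval₂_map]
      exact hpf⟩
    obtain ⟨g, rfl⟩ := IsIntegrallyClosed.isIntegral_iff.1 hf'
    exact g.2)

variable {P : Place k K} {Q : Place k K'}

theorem Place.v_le_one_iff (hQ : Q.under K = P) {a : K} :
    Q.v (algebraMap K K' a) ≤ 1 ↔ P.v a ≤ 1 := by
  subst hQ
  rw [← Place.mem_ring, ← Place.mem_ring]
  exact Iff.rfl

theorem Place.v_lt_one_iff (hQ : Q.under K = P) {a : K} :
    Q.v (algebraMap K K' a) < 1 ↔ P.v a < 1 := by
  rcases eq_or_ne a 0 with rfl | ha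
  · simp
  have h1 : 0 < P.v a := by simpa [zero_lt_iff] using ha
  have h2 : 0 < Q.v (algebraMap K K' a) := by simpa [zero_lt_iff] using ha
  have := Place.v_le_one_iff hQ (a := a⁻¹)
  rw [map_inv₀, map_inv₀, map_inv₀, inv_le_one₀ h2, inv_le_one₀ h1] at this
  rw [← not_le, ← not_le, this]

theorem Place.v_eq_one_iff (hQ : Q.under K = P) {a : K} :
    Q.v (algebraMap K K' a) = 1 ↔ P.v a = 1 := by
  rw [eq_iff_le_not_lt, eq_iff_le_not_lt, Place.v_le_one_iff hQ, Place.v_lt_one_iff hQ]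

/-- The value groups of P and Q are different types, so the relation is transported through the unit
a / t ^ n. -/
theorem Place.v_eq_zpow (hQ : Q.under K = P) {a t : K} (ht : t ≠ 0) {n : ℤ} (h : P.v a = P.v t ^ n) :
    Q.v (algebraMap K K' a) = Q.v (algebraMap K K' t) ^ n := by
  have h1 : P.v (a / t ^ n) = 1 := by
    rw [map_div₀, map_zpow₀, h]
    exact div_self (zpow_ne_zero _ (by simpa using ht))
  rw [← Place.v_eq_one_iff hQ, map_div₀, map_zpow₀, map_div₀, map_zpow₀,
    div_eq_one_iff_eq (zpow_ne_zero _ (by simpa using ht))] at h1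
  exact h1

/-- Every point has a preimage. -/
theorem Place.exists_under_eq (P : Place k K) : ∃ Q : Place k K', Q.under K = P := by
  -- A valuation ring dominating the local ring of P meets K in exactly that ring: if a is in A but
  -- not regular at P, then a⁻¹ is regular at P and a unit in A, hence already a unit at P.
  obtain ⟨A, hA, hloc⟩ := IsLocalRing.exists_factor_valuationRing
    ((algebraMap K K').comp P.ring.subtype)
  have hmem : ∀ a : K, algebraMap K K' a ∈ A ↔ a ∈ P.ring := by
    intro a
    refine ⟨fun ha => ?_, fun ha => hA ⟨a, ha⟩⟩
    by_contra hna
    have ha0 : a ≠ 0 := by rintro rfl; exact hna P.ring.zero_mem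
    have hinv : a⁻¹ ∈ P.ring := (P.ring.mem_or_inv_mem a).resolve_left hna
    have hu : IsUnit (⟨a⁻¹, hinv⟩ : P.ring) := by
      apply hloc.map_nonunit
      refine IsUnit.of_mul_eq_one ⟨algebraMap K K' a, ha⟩ (Subtype.ext ?_)
      change algebraMap K K' a⁻¹ * algebraMap K K' a = 1
      rw [← map_mul, inv_mul_cancel₀ ha0, map_one]
    obtain ⟨b, hb⟩ := hu.exists_right_inv
    have hb' : a⁻¹ * (b : K) = 1 := congrArg Subtype.val hb
    apply hna
    have : a = b := by
      field_simp at hb'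
      exact hb'.symm
    rw [this]
    exact b.2
  refine ⟨⟨A, fun a => ?_, fun h => P.ne_top ?_⟩, ?_⟩
  · rw [IsScalarTower.algebraMap_apply k K K', hmem]
    exact P.algebraMap_mem a
  · ext a
    refine ⟨fun _ => ValuationSubring.mem_top a, fun _ => ?_⟩
    rw [← hmem, h]
    exact ValuationSubring.mem_top _
  · apply Place.eq_of_ring_eq
    ext a
    exact hmem a

/-- The inclusion of local rings at a point and its image. -/
def Place.ringMap (Q : Place k K') : (Q.under K).ring →+* Q.ring :=
  ((algebraMap K K').comp (Q.under K).ring.subtype).codRestrict Q.ring fun a => a.2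

instance (Q : Place k K') : IsLocalHom (Place.ringMap (K := K) Q) where
  map_nonunit a ha := by
    rw [ValuationSubring.valuation_eq_one_iff] at ha ⊢
    exact (Place.v_eq_one_iff rfl).1 ha

/-- The inclusion of residue fields at a point and its image. -/
def Place.residueMap (Q : Place k K') :
    ResidueField (Q.under K).ring →ₗ[k] ResidueField Q.ring where
  toFun := ResidueField.map (Place.ringMap (K := K) Q)
  map_add' := map_add _
  map_smul' c a := by
    rw [RingHom.id_apply, Algebra.smul_def, Algebra.smul_def, map_mul]
    congr 1
    change ResidueField.map _ (residue _ (algebraMap k (Q.under K).ring c)) =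
      residue _ (algebraMap k Q.ring c)
    rw [ResidueField.map_residue]
    congr 1
    exact Subtype.ext (IsScalarTower.algebraMap_apply k K K' c).symm

theorem Place.residueMap_residue (Q : Place k K') {a : K} (ha : a ∈ (Q.under K).ring) :
    Place.residueMap Q (residue _ (⟨a, ha⟩ : (Q.under K).ring)) =
      residue Q.ring ⟨algebraMap K K' a, ha⟩ := rfl

theorem Place.residue_eq_iff {k K : Type*} [Field k] [Field K] [Algebra k K] {P : Place k K}
    {f g : P.ring} : residue P.ring f = residue P.ring g ↔ P.v (f - g : K) < 1 := by
  rw [← sub_eq_zero, ← map_sub, Place.residue_eq_zero_iff]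
  rfl

theorem Place.degree_eq_of_residue (hQ : Q.under K = P)
    (h : ∀ f : K', Q.v f ≤ 1 → ∃ a : K, P.v a ≤ 1 ∧ Q.v (f - algebraMap K K' a) < 1)
    (hfin : Module.Finite k (ResidueField P.ring)) :
    Module.Finite k (ResidueField Q.ring) ∧ Q.degree = P.degree := by
  subst hQ
  have hb : Function.Bijective (Place.residueMap (K := K) Q) := by
    constructor
    · exact (ResidueField.map (Place.ringMap (K := K) Q)).injective
    · intro c
      obtain ⟨f, rfl⟩ := residue_surjective c
      obtain ⟨a, ha, haf⟩ := h f (Q.ring.valuation_le_one f)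
      refine ⟨residue _ ⟨a, Place.mem_ring.2 ha⟩, ?_⟩
      rw [Place.residueMap_residue, eq_comm, Place.residue_eq_iff]
      exact haf
  let e := LinearEquiv.ofBijective _ hb
  exact ⟨Module.Finite.equiv e, e.finrank_eq.symm⟩

/-- The hypotheses say that 1 and the residue of z form a basis of the residue field at Q over that
at P. -/
theorem Place.degree_eq_two_mul (hQ : Q.under K = P) {z : K'} (hz : Q.v z ≤ 1)
    (h : ∀ f : K', Q.v f ≤ 1 → ∃ a b : K, P.v a ≤ 1 ∧ P.v b ≤ 1 ∧
      Q.v (f - (algebraMap K K' a + algebraMap K K' b * z)) < 1)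
    (hinj : ∀ a b : K, P.v a ≤ 1 → P.v b ≤ 1 →
      Q.v (algebraMap K K' a + algebraMap K K' b * z) < 1 → P.v a < 1 ∧ P.v b < 1)
    (hfin : Module.Finite k (ResidueField P.ring)) :
    Module.Finite k (ResidueField Q.ring) ∧ Q.degree = 2 * P.degree := by
  subst hQ
  let ζ : ResidueField Q.ring := residue Q.ring ⟨z, Place.mem_ring.2 hz⟩
  let φ : ResidueField (Q.under K).ring × ResidueField (Q.under K).ring →ₗ[k]
      ResidueField Q.ring :=
    Place.residueMap Q ∘ₗ LinearMap.fst k _ _ +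
      LinearMap.mulRight k ζ ∘ₗ Place.residueMap Q ∘ₗ LinearMap.snd k _ _
  have hφ : ∀ (a b : K) (ha : a ∈ (Q.under K).ring) (hb : b ∈ (Q.under K).ring),
      φ (residue _ ⟨a, ha⟩, residue _ ⟨b, hb⟩) = residue Q.ring (⟨algebraMap K K' a, ha⟩ +
        ⟨algebraMap K K' b, hb⟩ * ⟨z, Place.mem_ring.2 hz⟩) := by
    intro a b ha hb
    rw [map_add, map_mul]
    rfl
  have hb : Function.Bijective φ := by
    constructor
    · rw [← LinearMap.ker_eq_bot, LinearMap.ker_eq_bot']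
      rintro ⟨a, b⟩ hab
      obtain ⟨⟨a, ha⟩, rfl⟩ := residue_surjective a
      obtain ⟨⟨b, hb⟩, rfl⟩ := residue_surjective b
      rw [hφ, Place.residue_eq_zero_iff] at hab
      obtain ⟨h1, h2⟩ := hinj a b (Place.mem_ring.1 ha) (Place.mem_ring.1 hb) hab
      rw [Prod.mk_eq_zero, Place.residue_eq_zero_iff, Place.residue_eq_zero_iff]
      exact ⟨h1, h2⟩
    · intro c
      obtain ⟨f, rfl⟩ := residue_surjective c
      obtain ⟨a, b, ha, hb, habf⟩ := h f (Q.ring.valuation_le_one f)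
      refine ⟨(residue _ ⟨a, Place.mem_ring.2 ha⟩, residue _ ⟨b, Place.mem_ring.2 hb⟩), ?_⟩
      rw [hφ, eq_comm, Place.residue_eq_iff]
      exact habf
  let e := LinearEquiv.ofBijective _ hb
  refine ⟨Module.Finite.equiv e, ?_⟩
  rw [Place.degree, ← e.finrank_eq, Module.finrank_prod, Place.degree, two_mul]

end Extension

/-! ### Values of z² + z -/

section ArtinSchreierValuation

variable {K Γ : Type*} [Field K] [LinearOrderedCommGroupWithZero Γ] (v : Valuation K Γ)

theorem mul_lt_one_of_le_one_of_lt_one {x y : Γ} (hx : x ≤ 1) (hy : y < 1) : x * y < 1 :=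
  lt_of_le_of_lt (mul_le_of_le_one_left' hx) hy

theorem valuation_sq_add_of_one_lt {z : K} (hz : 1 < v z) : v (z ^ 2 + z) = v z ^ 2 := by
  rw [← map_pow]
  refine v.map_add_eq_of_lt_left ?_
  rw [map_pow, sq]
  exact lt_mul_of_one_lt_left (zero_lt_one.trans hz) hz

/-- At a pole of z the square dominates, so z² + z has a pole as well. -/
theorem valuation_sq_add_le_one {z : K} : v (z ^ 2 + z) ≤ 1 ↔ v z ≤ 1 := by
  constructor
  · intro h
    by_contra! hz
    rw [valuation_sq_add_of_one_lt v hz] at h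
    exact absurd h (not_le.2 (one_lt_pow₀ hz two_ne_zero))
  · intro h
    refine v.map_add_le ?_ h
    rw [map_pow]
    exact pow_le_one₀ zero_le h

end ArtinSchreierValuation

/-! ### Quadratic Artin–Schreier extensions -/

section Quadratic

set_option linter.unusedSectionVars false

/-- `K'` is the quadratic Artin–Schreier extension of `K` generated by a root `z` of
`z² + z = c`. -/
structure IsArtinSchreier (K : Type*) {K' : Type*} [Field K] [Field K'] [Algebra K K']
    (z : K') (c : K) : Prop where
  equation : z ^ 2 + z = algebraMap K K' c
  exists_eq : ∀ f : K', ∃ a b : K, f = algebraMap K K' a + algebraMap K K' b * z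
  eq_zero : ∀ a b : K, algebraMap K K' a + algebraMap K K' b * z = 0 → a = 0 ∧ b = 0

variable {k K K' : Type*} [Field k] [Field K] [Field K'] [Algebra k K] [Algebra k K']
  [Algebra K K'] [IsScalarTower k K K'] [CharP K 2]

theorem IsArtinSchreier.isAlgebraic {z : K'} {c : K} (h : IsArtinSchreier K z c) :
    Algebra.IsAlgebraic K K' := by
  have hz : IsIntegral K z := by
    refine ⟨Polynomial.X ^ 2 + Polynomial.X - Polynomial.C c, by monicity!, ?_⟩
    simp [h.equation]
  refine ⟨fun f => ?_⟩
  obtain ⟨a, b, rfl⟩ := h.exists_eq f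
  exact (isIntegral_algebraMap.add (isIntegral_algebraMap.mul hz)).isAlgebraic

variable {z : K'} {c : K}

theorem IsArtinSchreier.two_eq_zero (_ : IsArtinSchreier K z c) : (2 : K') = 0 := by
  have : algebraMap K K' 2 = 2 := map_ofNat _ 2
  rw [← this, CharTwo.two_eq_zero, map_zero]

/-- The map w ↦ w² + w is additive in characteristic 2. This change of generator brings the equation
into standard form at a given point. -/
theorem IsArtinSchreier.shift (h : IsArtinSchreier K z c) (w : K) :
    IsArtinSchreier K (z + algebraMap K K' w) (c + (w ^ 2 + w)) where
  equation := by
    rw [map_add, ← h.equation, map_add, map_pow]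
    linear_combination z * algebraMap K K' w * h.two_eq_zero
  exists_eq f := by
    obtain ⟨a, b, rfl⟩ := h.exists_eq f
    exact ⟨a - b * w, b, by rw [map_sub, map_mul]; ring⟩
  eq_zero a b hab := by
    obtain ⟨h1, h2⟩ := h.eq_zero (a + b * w) b (by rw [← hab, map_add, map_mul]; ring)
    subst h2
    exact ⟨by simpa using h1, rfl⟩

theorem IsArtinSchreier.add_one (h : IsArtinSchreier K z c) : IsArtinSchreier K (z + 1) c := by
  have := h.shift 1
  rwa [map_one, one_pow, CharTwo.add_self_eq_zero, add_zero] at this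

/-- Elements of a quadratic extension are multiples of elements with coprime coefficients. -/
theorem IsArtinSchreier.exists_primitive (h : IsArtinSchreier K z c) (P : Place k K) {f : K'}
    (hf : f ≠ 0) : ∃ d a b : K, d ≠ 0 ∧ P.v a ≤ 1 ∧ P.v b ≤ 1 ∧ (P.v a = 1 ∨ P.v b = 1) ∧
      f = algebraMap K K' d * (algebraMap K K' a + algebraMap K K' b * z) := by
  obtain ⟨a, b, rfl⟩ := h.exists_eq f
  have hab : ¬ (a = 0 ∧ b = 0) := by
    rintro ⟨rfl, rfl⟩
    simp at hf
  have key : ∀ d : K, d ≠ 0 → P.v a ≤ P.v d → P.v b ≤ P.v d → (P.v a = P.v d ∨ P.v b = P.v d) →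
      ∃ d a' b' : K, d ≠ 0 ∧ P.v a' ≤ 1 ∧ P.v b' ≤ 1 ∧ (P.v a' = 1 ∨ P.v b' = 1) ∧
      algebraMap K K' a + algebraMap K K' b * z =
        algebraMap K K' d * (algebraMap K K' a' + algebraMap K K' b' * z) := by
    intro d hd ha hb hor
    have hd' : P.v d ≠ 0 := by simpa using hd
    have hd'' : algebraMap K K' d ≠ 0 := by simpa using hd
    refine ⟨d, a / d, b / d, hd, ?_, ?_, ?_, ?_⟩
    · rw [map_div₀]
      exact div_le_one_of_le₀ ha zero_le
    · rw [map_div₀]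
      exact div_le_one_of_le₀ hb zero_le
    · rwa [map_div₀, map_div₀, div_eq_one_iff_eq hd', div_eq_one_iff_eq hd']
    · rw [map_div₀, map_div₀]
      field_simp
  rcases le_total (P.v a) (P.v b) with hle | hle
  · refine key b ?_ hle le_rfl (Or.inr rfl)
    rintro rfl
    rw [map_zero, le_zero_iff, map_eq_zero] at hle
    exact hab ⟨hle, rfl⟩
  · refine key a ?_ le_rfl hle (Or.inl rfl)
    rintro rfl
    rw [map_zero, le_zero_iff, map_eq_zero] at hle
    exact hab ⟨rfl, hle⟩

variable [Algebra.IsAlgebraic K K'] {P : Place k K} {Q : Place k K'}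

/-- The second factor is the conjugate of the first under z ↦ z + 1. -/
theorem IsArtinSchreier.norm_eq (h : IsArtinSchreier K z c) (a b : K) :
    (algebraMap K K' a + algebraMap K K' b * z) *
      (algebraMap K K' (a + b) + algebraMap K K' b * z) =
      algebraMap K K' (a ^ 2 + a * b + b ^ 2 * c) := by
  simp only [map_add, map_mul, map_pow, ← h.equation]
  linear_combination algebraMap K K' a * algebraMap K K' b * z * h.two_eq_zero

namespace IsArtinSchreier

theorem v_le_one (h : IsArtinSchreier K z c) (hc : P.v c ≤ 1) (hQ : Q.under K = P) :
    Q.v z ≤ 1 := by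
  rw [← valuation_sq_add_le_one, h.equation, Place.v_le_one_iff hQ]
  exact hc

theorem v_linear_le_one (h : IsArtinSchreier K z c) (hc : P.v c ≤ 1) (hQ : Q.under K = P)
    {a b : K} (ha : P.v a ≤ 1) (hb : P.v b ≤ 1) :
    Q.v (algebraMap K K' a + algebraMap K K' b * z) ≤ 1 := by
  refine Q.v.map_add_le ((Place.v_le_one_iff hQ).2 ha) ?_
  rw [map_mul]
  exact mul_le_one' ((Place.v_le_one_iff hQ).2 hb) (h.v_le_one hc hQ)

/-- If a + b z vanishes at Q, then b must be a unit. The conjugate differs from a + b z by b and so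
is a unit too, and the norm carries the whole value. Values on K' are thereby computed in K. -/
theorem v_primitive (h : IsArtinSchreier K z c) (hc : P.v c ≤ 1) (hQ : Q.under K = P)
    {a b : K} (ha : P.v a ≤ 1) (hb : P.v b ≤ 1) (hab : P.v a = 1 ∨ P.v b = 1) :
    Q.v (algebraMap K K' a + algebraMap K K' b * z) = 1 ∨
      (P.v b = 1 ∧ Q.v (algebraMap K K' (a + b) + algebraMap K K' b * z) = 1 ∧
      Q.v (algebraMap K K' a + algebraMap K K' b * z) =
        Q.v (algebraMap K K' (a ^ 2 + a * b + b ^ 2 * c))) := by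
  rcases (h.v_linear_le_one hc hQ ha hb).lt_or_eq with hlt | heq
  · right
    have hb1 : P.v b = 1 := by
      by_contra hb1
      have hb' : Q.v (algebraMap K K' b) < 1 := (Place.v_lt_one_iff hQ).2 (lt_of_le_of_ne hb hb1)
      have ha1 : Q.v (algebraMap K K' a) = 1 :=
        (Place.v_eq_one_iff hQ).2 (hab.resolve_right hb1)
      have hbz : Q.v (algebraMap K K' b * z) < 1 := by
        rw [map_mul]
        exact mul_lt_one_of_lt_of_le hb' (h.v_le_one hc hQ)
      rw [Q.v.map_add_eq_of_lt_left (by rwa [ha1]), ha1] at hlt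
      exact lt_irrefl _ hlt
    have hb1' : Q.v (algebraMap K K' b) = 1 := (Place.v_eq_one_iff hQ).2 hb1
    have hconj : Q.v (algebraMap K K' (a + b) + algebraMap K K' b * z) = 1 := by
      have : algebraMap K K' (a + b) + algebraMap K K' b * z =
          algebraMap K K' b + (algebraMap K K' a + algebraMap K K' b * z) := by
        rw [map_add]
        ring
      rw [this, Q.v.map_add_eq_of_lt_left (by rwa [hb1']), hb1']
    refine ⟨hb1, hconj, ?_⟩
    rw [← h.norm_eq, map_mul, hconj, mul_one]
  · exact Or.inl heq

theorem norm_ne_zero (h : IsArtinSchreier K z c) {a b : K} (hab : ¬ (a = 0 ∧ b = 0)) :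
    a ^ 2 + a * b + b ^ 2 * c ≠ 0 := by
  intro hN
  have := h.norm_eq a b
  rw [hN, map_zero, mul_eq_zero] at this
  rcases this with h1 | h1
  · exact hab (h.eq_zero _ _ h1)
  · obtain ⟨h2, rfl⟩ := h.eq_zero _ _ h1
    exact hab ⟨by simpa using h2, rfl⟩

/-- At an unramified point the value group does not change. -/
theorem isParam_of_unramified (h : IsArtinSchreier K z c) (hc : P.v c ≤ 1) (hQ : Q.under K = P)
    {t : K} (ht : P.IsParam t) : Q.IsParam (algebraMap K K' t) := by
  refine ⟨(Place.v_lt_one_iff hQ).2 ht.1, fun f hf => ?_⟩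
  have key : ∃ g : K, g ≠ 0 ∧ Q.v f = Q.v (algebraMap K K' g) := by
    obtain ⟨d, a, b, hd, ha, hb, hab, rfl⟩ := h.exists_primitive P hf
    rcases h.v_primitive hc hQ ha hb hab with h1 | ⟨hb1, -, h1⟩
    · exact ⟨d, hd, by rw [map_mul, h1, mul_one]⟩
    · refine ⟨d * (a ^ 2 + a * b + b ^ 2 * c), mul_ne_zero hd (h.norm_ne_zero ?_), ?_⟩
      · rintro ⟨rfl, rfl⟩
        simp at hb1
      · rw [map_mul, h1, map_mul, map_mul]
  obtain ⟨g, hg, hfg⟩ := key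
  obtain ⟨n, hn⟩ := ht.2 g hg
  exact ⟨n, hfg.trans (Place.v_eq_zpow hQ ht.ne_zero hn)⟩

/-! ### Points over P at which z vanishes -/

section Split

theorem v_eq_one_of_split (_ : IsArtinSchreier K z c) (hQ : Q.under K = P)
    (hz : Q.v z < 1) {a b : K} (hb : P.v b ≤ 1) :
    Q.v (algebraMap K K' a + algebraMap K K' b * z) = 1 ↔ P.v a = 1 := by
  have hbz : Q.v (algebraMap K K' b * z) < 1 := by
    rw [map_mul]
    exact mul_lt_one_of_le_one_of_lt_one ((Place.v_le_one_iff hQ).2 hb) hz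
  rw [← Place.v_eq_one_iff hQ]
  constructor
  · intro h1
    have : algebraMap K K' a = (algebraMap K K' a + algebraMap K K' b * z) -
      algebraMap K K' b * z := by ring
    rw [this, Q.v.map_sub_eq_of_lt_left (by rwa [h1]), h1]
  · intro h1
    rw [Q.v.map_add_eq_of_lt_left (by rwa [h1]), h1]

/-- If z vanishes at Q, regularity of d (a + b z) is decided at P: by d if a is a unit, and by d
times the norm otherwise. The criterion is the same for Q'. -/
theorem ring_le_of_split (h : IsArtinSchreier K z c) (hc : P.v c < 1) (hQ : Q.under K = P)
    (hz : Q.v z < 1) {Q' : Place k K'} (hQ' : Q'.under K = P) (hz' : Q'.v z < 1) {f : K'}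
    (hf : f ∈ Q.ring) : f ∈ Q'.ring := by
  rcases eq_or_ne f 0 with rfl | hf0
  · exact Q'.ring.zero_mem
  obtain ⟨d, a, b, hd, ha, hb, hab, rfl⟩ := h.exists_primitive P hf0
  rw [Place.mem_ring] at hf ⊢
  by_cases ha1 : P.v a = 1
  · rw [map_mul, (h.v_eq_one_of_split hQ' hz' hb).2 ha1, mul_one, Place.v_le_one_iff hQ']
    rwa [map_mul, (h.v_eq_one_of_split hQ hz hb).2 ha1, mul_one, Place.v_le_one_iff hQ] at hf
  · have h1 := (h.v_primitive hc.le hQ ha hb hab).resolve_left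
      fun h2 => ha1 ((h.v_eq_one_of_split hQ hz hb).1 h2)
    have h1' := (h.v_primitive hc.le hQ' ha hb hab).resolve_left
      fun h2 => ha1 ((h.v_eq_one_of_split hQ' hz' hb).1 h2)
    rw [map_mul, h1'.2.2, ← map_mul, ← map_mul, Place.v_le_one_iff hQ']
    rwa [map_mul, h1.2.2, ← map_mul, ← map_mul, Place.v_le_one_iff hQ] at hf

theorem eq_of_split (h : IsArtinSchreier K z c) (hc : P.v c < 1) (hQ : Q.under K = P)
    (hz : Q.v z < 1) {Q' : Place k K'} (hQ' : Q'.under K = P) (hz' : Q'.v z < 1) : Q = Q' :=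
  Place.eq_of_ring_eq (SetLike.ext fun _ =>
    ⟨h.ring_le_of_split hc hQ hz hQ' hz', h.ring_le_of_split hc hQ' hz' hQ hz⟩)

theorem degree_of_split (h : IsArtinSchreier K z c) (hc : P.v c < 1) (hQ : Q.under K = P)
    (hz : Q.v z < 1) (hfin : Module.Finite k (ResidueField P.ring)) :
    Module.Finite k (ResidueField Q.ring) ∧ Q.degree = P.degree := by
  refine Place.degree_eq_of_residue hQ (fun f hf => ?_) hfin
  rcases eq_or_ne f 0 with rfl | hf0
  · exact ⟨0, by simp⟩
  obtain ⟨d, a, b, hd, ha, hb, hab, rfl⟩ := h.exists_primitive P hf0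
  by_cases ha1 : P.v a = 1
  · have h1 := (h.v_eq_one_of_split hQ hz hb).2 ha1
    have hd1 : Q.v (algebraMap K K' d) ≤ 1 := by rwa [map_mul, h1, mul_one] at hf
    refine ⟨d * a, ?_, ?_⟩
    · rw [map_mul]
      exact mul_le_one' ((Place.v_le_one_iff hQ).1 hd1) ha
    · have : algebraMap K K' d * (algebraMap K K' a + algebraMap K K' b * z) -
          algebraMap K K' (d * a) = algebraMap K K' (d * b) * z := by
        rw [map_mul, map_mul]
        ring
      rw [this, map_mul, map_mul, map_mul]
      exact mul_lt_one_of_le_one_of_lt_one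
        (mul_le_one' hd1 ((Place.v_le_one_iff hQ).2 hb)) hz
  · have hne : Q.v (algebraMap K K' a + algebraMap K K' b * z) ≠ 1 :=
      fun h2 => ha1 ((h.v_eq_one_of_split hQ hz hb).1 h2)
    obtain ⟨hb1, hconj, h1⟩ := (h.v_primitive hc.le hQ ha hb hab).resolve_left hne
    have hlt := lt_of_le_of_ne (h.v_linear_le_one hc.le hQ ha hb) hne
    have hb0 : b ≠ 0 := by rintro rfl; simp at hb1
    have hb0' : algebraMap K K' b ≠ 0 := by simpa using hb0
    have hconj0 : algebraMap K K' (a + b) + algebraMap K K' b * z ≠ 0 := by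
      intro h0
      rw [h0, map_zero] at hconj
      exact zero_ne_one hconj
    have hdN : Q.v (algebraMap K K' (d * (a ^ 2 + a * b + b ^ 2 * c))) ≤ 1 := by
      rwa [map_mul, h1, ← map_mul, ← map_mul] at hf
    -- With N the norm, d (a + b z) is d N divided by the conjugate, and the conjugate is congruent
    -- to b because a + b z vanishes.
    refine ⟨d * (a ^ 2 + a * b + b ^ 2 * c) / b, ?_, ?_⟩
    · rw [map_div₀, hb1, div_one]
      exact (Place.v_le_one_iff hQ).1 hdN
    · have : algebraMap K K' d * (algebraMap K K' a + algebraMap K K' b * z) -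
          algebraMap K K' (d * (a ^ 2 + a * b + b ^ 2 * c) / b) =
          -(algebraMap K K' (d * (a ^ 2 + a * b + b ^ 2 * c)) *
            (algebraMap K K' a + algebraMap K K' b * z)) /
            ((algebraMap K K' (a + b) + algebraMap K K' b * z) * algebraMap K K' b) := by
        rw [map_div₀, map_mul, ← h.norm_eq]
        field_simp
        rw [map_add]
        ring
      rw [this, map_div₀, Valuation.map_neg, map_mul, map_mul _ _ (algebraMap K K' b), hconj,
        (Place.v_eq_one_iff hQ).2 hb1, mul_one, div_one]
      exact mul_lt_one_of_le_one_of_lt_one hdN hlt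

/-- Existence of the point above a split point at which the generator vanishes. -/
theorem exists_split (h : IsArtinSchreier K z c) (hc : P.v c < 1) :
    ∃ Q : Place k K', Q.under K = P ∧ Q.v z < 1 := by
  -- A is O_P + O_P z and I is m_P + O_P z; I is closed under multiplication by A because c vanishes
  -- at P, and 1, z being independent it is proper. A valuation ring containing A whose nonunits
  -- contain I is the point sought.
  let A : Subring K' :=
    { carrier := {f | ∃ a b : K, P.v a ≤ 1 ∧ P.v b ≤ 1 ∧
        f = algebraMap K K' a + algebraMap K K' b * z}
      mul_mem' := by
        rintro _ _ ⟨a, b, ha, hb, rfl⟩ ⟨a', b', ha', hb', rfl⟩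
        refine ⟨a * a' + b * b' * c, a * b' + a' * b - b * b', ?_, ?_, ?_⟩
        · refine P.v.map_add_le ?_ ?_
          · rw [map_mul]; exact mul_le_one' ha ha'
          · rw [map_mul, map_mul]; exact mul_le_one' (mul_le_one' hb hb') hc.le
        · refine P.v.map_sub_le (P.v.map_add_le ?_ ?_) ?_
          · rw [map_mul]; exact mul_le_one' ha hb'
          · rw [map_mul]; exact mul_le_one' ha' hb
          · rw [map_mul]; exact mul_le_one' hb hb'
        · simp only [map_add, map_mul, map_sub, ← h.equation]
          ring
      one_mem' := ⟨1, 0, by simp⟩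
      add_mem' := by
        rintro _ _ ⟨a, b, ha, hb, rfl⟩ ⟨a', b', ha', hb', rfl⟩
        exact ⟨a + a', b + b', P.v.map_add_le ha ha', P.v.map_add_le hb hb',
          by rw [map_add, map_add]; ring⟩
      zero_mem' := ⟨0, 0, by simp⟩
      neg_mem' := by
        rintro _ ⟨a, b, ha, hb, rfl⟩
        exact ⟨-a, -b, by rwa [Valuation.map_neg], by rwa [Valuation.map_neg],
          by rw [map_neg, map_neg]; ring⟩ }
  let I : Ideal A :=
    { carrier := {f | ∃ a b : K, P.v a < 1 ∧ P.v b ≤ 1 ∧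
        (f : K') = algebraMap K K' a + algebraMap K K' b * z}
      add_mem' := by
        rintro ⟨_, _⟩ ⟨_, _⟩ ⟨a, b, ha, hb, rfl⟩ ⟨a', b', ha', hb', rfl⟩
        exact ⟨a + a', b + b', P.v.map_add_lt ha ha', P.v.map_add_le hb hb',
          by change _ + _ = _; rw [map_add, map_add]; ring⟩
      zero_mem' := ⟨0, 0, by simp⟩
      smul_mem' := by
        rintro ⟨_, a, b, ha, hb, rfl⟩ ⟨_, _⟩ ⟨a', b', ha', hb', rfl⟩
        refine ⟨a * a' + b * b' * c, a * b' + a' * b - b * b', ?_, ?_, ?_⟩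
        · refine P.v.map_add_lt ?_ ?_
          · rw [map_mul]; exact mul_lt_one_of_le_one_of_lt_one ha ha'
          · rw [map_mul, map_mul]
            exact mul_lt_one_of_le_one_of_lt_one (mul_le_one' hb hb') hc
        · refine P.v.map_sub_le (P.v.map_add_le ?_ ?_) ?_
          · rw [map_mul]; exact mul_le_one' ha hb'
          · rw [map_mul]; exact mul_le_one' ha'.le hb
          · rw [map_mul]; exact mul_le_one' hb hb'
        · change _ * _ = _
          simp only [map_add, map_mul, map_sub, ← h.equation]
          ring }
  have hI : I ≠ ⊤ := by
    rw [Ideal.ne_top_iff_one]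
    rintro ⟨a, b, ha, hb, hab⟩
    obtain ⟨h1, -⟩ := h.eq_zero (a - 1) b (by
      rw [map_sub, map_one, sub_add_eq_add_sub, ← hab]
      exact sub_self _)
    rw [sub_eq_zero.1 h1, map_one] at ha
    exact lt_irrefl _ ha
  obtain ⟨V, hAV, hIV⟩ := I.image_subset_nonunits_valuationSubring hI
  have hm : ∀ a b : K, P.v a < 1 → P.v b ≤ 1 →
      V.valuation (algebraMap K K' a + algebraMap K K' b * z) < 1 := fun a b ha hb =>
    V.mem_nonunits_iff.1 (hIV ⟨⟨_, a, b, ha.le, hb, rfl⟩, ⟨a, b, ha, hb, rfl⟩, rfl⟩)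
  have hmem : ∀ a : K, algebraMap K K' a ∈ V ↔ a ∈ P.ring := by
    intro a
    constructor
    · intro ha
      by_contra hna
      rw [Place.mem_ring, not_le] at hna
      have ha0 : a ≠ 0 := by rintro rfl; simp at hna
      have h1 := hm a⁻¹ 0 (by rw [map_inv₀]; exact inv_lt_one_of_one_lt₀ hna) (by simp)
      rw [map_zero, zero_mul, add_zero, map_inv₀, map_inv₀] at h1
      have h2 := (V.valuation_le_one_iff _).2 ha
      exact absurd (h1.trans_le' ((one_le_inv₀ (by simpa [zero_lt_iff] using ha0)).2 h2))
        (lt_irrefl _)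
    · intro ha
      exact hAV ⟨a, 0, Place.mem_ring.1 ha, by simp, by simp⟩
  refine ⟨⟨V, fun a => ?_, fun hV => P.ne_top ?_⟩, ?_, ?_⟩
  · rw [IsScalarTower.algebraMap_apply k K K', hmem]
    exact P.algebraMap_mem a
  · ext a
    refine ⟨fun _ => ValuationSubring.mem_top a, fun _ => ?_⟩
    rw [← hmem, hV]
    exact ValuationSubring.mem_top _
  · apply Place.eq_of_ring_eq
    ext a
    exact hmem a
  · simpa using hm 0 1 (by simp) (by simp)

end Split

/-! ### Points over P when z² + z = c has no root in the residue field -/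

section Inert

/-- For a unit b the norm is b² (c + r² + r) with r = a / b, and `hroot` makes the second factor a
unit. -/
theorem v_eq_one_of_inert (h : IsArtinSchreier K z c) (hc : P.v c ≤ 1) (hQ : Q.under K = P)
    (hroot : ∀ r : K, P.v r ≤ 1 → ¬ P.v (c + (r ^ 2 + r)) < 1) {a b : K} (ha : P.v a ≤ 1)
    (hb : P.v b ≤ 1) (hab : P.v a = 1 ∨ P.v b = 1) :
    Q.v (algebraMap K K' a + algebraMap K K' b * z) = 1 := by
  refine (h.v_primitive hc hQ ha hb hab).elim id fun ⟨hb1, hconj, h1⟩ => ?_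
  rw [h1, Place.v_eq_one_iff hQ]
  have hb0 : b ≠ 0 := by rintro rfl; simp at hb1
  have hr : P.v (a / b) ≤ 1 := by rwa [map_div₀, hb1, div_one]
  have : a ^ 2 + a * b + b ^ 2 * c = b ^ 2 * (c + ((a / b) ^ 2 + a / b)) := by
    field_simp
    ring
  rw [this, map_mul, map_pow, hb1, one_pow, one_mul]
  refine le_antisymm (P.v.map_add_le hc ((valuation_sq_add_le_one _).2 hr)) ?_
  exact not_lt.1 (hroot _ hr)

theorem v_le_one_iff_of_inert (h : IsArtinSchreier K z c) (hc : P.v c ≤ 1) (hQ : Q.under K = P)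
    (hroot : ∀ r : K, P.v r ≤ 1 → ¬ P.v (c + (r ^ 2 + r)) < 1) {a b : K} :
    Q.v (algebraMap K K' a + algebraMap K K' b * z) ≤ 1 ↔ P.v a ≤ 1 ∧ P.v b ≤ 1 := by
  constructor
  · intro hf
    by_cases h0 : algebraMap K K' a + algebraMap K K' b * z = 0
    · obtain ⟨rfl, rfl⟩ := h.eq_zero a b h0
      simp
    obtain ⟨d, a', b', hd, ha, hb, hab, heq⟩ := h.exists_primitive P h0
    rw [heq, map_mul, h.v_eq_one_of_inert hc hQ hroot ha hb hab, mul_one,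
      Place.v_le_one_iff hQ] at hf
    obtain ⟨h1, h2⟩ := h.eq_zero (a - d * a') (b - d * b') (by
      simp only [map_sub, map_mul]
      linear_combination heq)
    rw [sub_eq_zero.1 h1, sub_eq_zero.1 h2, map_mul, map_mul]
    exact ⟨mul_le_one' hf ha, mul_le_one' hf hb⟩
  · rintro ⟨ha, hb⟩
    exact h.v_linear_le_one hc hQ ha hb

theorem eq_of_inert (h : IsArtinSchreier K z c) (hc : P.v c ≤ 1) (hQ : Q.under K = P)
    (hroot : ∀ r : K, P.v r ≤ 1 → ¬ P.v (c + (r ^ 2 + r)) < 1) {Q' : Place k K'}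
    (hQ' : Q'.under K = P) : Q = Q' := by
  apply Place.eq_of_ring_eq
  ext f
  obtain ⟨a, b, rfl⟩ := h.exists_eq f
  rw [Place.mem_ring, Place.mem_ring, h.v_le_one_iff_of_inert hc hQ hroot,
    h.v_le_one_iff_of_inert hc hQ' hroot]

theorem degree_of_inert (h : IsArtinSchreier K z c) (hc : P.v c ≤ 1) (hQ : Q.under K = P)
    (hroot : ∀ r : K, P.v r ≤ 1 → ¬ P.v (c + (r ^ 2 + r)) < 1)
    (hfin : Module.Finite k (ResidueField P.ring)) :
    Module.Finite k (ResidueField Q.ring) ∧ Q.degree = 2 * P.degree := by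
  refine Place.degree_eq_two_mul hQ (h.v_le_one hc hQ) (fun f hf => ?_) (fun a b ha hb hab => ?_)
    hfin
  · obtain ⟨a, b, rfl⟩ := h.exists_eq f
    obtain ⟨ha, hb⟩ := (h.v_le_one_iff_of_inert hc hQ hroot).1 hf
    exact ⟨a, b, ha, hb, by simp⟩
  · by_contra hne
    have : P.v a = 1 ∨ P.v b = 1 := by
      by_contra! h1
      exact hne ⟨lt_of_le_of_ne ha h1.1, lt_of_le_of_ne hb h1.2⟩
    rw [h.v_eq_one_of_inert hc hQ hroot ha hb this] at hab
    exact lt_irrefl _ hab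

end Inert

/-! ### Points over a simple pole of c -/

section Ramified

theorem one_lt_v_of_ramified (h : IsArtinSchreier K z c) (hc : P.IsParam c⁻¹)
    (hQ : Q.under K = P) : 1 < Q.v z ∧ Q.v (algebraMap K K' c) = Q.v z ^ 2 := by
  have h1 : 1 < Q.v z := by
    rw [← not_le, ← valuation_sq_add_le_one, h.equation, Place.v_le_one_iff hQ, not_le]
    have := hc.1
    rwa [map_inv₀, inv_lt_one₀ (by simpa using hc.v_pos)] at this
  exact ⟨h1, by rw [← h.equation, valuation_sq_add_of_one_lt _ h1]⟩

theorem v_eq_zpow_of_ramified (h : IsArtinSchreier K z c) (hc : P.IsParam c⁻¹)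
    (hQ : Q.under K = P) {a : K} {n : ℤ} (hn : P.v a = P.v c⁻¹ ^ n) :
    Q.v (algebraMap K K' a) = Q.v z⁻¹ ^ (2 * n) := by
  rw [Place.v_eq_zpow hQ hc.ne_zero hn, map_inv₀, map_inv₀, (h.one_lt_v_of_ramified hc hQ).2,
    map_inv₀, zpow_mul, ← inv_pow]
  norm_cast

/-- Nonzero elements of K have even order in z⁻¹ and their multiples by z odd order, so the two
terms never cancel. -/
theorem v_linear_of_ramified (h : IsArtinSchreier K z c) (hc : P.IsParam c⁻¹)
    (hQ : Q.under K = P) (a b : K) :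
    Q.v (algebraMap K K' a + algebraMap K K' b * z) =
      max (Q.v (algebraMap K K' a)) (Q.v (algebraMap K K' b * z)) := by
  rcases eq_or_ne a 0 with rfl | ha
  · simp
  rcases eq_or_ne b 0 with rfl | hb
  · simp
  apply Q.v.map_add_of_distinct_val
  obtain ⟨m, hm⟩ := hc.2 a ha
  obtain ⟨n, hn⟩ := hc.2 b hb
  have hz1 := (h.one_lt_v_of_ramified hc hQ).1
  have hz0 : 0 < Q.v z⁻¹ := by
    rw [map_inv₀, inv_pos]
    exact zero_lt_one.trans hz1
  have hzlt : Q.v z⁻¹ < 1 := by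
    rw [map_inv₀]
    exact inv_lt_one_of_one_lt₀ hz1
  have hz : Q.v z = Q.v z⁻¹ ^ (-1 : ℤ) := by rw [map_inv₀, zpow_neg_one, inv_inv]
  rw [map_mul, h.v_eq_zpow_of_ramified hc hQ hm, h.v_eq_zpow_of_ramified hc hQ hn]
  rw [hz]
  rw [← zpow_add₀ hz0.ne']
  intro heq
  have := (zpow_right_strictAnti₀ hz0 hzlt).injective heq
  omega

theorem isParam_of_ramified (h : IsArtinSchreier K z c) (hc : P.IsParam c⁻¹)
    (hQ : Q.under K = P) : Q.IsParam z⁻¹ := by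
  have hz1 := (h.one_lt_v_of_ramified hc hQ).1
  have hz0 : 0 < Q.v z⁻¹ := by
    rw [map_inv₀, inv_pos]
    exact zero_lt_one.trans hz1
  have hz : Q.v z = Q.v z⁻¹ ^ (-1 : ℤ) := by rw [map_inv₀, zpow_neg_one, inv_inv]
  refine ⟨by rw [map_inv₀]; exact inv_lt_one_of_one_lt₀ hz1, fun f hf => ?_⟩
  obtain ⟨a, b, rfl⟩ := h.exists_eq f
  have hbz : b ≠ 0 → ∃ n : ℤ, Q.v (algebraMap K K' b * z) = Q.v z⁻¹ ^ n := by
    intro hb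
    obtain ⟨n, hn⟩ := hc.2 b hb
    refine ⟨2 * n + -1, ?_⟩
    rw [map_mul, h.v_eq_zpow_of_ramified hc hQ hn, zpow_add₀ hz0.ne', ← hz]
  have ha' : a ≠ 0 → ∃ n : ℤ, Q.v (algebraMap K K' a) = Q.v z⁻¹ ^ n := by
    intro ha
    obtain ⟨n, hn⟩ := hc.2 a ha
    exact ⟨_, h.v_eq_zpow_of_ramified hc hQ hn⟩
  rcases eq_or_ne a 0 with rfl | ha
  · rw [map_zero, zero_add] at hf ⊢
    exact hbz (by rintro rfl; simp at hf)
  rcases eq_or_ne b 0 with rfl | hb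
  · rw [map_zero, zero_mul, add_zero]
    exact ha' ha
  rw [h.v_linear_of_ramified hc hQ]
  rcases max_choice (Q.v (algebraMap K K' a)) (Q.v (algebraMap K K' b * z)) with h1 | h1
  · rw [h1]
    exact ha' ha
  · rw [h1]
    exact hbz hb

theorem v_mul_le_one_of_ramified (h : IsArtinSchreier K z c) (hc : P.IsParam c⁻¹)
    (hQ : Q.under K = P) (b : K) : Q.v (algebraMap K K' b * z) ≤ 1 ↔ P.v b < 1 := by
  rcases eq_or_ne b 0 with rfl | hb
  · simp
  obtain ⟨n, hn⟩ := hc.2 b hb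
  have hp := h.isParam_of_ramified hc hQ
  have hz : Q.v z = Q.v z⁻¹ ^ (-1 : ℤ) := by rw [map_inv₀, zpow_neg_one, inv_inv]
  rw [map_mul, h.v_eq_zpow_of_ramified hc hQ hn, hn, hc.zpow_lt_one]
  rw [hz]
  rw [← zpow_add₀ hp.v_pos.ne', hp.zpow_le_one]
  omega

theorem v_le_one_iff_of_ramified (h : IsArtinSchreier K z c) (hc : P.IsParam c⁻¹)
    (hQ : Q.under K = P) {a b : K} :
    Q.v (algebraMap K K' a + algebraMap K K' b * z) ≤ 1 ↔ P.v a ≤ 1 ∧ P.v b < 1 := by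
  rw [h.v_linear_of_ramified hc hQ, max_le_iff, Place.v_le_one_iff hQ,
    h.v_mul_le_one_of_ramified hc hQ]

theorem eq_of_ramified (h : IsArtinSchreier K z c) (hc : P.IsParam c⁻¹)
    (hQ : Q.under K = P) {Q' : Place k K'} (hQ' : Q'.under K = P) : Q = Q' := by
  apply Place.eq_of_ring_eq
  ext f
  obtain ⟨a, b, rfl⟩ := h.exists_eq f
  rw [Place.mem_ring, Place.mem_ring, h.v_le_one_iff_of_ramified hc hQ,
    h.v_le_one_iff_of_ramified hc hQ']

theorem degree_of_ramified (h : IsArtinSchreier K z c) (hc : P.IsParam c⁻¹)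
    (hQ : Q.under K = P) (hfin : Module.Finite k (ResidueField P.ring)) :
    Module.Finite k (ResidueField Q.ring) ∧ Q.degree = P.degree := by
  refine Place.degree_eq_of_residue hQ (fun f hf => ?_) hfin
  obtain ⟨a, b, rfl⟩ := h.exists_eq f
  obtain ⟨ha, hb⟩ := (h.v_le_one_iff_of_ramified hc hQ).1 hf
  refine ⟨a, ha, ?_⟩
  rw [add_sub_cancel_left]
  -- A regular b z vanishes, since its order is odd. Hence the residue field does not grow.
  refine lt_of_le_of_ne ((h.v_mul_le_one_of_ramified hc hQ b).2 hb) fun h1 => ?_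
  have hb0 : b ≠ 0 := by rintro rfl; simp at h1
  obtain ⟨n, hn⟩ := hc.2 b hb0
  have hp := h.isParam_of_ramified hc hQ
  have hz : Q.v z = Q.v z⁻¹ ^ (-1 : ℤ) := by rw [map_inv₀, zpow_neg_one, inv_inv]
  rw [map_mul, h.v_eq_zpow_of_ramified hc hQ hn] at h1
  rw [hz] at h1
  rw [← zpow_add₀ hp.v_pos.ne', ← zpow_zero (Q.v z⁻¹), hp.zpow_inj] at h1
  omega

end Ramified

end IsArtinSchreier

end Quadratic

/-! ### Fibres and local integral bases -/

section Fiber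

set_option linter.unusedSectionVars false

variable {k K K' : Type*} [Field k] [Field K] [Field K'] [Algebra k K] [Algebra k K']
  [Algebra K K'] [IsScalarTower k K K'] [CharP K 2] [Algebra.IsAlgebraic K K']
  {z : K'} {c : K} {P : Place k K} {Q : Place k K'}

/-- The points of `K' = K ⊕ K z` above `P` all have ramification index `e`, their degrees add up,
and the functions regular at all of them are described by `z`. -/
structure IsFiber (P : Place k K) (z : K') (e : ℕ) : Prop where
  exists_finset : ∃ S : Finset (Place k K'), (∀ Q, Q ∈ S ↔ Q.under K = P) ∧
    e * ∑ Q ∈ S, Q.degree = 2 * P.degree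
  finite_residueField : ∀ Q : Place k K', Q.under K = P → Module.Finite k (ResidueField Q.ring)
  exists_isParam : ∀ Q : Place k K', Q.under K = P → ∀ t, P.IsParam t →
    ∃ s, Q.IsParam s ∧ Q.v s ^ e = Q.v (algebraMap K K' t)
  forall_le_one_iff : ∀ (a b t : K), P.IsParam t →
    ((∀ Q : Place k K', Q.under K = P → Q.v (algebraMap K K' a + algebraMap K K' b * z) ≤ 1) ↔
      P.v a ≤ 1 ∧ P.v b ≤ P.v t ^ (e - 1))

theorem IsFiber.of_ramified (h : IsArtinSchreier K z c) (hc : P.IsParam c⁻¹)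
    (hfin : Module.Finite k (ResidueField P.ring)) : IsFiber P z 2 := by
  obtain ⟨Q, hQ⟩ := Place.exists_under_eq (K' := K') P
  have hu : ∀ Q' : Place k K', Q'.under K = P ↔ Q' = Q :=
    fun Q' => ⟨fun hQ' => h.eq_of_ramified hc hQ' hQ, fun hQ' => hQ' ▸ hQ⟩
  refine ⟨⟨{Q}, fun Q' => by rw [Finset.mem_singleton, hu], ?_⟩, fun Q' hQ' =>
    (h.degree_of_ramified hc hQ' hfin).1, fun Q' hQ' t ht => ?_, fun a b t ht => ?_⟩
  · rw [Finset.sum_singleton, (h.degree_of_ramified hc hQ hfin).2]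
  · refine ⟨z⁻¹, h.isParam_of_ramified hc hQ', ?_⟩
    have h1 : P.v t = P.v c⁻¹ ^ (1 : ℤ) := by rw [zpow_one, hc.v_eq ht]
    rw [h.v_eq_zpow_of_ramified hc hQ' h1]
    norm_cast
  · rw [show 2 - 1 = 1 from rfl, pow_one, ← ht.lt_one_iff, ← h.v_le_one_iff_of_ramified hc hQ]
    exact ⟨fun H => H Q hQ, fun H Q' hQ' => (hu Q').1 hQ' ▸ H⟩

theorem sum_degree_split (h : IsArtinSchreier K z c) (hc : P.v c < 1)
    (hfin : Module.Finite k (ResidueField P.ring)) :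
    ∃ Q : Place k K', (∀ Q' : Place k K', Q'.under K = P ∧ Q'.v z < 1 ↔ Q' = Q) ∧
      Q.degree = P.degree := by
  obtain ⟨Q, hQ, hz⟩ := h.exists_split hc
  exact ⟨Q, fun Q' => ⟨fun hQ' => h.eq_of_split hc hQ'.1 hQ'.2 hQ hz, fun hQ' => hQ' ▸ ⟨hQ, hz⟩⟩,
    (h.degree_of_split hc hQ hz hfin).2⟩

/-- Since z (z + 1) = c vanishes, there are exactly two points over P, one with z = 0 and one with z
= 1. -/
theorem IsFiber.of_unramified_of_root (h : IsArtinSchreier K z c) (hc : P.v c < 1)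
    (hfin : Module.Finite k (ResidueField P.ring)) : IsFiber P z 1 := by
  classical
  have h' := h.add_one
  obtain ⟨Q₀, hQ₀, hz₀⟩ := h.exists_split hc
  obtain ⟨Q₁, hQ₁, hz₁⟩ := h'.exists_split hc
  have hor : ∀ Q : Place k K', Q.under K = P → Q.v z < 1 ∨ Q.v (z + 1) < 1 := by
    intro Q hQ
    have hz := h.v_le_one hc.le hQ
    have hz' := h'.v_le_one hc.le hQ
    by_contra! hlt
    have h1 : Q.v (z * (z + 1)) = 1 := by
      rw [map_mul, le_antisymm hz hlt.1, le_antisymm hz' hlt.2, mul_one]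
    rw [mul_add, mul_one, ← sq, h.equation, Place.v_eq_one_iff hQ] at h1
    exact hc.ne h1
  have hne : Q₀ ≠ Q₁ := by
    rintro rfl
    have := Q₀.v.map_sub_lt hz₁ hz₀
    rw [add_sub_cancel_left, map_one] at this
    exact lt_irrefl _ this
  have hmem : ∀ Q : Place k K', Q.under K = P ↔ Q = Q₀ ∨ Q = Q₁ := by
    intro Q
    constructor
    · intro hQ
      exact (hor Q hQ).imp (fun hz => h.eq_of_split hc hQ hz hQ₀ hz₀)
        (fun hz => h'.eq_of_split hc hQ hz hQ₁ hz₁)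
    · rintro (rfl | rfl)
      exacts [hQ₀, hQ₁]
  refine ⟨⟨{Q₀, Q₁}, fun Q' => by rw [hmem]; simp, ?_⟩, fun Q hQ => ?_, fun Q hQ t ht => ?_,
    fun a b t ht => ?_⟩
  · rw [Finset.sum_pair hne, (h.degree_of_split hc hQ₀ hz₀ hfin).2,
      (h'.degree_of_split hc hQ₁ hz₁ hfin).2]
    ring
  · exact (hor Q hQ).elim (fun hz => (h.degree_of_split hc hQ hz hfin).1)
      (fun hz => (h'.degree_of_split hc hQ hz hfin).1)
  · exact ⟨_, h.isParam_of_unramified hc.le hQ ht, pow_one _⟩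
  · rw [Nat.sub_self, pow_zero]
    refine ⟨fun H => ?_, fun H Q hQ => h.v_linear_le_one hc.le hQ H.1 H.2⟩
    by_cases h0 : algebraMap K K' a + algebraMap K K' b * z = 0
    · obtain ⟨rfl, rfl⟩ := h.eq_zero a b h0
      simp
    obtain ⟨d, a', b', hd, ha, hb, hab, heq⟩ := h.exists_primitive P h0
    obtain ⟨h1, h2⟩ := h.eq_zero (a - d * a') (b - d * b') (by
      simp only [map_sub, map_mul]
      linear_combination heq)
    have hd1 : P.v d ≤ 1 := by
      rw [heq] at H
      -- The primitive factor is a unit at the point z = 0 if a' is a unit, and otherwise at the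
      -- point z = 1, because then a' − b' is a unit. Either way regularity at that point bounds d.
      by_cases ha1 : P.v a' = 1
      · have := H Q₀ hQ₀
        rwa [map_mul, (h.v_eq_one_of_split hQ₀ hz₀ hb).2 ha1, mul_one,
          Place.v_le_one_iff hQ₀] at this
      · have hb1 := hab.resolve_left ha1
        have hab1 : P.v (a' - b') = 1 := by
          rw [P.v.map_sub_eq_of_lt_right (by rw [hb1]; exact lt_of_le_of_ne ha ha1), hb1]
        have := H Q₁ hQ₁
        have heq' : algebraMap K K' a' + algebraMap K K' b' * z =
            algebraMap K K' (a' - b') + algebraMap K K' b' * (z + 1) := by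
          rw [map_sub]
          ring
        rwa [map_mul, heq', (h'.v_eq_one_of_split hQ₁ hz₁ hb).2 hab1, mul_one,
          Place.v_le_one_iff hQ₁] at this
    rw [sub_eq_zero.1 h1, sub_eq_zero.1 h2, map_mul, map_mul]
    exact ⟨mul_le_one' hd1 ha, mul_le_one' hd1 hb⟩

/-- A root r of the residue equation reduces to the split case for z + r; without a root the point
is inert. -/
theorem IsFiber.of_unramified (h : IsArtinSchreier K z c) (hc : P.v c ≤ 1)
    (hfin : Module.Finite k (ResidueField P.ring)) : IsFiber P z 1 := by
  by_cases hroot : ∃ r : K, P.v r ≤ 1 ∧ P.v (c + (r ^ 2 + r)) < 1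
  · obtain ⟨r, hr, hrc⟩ := hroot
    obtain ⟨h1, h2, h3, h4⟩ := IsFiber.of_unramified_of_root (h.shift r) hrc hfin
    refine ⟨h1, h2, h3, fun a b t ht => ?_⟩
    have heq : algebraMap K K' a + algebraMap K K' b * z =
        algebraMap K K' (a - b * r) + algebraMap K K' b * (z + algebraMap K K' r) := by
      rw [map_sub, map_mul]
      ring
    rw [heq, h4 _ _ _ ht, Nat.sub_self, pow_zero]
    have hbr : P.v b ≤ 1 → P.v (b * r) ≤ 1 := fun hb => by
      rw [map_mul]
      exact mul_le_one' hb hr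
    refine ⟨fun ⟨ha, hb⟩ => ⟨?_, hb⟩, fun ⟨ha, hb⟩ => ⟨P.v.map_sub_le ha (hbr hb), hb⟩⟩
    simpa using P.v.map_add_le ha (hbr hb)
  · push Not at hroot
    replace hroot : ∀ r : K, P.v r ≤ 1 → ¬ P.v (c + (r ^ 2 + r)) < 1 :=
      fun r hr => not_lt.2 (hroot r hr)
    obtain ⟨Q, hQ⟩ := Place.exists_under_eq (K' := K') P
    have hu : ∀ Q' : Place k K', Q'.under K = P ↔ Q' = Q :=
      fun Q' => ⟨fun hQ' => h.eq_of_inert hc hQ' hroot hQ, fun hQ' => hQ' ▸ hQ⟩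
    refine ⟨⟨{Q}, fun Q' => by rw [Finset.mem_singleton, hu], ?_⟩, fun Q' hQ' =>
      (h.degree_of_inert hc hQ' hroot hfin).1, fun Q' hQ' t ht =>
      ⟨_, h.isParam_of_unramified hc hQ' ht, pow_one _⟩, fun a b t ht => ?_⟩
    · rw [Finset.sum_singleton, (h.degree_of_inert hc hQ hroot hfin).2, one_mul]
    · rw [Nat.sub_self, pow_zero, ← h.v_le_one_iff_of_inert hc hQ hroot]
      exact ⟨fun H => H Q hQ, fun H Q' hQ' => (hu Q').1 hQ' ▸ H⟩

end Fiber

/-! ### The genus of a quadratic extension -/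

section Genus

set_option linter.unusedSectionVars false

variable {k K K' : Type*} [Field k] [Field K] [Field K'] [Algebra k K] [Algebra k K']
  [Algebra K K'] [IsScalarTower k K K'] [CharP K 2] [Algebra.IsAlgebraic K K']
  {y : K'} {u : K} {w : Place k K → K} {e : Place k K → ℕ}

theorem IsCurve.of_isFiber (hK : IsCurve k K) (h : IsArtinSchreier K y u)
    (hF : ∀ P : Place k K, IsFiber P (y + algebraMap K K' (w P)) (e P)) : IsCurve k K' where
  exists_isParam Q := by
    obtain ⟨t, ht⟩ := hK.exists_isParam (Q.under K)
    obtain ⟨s, hs, -⟩ := (hF _).exists_isParam Q rfl t ht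
    exact ⟨s, hs⟩
  finite_residueField Q := (hF _).finite_residueField Q rfl
  finite_poles f := by
    obtain ⟨a, b, rfl⟩ := h.exists_eq f
    choose S hS using fun P => (hF P).exists_finset
    -- Away from the poles of u the generator y is integral, so a + b y has poles only over poles of
    -- a, b or u.
    refine ((((hK.finite_poles a).union (hK.finite_poles b)).union
      (hK.finite_poles u)).biUnion fun P _ => (S P).finite_toSet).subset fun Q hQ => ?_
    rw [Set.mem_iUnion₂]
    refine ⟨Q.under K, ?_, Finset.mem_coe.2 (((hS _).1 Q).2 rfl)⟩
    by_contra hcon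
    simp only [Set.mem_union, Set.mem_ofPred_eq, not_or, not_not, Place.mem_ring] at hcon
    exact hQ (Place.mem_ring.2 (h.v_linear_le_one hcon.2 rfl hcon.1.1 hcon.1.2))

/-- The pullback of divisors. -/
def Divisor.pullback (hF : ∀ P : Place k K, IsFiber P (y + algebraMap K K' (w P)) (e P))
    (D : Divisor k K) : Divisor k K' :=
  Finsupp.ofSupportFinite (fun Q => e (Q.under K) * D (Q.under K)) (by
    choose S hS using fun P => (hF P).exists_finset
    refine (D.support.finite_toSet.biUnion fun P _ => (S P).finite_toSet).subset fun Q hQ => ?_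
    rw [Set.mem_iUnion₂]
    refine ⟨Q.under K, ?_, Finset.mem_coe.2 (((hS _).1 Q).2 rfl)⟩
    rw [Finset.mem_coe, Finsupp.mem_support_iff]
    exact right_ne_zero_of_mul hQ)

theorem Divisor.pullback_apply (hF : ∀ P : Place k K, IsFiber P (y + algebraMap K K' (w P)) (e P))
    (D : Divisor k K) (Q : Place k K') :
    D.pullback hF Q = e (Q.under K) * D (Q.under K) := rfl

theorem Divisor.degree_pullback
    (hF : ∀ P : Place k K, IsFiber P (y + algebraMap K K' (w P)) (e P)) (D : Divisor k K) :
    (D.pullback hF).degree = 2 * D.degree := by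
  classical
  choose S hS using fun P => (hF P).exists_finset
  have hsub : (D.pullback hF).support ⊆ D.support.biUnion S := by
    intro Q hQ
    rw [Finset.mem_biUnion]
    refine ⟨Q.under K, ?_, ((hS _).1 Q).2 rfl⟩
    rw [Finsupp.mem_support_iff] at hQ ⊢
    exact right_ne_zero_of_mul hQ
  rw [Divisor.degree, Finsupp.sum_of_support_subset _ hsub _ (by simp), Finset.sum_biUnion]
  · rw [Divisor.degree, Finsupp.sum, Finset.mul_sum]
    refine Finset.sum_congr rfl fun P _ => ?_
    have h1 := (hS P).2
    zify at h1
    calc ∑ Q ∈ S P, D.pullback hF Q * (Q.degree : ℤ)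
        = ∑ Q ∈ S P, D P * (e P * (Q.degree : ℤ)) := by
          refine Finset.sum_congr rfl fun Q hQ => ?_
          rw [Divisor.pullback_apply, ((hS P).1 Q).1 hQ]
          ring
      _ = D P * (e P * ∑ Q ∈ S P, (Q.degree : ℤ)) := by rw [Finset.mul_sum, Finset.mul_sum]
      _ = 2 * (D P * P.degree) := by rw [h1]; ring
  · intro P _ P' _ hne
    rw [Function.onFun, Finset.disjoint_left]
    intro Q hQ hQ'
    exact hne ((((hS P).1 Q).1 hQ).symm.trans (((hS P').1 Q).1 hQ'))

/-- The functions in the Riemann–Roch space of a pullback. -/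
theorem mem_riemannRochSpace_pullback (hK' : IsCurve k K')
    (hF : ∀ P : Place k K, IsFiber P (y + algebraMap K K' (w P)) (e P))
    (he : ∀ P, 1 ≤ e P) {t : Place k K → K} (ht : ∀ P : Place k K, P.IsParam (t P))
    {D E : Divisor k K} (hE : ∀ P, E P = e P - 1) {a b : K} :
    algebraMap K K' a + algebraMap K K' b * y ∈ (D.pullback hF).riemannRochSpace ↔
      ∀ P, a - b * w P ∈ P.polar (t P) (D P) ∧ b ∈ P.polar (t P) ((D - E) P) := by
  have hloc : ∀ P : Place k K, (∀ Q : Place k K', Q.under K = P → ∀ s, Q.IsParam s →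
      Q.v (algebraMap K K' a + algebraMap K K' b * y) * Q.v s ^ (D.pullback hF Q) ≤ 1) ↔
      (a - b * w P ∈ P.polar (t P) (D P) ∧ b ∈ P.polar (t P) ((D - E) P)) := by
    intro P
    -- Multiplying by t ^ D(P) and passing to the local generator y + w(P) reduces the condition
    -- over P to regularity, where the integral basis of the fibre applies.
    have h1 : (∀ Q : Place k K', Q.under K = P → ∀ s, Q.IsParam s →
        Q.v (algebraMap K K' a + algebraMap K K' b * y) * Q.v s ^ (D.pullback hF Q) ≤ 1) ↔
        (∀ Q : Place k K', Q.under K = P →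
          Q.v (algebraMap K K' ((a - b * w P) * t P ^ D P) +
            algebraMap K K' (b * t P ^ D P) * (y + algebraMap K K' (w P))) ≤ 1) := by
      refine forall_congr' fun Q => forall_congr' fun hQ => ?_
      have heq : algebraMap K K' ((a - b * w P) * t P ^ D P) +
            algebraMap K K' (b * t P ^ D P) * (y + algebraMap K K' (w P)) =
          (algebraMap K K' a + algebraMap K K' b * y) * algebraMap K K' (t P) ^ D P := by
        simp only [map_mul, map_sub, map_zpow₀]
        ring
      obtain ⟨s, hs, hst⟩ := (hF P).exists_isParam Q hQ (t P) (ht P)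
      have hpow : Q.v s ^ (D.pullback hF Q) = Q.v (algebraMap K K' (t P) ^ D P) := by
        rw [Divisor.pullback_apply, hQ, zpow_mul, zpow_natCast, hst, map_zpow₀]
      rw [heq, map_mul, ← hpow]
      exact ⟨fun H => H s hs, fun H s' hs' => by rwa [hs.v_eq hs']⟩
    rw [h1, (hF P).forall_le_one_iff _ _ _ (ht P), Place.mem_polar, Place.mem_polar, map_mul,
      map_zpow₀, map_mul, map_zpow₀]
    refine and_congr_right fun _ => ?_
    have h0 := (ht P).v_pos
    have hexp : P.v (t P) ^ ((D - E) P) = P.v (t P) ^ D P / P.v (t P) ^ (e P - 1) := by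
      rw [Finsupp.sub_apply, hE, zpow_sub₀ h0.ne', ← Nat.cast_pred (he P), zpow_natCast]
    rw [hexp, ← mul_div_assoc, div_le_one₀ (pow_pos h0 _)]
  rw [mem_riemannRochSpace hK']
  constructor
  · exact fun H P => (hloc P).1 fun Q _ => H Q
  · exact fun H Q => (hloc (Q.under K)).2 (H _) Q rfl

/-- Coordinates with respect to the basis `1, y`. -/
def IsArtinSchreier.coord (k : Type*) [Field k] [Algebra k K] [Algebra k K'] [IsScalarTower k K K']
    (h : IsArtinSchreier K y u) : (K × K) ≃ₗ[k] K' :=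
  LinearEquiv.ofBijective
    { toFun := fun p => algebraMap K K' p.1 + algebraMap K K' p.2 * y
      map_add' := fun p q => by
        rw [Prod.fst_add, Prod.snd_add, map_add, map_add]
        ring
      map_smul' := fun c p => by
        rw [Prod.smul_fst, Prod.smul_snd, RingHom.id_apply]
        simp only [Algebra.smul_def, map_mul, ← IsScalarTower.algebraMap_apply k K K']
        ring }
    ⟨by
      rw [injective_iff_map_eq_zero]
      rintro ⟨a, b⟩ hab
      obtain ⟨rfl, rfl⟩ := h.eq_zero a b hab
      rfl,
     fun f => by
      obtain ⟨a, b, rfl⟩ := h.exists_eq f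
      exact ⟨(a, b), rfl⟩⟩

theorem IsArtinSchreier.coord_apply (h : IsArtinSchreier K y u) (a b : K) :
    h.coord k (a, b) = algebraMap K K' a + algebraMap K K' b * y := rfl

/-- The dimension of the Riemann–Roch space of the pullback of a large divisor. -/
theorem ell_pullback {g : ℤ} (hK : IsCurve k K) (hg : HasGenus k K g)
    (h : IsArtinSchreier K y u)
    (hF : ∀ P : Place k K, IsFiber P (y + algebraMap K K' (w P)) (e P))
    (he : ∀ P, 1 ≤ e P) (hw : {P | w P ≠ 0}.Finite) {E : Divisor k K} (hE : ∀ P, E P = e P - 1)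
    {D₀ D : Divisor k K} (h0 : ∀ D, D₀ ≤ D → D.degree + 1 - (D.ell : ℤ) = g) (hD : D₀ ≤ D) :
    Module.Finite k (D.pullback hF).riemannRochSpace ∧
      (D.pullback hF).ell = D.ell + (D - E).ell := by
  have hK' := hK.of_isFiber h hF
  choose t ht using hK.exists_isParam
  have hmem : ∀ a b : K, algebraMap K K' a + algebraMap K K' b * y ∈
      (D.pullback hF).riemannRochSpace ↔ _ := fun a b =>
    mem_riemannRochSpace_pullback hK' hF he ht hE
  let M := (D.pullback hF).riemannRochSpace
  let β : M →ₗ[k] (D - E).riemannRochSpace :=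
    ((LinearMap.snd k K K ∘ₗ (h.coord k).symm.toLinearMap) ∘ₗ M.subtype).codRestrict _ (by
      rintro ⟨f, hf⟩
      obtain ⟨⟨a, b⟩, rfl⟩ := (h.coord k).surjective f
      rw [LinearMap.comp_apply, LinearMap.comp_apply, Submodule.subtype_apply,
        LinearEquiv.coe_coe, LinearEquiv.symm_apply_apply, LinearMap.snd_apply,
        mem_riemannRochSpace_iff_polar hK ht]
      exact fun P => ((hmem a b).1 hf P).2)
  have hβ : ∀ (a b : K) (hab : h.coord k (a, b) ∈ M), (β ⟨h.coord k (a, b), hab⟩ : K) = b := by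
    intro a b hab
    change ((h.coord k).symm (h.coord k (a, b))).2 = b
    rw [LinearEquiv.symm_apply_apply]
  have hker : ∀ a : K, h.coord k (a, 0) ∈ M ↔ a ∈ D.riemannRochSpace := by
    intro a
    rw [h.coord_apply, hmem, mem_riemannRochSpace_iff_polar hK ht]
    simp
  let α : D.riemannRochSpace →ₗ[k] M :=
    (((h.coord k).toLinearMap ∘ₗ LinearMap.inl k K K) ∘ₗ
      D.riemannRochSpace.subtype).codRestrict _ fun a => (hker a).2 a.2
  have hαv : ∀ a : D.riemannRochSpace, (α a : K') = h.coord k ((a : K), 0) := fun _ => rfl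
  have hα : Function.Injective α := by
    intro a a' haa
    have h1 : h.coord k ((a : K), 0) = h.coord k ((a' : K), 0) := by rw [← hαv, ← hαv, haa]
    exact Subtype.ext (congrArg Prod.fst ((h.coord k).injective h1))
  have hrange : LinearMap.range α = LinearMap.ker β := by
    ext ⟨f, hf⟩
    obtain ⟨⟨a, b⟩, rfl⟩ := (h.coord k).surjective f
    rw [LinearMap.mem_ker, ← Submodule.coe_eq_zero, hβ]
    constructor
    · rintro ⟨a', ha'⟩
      have h1 : h.coord k ((a' : K), 0) = h.coord k (a, b) := by rw [← hαv, ha']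
      exact (congrArg Prod.snd ((h.coord k).injective h1)).symm
    · rintro rfl
      exact ⟨⟨a, (hker a).1 hf⟩, rfl⟩
  have hsurj : Function.Surjective β := by
    rintro ⟨b, hb⟩
    -- Given b, the element a only has to match b w(P) up to D(P) at every P; finiteness of the
    -- support of w makes this a problem at finitely many points.
    obtain ⟨a, ha⟩ := exists_approx hK hg h0 ht hD (fun P => b * w P)
      (hw.subset fun P hP => right_ne_zero_of_mul hP)
    rw [mem_riemannRochSpace_iff_polar hK ht] at hb
    exact ⟨⟨h.coord k (a, b), (hmem a b).2 fun P => ⟨ha P, hb P⟩⟩, Subtype.ext (hβ _ _ _)⟩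
  have eker : D.riemannRochSpace ≃ₗ[k] LinearMap.ker β :=
    (LinearEquiv.ofInjective α hα).trans (LinearEquiv.ofEq _ _ hrange)
  have := hg.finite hK D
  have := hg.finite hK (D - E)
  have : Module.Finite k (LinearMap.ker β) := Module.Finite.equiv eker
  have := Module.Finite.equiv (LinearMap.quotKerEquivRange β).symm
  have hfin : Module.Finite k M := Module.Finite.of_submodule_quotient (LinearMap.ker β)
  refine ⟨hfin, ?_⟩
  change Module.finrank k M = _
  rw [← LinearMap.finrank_range_add_finrank_ker β, LinearMap.range_eq_top.2 hsurj, finrank_top,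
    ← eker.finrank_eq, add_comm]
  rfl

/-- The genus of a quadratic Artin–Schreier extension whose ramified points all have simple poles
as standard forms. -/
theorem HasGenus.of_isFiber {g : ℤ} (hK : IsCurve k K) (hg : HasGenus k K g)
    (h : IsArtinSchreier K y u)
    (hF : ∀ P : Place k K, IsFiber P (y + algebraMap K K' (w P)) (e P))
    (he : ∀ P, 1 ≤ e P) (hw : {P | w P ≠ 0}.Finite) {E : Divisor k K} (hE : ∀ P, E P = e P - 1) :
    HasGenus k K' (2 * g - 1 + E.degree) := by
  classical
  obtain ⟨D₀, h0⟩ := hg.exists_forall_ge hK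
  intro D'
  let A : Divisor k K := ∑ Q ∈ D'.support, Finsupp.single (Q.under K) |D' Q|
  have hA0 : 0 ≤ A := Finset.sum_nonneg fun Q _ => Divisor.single_nonneg _ (abs_nonneg _)
  have hA : ∀ Q, D' Q ≤ A (Q.under K) := by
    intro Q
    by_cases hQ : Q ∈ D'.support
    · have h1 : Finsupp.single (Q.under K) |D' Q| ≤ A :=
        Finset.single_le_sum (f := fun Q : Place k K' => Finsupp.single (Q.under K) |D' Q|)
          (fun Q _ => Divisor.single_nonneg _ (abs_nonneg _)) hQ
      have h2 := h1 (Q.under K)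
      rw [Finsupp.single_eq_same] at h2
      exact (le_abs_self _).trans h2
    · rw [Finsupp.notMem_support_iff.1 hQ]
      exact hA0 _
  have hE0 : 0 ≤ E := fun P => by
    rw [hE]
    have := he P
    simp only [Finsupp.coe_zero, Pi.zero_apply]
    omega
  -- Large enough that both D and D − E lie above D₀ and that the pullback dominates D'.
  let D : Divisor k K := D₀ ⊔ 0 + E + A
  have hD1 : D₀ ≤ D - E := by
    have : D - E = D₀ ⊔ 0 + A := by simp only [D]; abel
    rw [this]
    exact le_sup_left.trans (le_add_of_nonneg_right hA0)
  have hD : D₀ ≤ D := hD1.trans (sub_le_self _ hE0)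
  have hAD : A ≤ D := le_add_of_nonneg_left (add_nonneg le_sup_right hE0)
  obtain ⟨hfin, hell⟩ := ell_pullback hK hg h hF he hw hE h0 hD
  refine ⟨D.pullback hF, fun Q => ?_, hfin, ?_⟩
  · rw [Divisor.pullback_apply]
    have h1 := hA Q
    have h2 := hAD (Q.under K)
    have h3 := hA0 (Q.under K)
    have h4 : (1 : ℤ) ≤ e (Q.under K) := by exact_mod_cast he _
    simp only [Finsupp.coe_zero, Pi.zero_apply] at h3
    nlinarith
  · have h1 := h0 D hD
    have h2 := h0 _ hD1
    rw [Divisor.degree_sub] at h2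
    rw [Divisor.degree_pullback, hell]
    push_cast
    linarith

end Genus

/-! ### Chains describing the pole of the next equation -/

section Stages

set_option linter.unusedSectionVars false

variable {k K : Type*} [Field k] [Field K] [Algebra k K] [CharP K 2] {P : Place k K}

/-- `V` is, modulo regular functions, the end of a chain `V_r, …, V_0 = V` in which `V_r` has a
simple pole and `V_j = y_j (V_{j+1}² + V_{j+1})`, where `y_j` is close to a primitive cube root of
unity. -/
def Place.EvenStage (P : Place k K) : ℕ → K → Prop
  | 0, V => P.IsParam V⁻¹
  | r + 1, V => ∃ y s W : K, P.v s < 1 ∧ P.v (y ^ 2 + y + 1) ≤ P.v s ^ 2 ∧ P.v (s * W) ≤ 1 ∧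
      P.v (V + y * (W ^ 2 + W)) ≤ 1 ∧ P.EvenStage r W

/-- The analogue of `Place.EvenStage` for chains with
`V_j = (y_j + 1) (V_{j+1}² + V_{j+1}) + V_{j+1}`. -/
def Place.OddStage (P : Place k K) : ℕ → K → Prop
  | 0, V => P.IsParam V⁻¹
  | r + 1, V => ∃ y s W : K, P.v s < 1 ∧ P.v (y ^ 2 + y + 1) ≤ P.v s ^ 2 ∧ P.v (s * W) ≤ 1 ∧
      P.v (V + ((y + 1) * (W ^ 2 + W) + W)) ≤ 1 ∧ P.OddStage r W

theorem Place.IsParam.one_lt_v {V : K} (h : P.IsParam V⁻¹) : 1 < P.v V := by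
  have := h.1
  rwa [map_inv₀, inv_lt_one₀ (by simpa using h.v_pos)] at this

theorem Place.IsParam.inv_congr {V V' : K} (h : P.IsParam V⁻¹) (h' : P.v (V + V') ≤ 1) :
    P.IsParam V'⁻¹ := by
  refine h.congr ?_
  rw [map_inv₀, map_inv₀]
  congr 1
  have : V' = (V + V') - V := by ring
  rw [this, P.v.map_sub_eq_of_lt_right (h'.trans_lt h.one_lt_v)]

theorem Place.EvenStage.congr {r : ℕ} {V V' : K} (h : P.EvenStage r V) (h' : P.v (V + V') ≤ 1) :
    P.EvenStage r V' := by
  cases r with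
  | zero => exact Place.IsParam.inv_congr h h'
  | succ r =>
    obtain ⟨y, s, W, h1, h2, h3, h4, h5⟩ := h
    refine ⟨y, s, W, h1, h2, h3, ?_, h5⟩
    have : V' + y * (W ^ 2 + W) = (V + V') + (V + y * (W ^ 2 + W)) := by
      linear_combination -V * CharTwo.two_eq_zero (R := K)
    rw [this]
    exact P.v.map_add_le h' h4

theorem Place.OddStage.congr {r : ℕ} {V V' : K} (h : P.OddStage r V) (h' : P.v (V + V') ≤ 1) :
    P.OddStage r V' := by
  cases r with
  | zero => exact Place.IsParam.inv_congr h h'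
  | succ r =>
    obtain ⟨y, s, W, h1, h2, h3, h4, h5⟩ := h
    refine ⟨y, s, W, h1, h2, h3, ?_, h5⟩
    have : V' + ((y + 1) * (W ^ 2 + W) + W) = (V + V') + (V + ((y + 1) * (W ^ 2 + W) + W)) := by
      linear_combination -V * CharTwo.two_eq_zero (R := K)
    rw [this]
    exact P.v.map_add_le h' h4

theorem Place.v_eq_one_of_cyclotomic {y : K} (h : P.v (y ^ 2 + y + 1) < 1) : P.v y = 1 := by
  have h1 : P.v y ≤ 1 := by
    rw [← valuation_sq_add_le_one]
    have : y ^ 2 + y = (y ^ 2 + y + 1) - 1 := by ring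
    rw [this]
    exact P.v.map_sub_le h.le (by simp)
  refine h1.eq_of_not_lt fun h2 => ?_
  have h3 : P.v (y ^ 2 + y) < 1 := by
    refine P.v.map_add_lt ?_ h2
    rw [map_pow]
    exact pow_lt_one₀ zero_le h2 two_ne_zero
  rw [P.v.map_add_eq_of_lt_right (by rwa [map_one]), map_one] at h
  exact lt_irrefl _ h

/-- This is what the auxiliary s in a chain is for: y² + y + 1 vanishes at least twice as deeply as
s, and the pole of W is at most as deep as the zero of s. -/
theorem Place.v_cyclotomic_mul_le {y s W : K} (hy : P.v (y ^ 2 + y + 1) ≤ P.v s ^ 2)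
    (hW : P.v (s * W) ≤ 1) : P.v ((y ^ 2 + y + 1) * W ^ 2) ≤ 1 := by
  rw [map_mul, map_pow]
  calc P.v (y ^ 2 + y + 1) * P.v W ^ 2 ≤ P.v s ^ 2 * P.v W ^ 2 := by gcongr
    _ = P.v (s * W) ^ 2 := by rw [map_mul, mul_pow]
    _ ≤ 1 := pow_le_one₀ zero_le hW

/-- At a pole, W² is no larger than V, so the bound on V by 1/s passes to the root W. -/
theorem Place.v_mul_le_of_sq_add {s V W : K} (hs : P.v s ≤ 1) (hV : P.v (s * V) ≤ 1)
    (h : P.v (W ^ 2 + W + V) ≤ 1) : P.v (s * W) ≤ 1 := by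
  rcases le_or_gt (P.v W) 1 with hW | hW
  · rw [map_mul]
    exact mul_le_one' hs hW
  have h1 : P.v (W ^ 2) ≤ P.v V := by
    rw [map_pow, ← valuation_sq_add_of_one_lt _ hW]
    have h2 : 1 < P.v (W ^ 2 + W) := by
      rw [valuation_sq_add_of_one_lt _ hW]
      exact one_lt_pow₀ hW two_ne_zero
    have : V = (W ^ 2 + W + V) - (W ^ 2 + W) := by ring
    rw [this, P.v.map_sub_eq_of_lt_right (h.trans_lt h2)]
  rw [← pow_le_one_iff_of_nonneg zero_le two_ne_zero, ← map_pow]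
  calc P.v ((s * W) ^ 2) = P.v s * (P.v s * P.v (W ^ 2)) := by
        rw [mul_pow, map_mul, map_pow, sq (P.v s), mul_assoc]
    _ ≤ P.v s * (P.v s * P.v V) := by gcongr
    _ = P.v s * P.v (s * V) := by rw [map_mul]
    _ ≤ 1 := mul_le_one' hs hV

/-- At an even stage the Artin–Schreier equation can be brought into a form with a simple pole. -/
theorem Place.EvenStage.exists_ramified {r : ℕ} {V : K} (h : P.EvenStage r V) :
    ∃ w : K, P.IsParam (V + (w ^ 2 + w))⁻¹ := by
  induction r generalizing V with
  | zero => exact ⟨0, by simpa [Place.EvenStage] using h⟩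
  | succ r ih =>
    obtain ⟨y, s, W, h1, h2, h3, h4, h5⟩ := h
    obtain ⟨w, hw⟩ := ih h5
    -- The shift by (y + 1) W turns y (W² + W) into W + (y² + y + 1) W², which is W modulo regular
    -- functions; w then treats the shorter chain.
    refine ⟨(y + 1) * W + w, hw.inv_congr ?_⟩
    have : W + (w ^ 2 + w) + (V + (((y + 1) * W + w) ^ 2 + ((y + 1) * W + w))) =
        (V + y * (W ^ 2 + W)) + (y ^ 2 + y + 1) * W ^ 2 := by
      linear_combination (W + w ^ 2 + w + (y + 1) * W * w) * CharTwo.two_eq_zero (R := K)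
    rw [this]
    exact P.v.map_add_le h4 (Place.v_cyclotomic_mul_le h2 h3)

/-- At an odd stage that is not the last one, the Artin–Schreier equation is unramified. -/
theorem Place.OddStage.exists_unramified {r : ℕ} {V : K} (h : P.OddStage (r + 1) V) :
    ∃ w : K, P.v (V + (w ^ 2 + w)) ≤ 1 := by
  obtain ⟨y, s, W, h1, h2, h3, h4, h5⟩ := h
  -- In characteristic 2, (y + 1)(W² + W) + W and (y W)² + y W differ by (y² + y + 1) W².
  refine ⟨y * W, ?_⟩
  have : V + ((y * W) ^ 2 + y * W) =
      (V + ((y + 1) * (W ^ 2 + W) + W)) + (y ^ 2 + y + 1) * W ^ 2 := by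
    linear_combination -(y * W ^ 2 + W ^ 2 + W) * CharTwo.two_eq_zero (R := K)
  rw [this]
  exact P.v.map_add_le h4 (Place.v_cyclotomic_mul_le h2 h3)

/-- With y', W the next link of V, one has V ≡ (y' W)² + y' W, so y V is an even link over y' W, and
the induction applies to y' W. For r = 0 the factor y is only a unit. -/
theorem Place.OddStage.evenStage_mul {r : ℕ} {y s V : K} (h : P.OddStage r V) (hs : P.v s < 1)
    (hy : P.v (y ^ 2 + y + 1) ≤ P.v s ^ 2) (hV : P.v (s * V) ≤ 1) : P.EvenStage r (y * V) := by
  have hy1 : P.v y = 1 :=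
    Place.v_eq_one_of_cyclotomic (hy.trans_lt (pow_lt_one₀ zero_le hs two_ne_zero))
  induction r generalizing y s V with
  | zero =>
    refine Place.IsParam.congr h ?_
    rw [map_inv₀, map_mul, hy1, one_mul, map_inv₀]
  | succ r ih =>
    obtain ⟨y', s', W, h1, h2, h3, h4, h5⟩ := h
    have hy1' : P.v y' = 1 :=
      Place.v_eq_one_of_cyclotomic (h2.trans_lt (pow_lt_one₀ zero_le h1 two_ne_zero))
    have h6 : P.v ((y' * W) ^ 2 + y' * W + V) ≤ 1 := by
      have : (y' * W) ^ 2 + y' * W + V =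
          (V + ((y' + 1) * (W ^ 2 + W) + W)) + (y' ^ 2 + y' + 1) * W ^ 2 := by
        linear_combination -(y' * W ^ 2 + W ^ 2 + W) * CharTwo.two_eq_zero (R := K)
      rw [this]
      exact P.v.map_add_le h4 (Place.v_cyclotomic_mul_le h2 h3)
    refine ⟨y, s, y' * W, hs, hy, Place.v_mul_le_of_sq_add hs.le hV h6, ?_, ih h5 h1 h2 h3 hy1'⟩
    rw [← mul_add, map_mul, hy1, one_mul, add_comm]
    exact h6

section Extension

variable {K' : Type*} [Field K'] [Algebra k K'] [Algebra K K'] [IsScalarTower k K K']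
  [Algebra.IsAlgebraic K K'] [CharP K' 2] {Q : Place k K'}

theorem Place.v_le_sq_iff (hQ : Q.under K = P) {a s : K} :
    Q.v (algebraMap K K' a) ≤ Q.v (algebraMap K K' s) ^ 2 ↔ P.v a ≤ P.v s ^ 2 := by
  rcases eq_or_ne s 0 with rfl | hs
  · simp
  have h1 : 0 < P.v s ^ 2 := pow_pos (by simpa [zero_lt_iff] using hs) 2
  have h2 : 0 < Q.v (algebraMap K K' s) ^ 2 := pow_pos (by simpa [zero_lt_iff] using hs) 2
  rw [← div_le_one₀ h1, ← div_le_one₀ h2, ← map_pow, ← map_pow, ← map_pow, ← map_div₀, ← map_div₀,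
    ← map_div₀, Place.v_le_one_iff hQ]

theorem Place.EvenStage.map {r : ℕ} {V : K} (h : P.EvenStage r V) (hQ : Q.under K = P)
    (hpar : ∀ t, P.IsParam t → Q.IsParam (algebraMap K K' t)) :
    Q.EvenStage r (algebraMap K K' V) := by
  induction r generalizing V with
  | zero =>
    change Q.IsParam _
    rw [← map_inv₀]
    exact hpar _ h
  | succ r ih =>
    obtain ⟨y, s, W, h1, h2, h3, h4, h5⟩ := h
    refine ⟨algebraMap K K' y, algebraMap K K' s, algebraMap K K' W,
      (Place.v_lt_one_iff hQ).2 h1, ?_, ?_, ?_, ih h5⟩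
    · rw [← Place.v_le_sq_iff hQ] at h2
      simpa using h2
    · rw [← Place.v_le_one_iff hQ] at h3
      simpa using h3
    · rw [← Place.v_le_one_iff hQ] at h4
      simpa only [map_add, map_mul, map_pow] using h4

/-- Passage from an even stage to the odd stage above it. -/
theorem Place.EvenStage.oddStage {r : ℕ} {V : K} {T : K'} (h : P.EvenStage r V)
    (hQ : Q.under K = P)
    (hpar : ∀ (V : K) (T : K'), P.IsParam V⁻¹ → Q.v (T ^ 2 + T + algebraMap K K' V) ≤ 1 →
      Q.IsParam T⁻¹)
    (hT : Q.v (T ^ 2 + T + algebraMap K K' V) ≤ 1) : Q.OddStage r T := by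
  induction r generalizing V T with
  | zero => exact hpar V T h hT
  | succ r ih =>
    obtain ⟨y, s, W, h1, h2, h3, h4, h5⟩ := h
    have hy1 : P.v y = 1 :=
      Place.v_eq_one_of_cyclotomic (h2.trans_lt (pow_lt_one₀ zero_le h1 two_ne_zero))
    have h6 : Q.v (algebraMap K K' ((y ^ 2 + y + 1) * W ^ 2)) ≤ 1 :=
      (Place.v_le_one_iff hQ).2 (Place.v_cyclotomic_mul_le h2 h3)
    have h4' := (Place.v_le_one_iff hQ).2 h4
    -- The element T' = T + (y + 1) W solves, modulo regular functions, the equation for the shorter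
    -- chain W, and T ≡ (y + 1)(T'² + T') + T'.
    have h7 : Q.v ((T + algebraMap K K' ((y + 1) * W)) ^ 2 + (T + algebraMap K K' ((y + 1) * W)) +
        algebraMap K K' W) ≤ 1 := by
      have : (T + algebraMap K K' ((y + 1) * W)) ^ 2 + (T + algebraMap K K' ((y + 1) * W)) +
          algebraMap K K' W = (T ^ 2 + T + algebraMap K K' V) +
            (algebraMap K K' (V + y * (W ^ 2 + W)) +
              algebraMap K K' ((y ^ 2 + y + 1) * W ^ 2)) := by
        simp only [map_add, map_mul, map_pow, map_one]
        linear_combination (T * (algebraMap K K' y + 1) * algebraMap K K' W + algebraMap K K' W -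
          algebraMap K K' V) * CharTwo.two_eq_zero (R := K')
      rw [this]
      exact Q.v.map_add_le hT (Q.v.map_add_le h4' h6)
    refine ⟨algebraMap K K' y, algebraMap K K' s, T + algebraMap K K' ((y + 1) * W),
      (Place.v_lt_one_iff hQ).2 h1, ?_, ?_, ?_, ih h5 h7⟩
    · rw [← Place.v_le_sq_iff hQ] at h2
      simpa using h2
    · refine Place.v_mul_le_of_sq_add ((Place.v_lt_one_iff hQ).2 h1).le ?_ h7
      rw [← map_mul, Place.v_le_one_iff hQ]
      exact h3
    · have : T + ((algebraMap K K' y + 1) * ((T + algebraMap K K' ((y + 1) * W)) ^ 2 +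
          (T + algebraMap K K' ((y + 1) * W))) + (T + algebraMap K K' ((y + 1) * W))) =
          algebraMap K K' (y + 1) * ((T + algebraMap K K' ((y + 1) * W)) ^ 2 +
            (T + algebraMap K K' ((y + 1) * W)) + algebraMap K K' W) := by
        simp only [map_add, map_mul, map_one]
        linear_combination T * CharTwo.two_eq_zero (R := K')
      rw [this, map_mul]
      refine mul_le_one' ((Place.v_le_one_iff hQ).2 (P.v.map_add_le hy1.le (by simp))) h7

/-- Passage from an odd stage to the even stage above it. -/
theorem Place.OddStage.evenStage {r : ℕ} {V : K} {T : K'} (h : P.OddStage (r + 1) V)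
    (hQ : Q.under K = P) (hpar : ∀ t, P.IsParam t → Q.IsParam (algebraMap K K' t))
    (hT : Q.v (T ^ 2 + T + algebraMap K K' V) ≤ 1) : Q.EvenStage r T := by
  obtain ⟨y, s, W, h1, h2, h3, h4, h5⟩ := h
  have h6 := (h5.evenStage_mul h1 h2 h3).map hQ hpar
  -- The functions T and y W solve the same equation modulo regular functions, hence differ by a
  -- regular function.
  refine h6.congr ?_
  have h7 : Q.v (algebraMap K K' ((y ^ 2 + y + 1) * W ^ 2)) ≤ 1 :=
    (Place.v_le_one_iff hQ).2 (Place.v_cyclotomic_mul_le h2 h3)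
  rw [← valuation_sq_add_le_one]
  have : (algebraMap K K' (y * W) + T) ^ 2 + (algebraMap K K' (y * W) + T) =
      (T ^ 2 + T + algebraMap K K' V) + (algebraMap K K' (V + ((y + 1) * (W ^ 2 + W) + W)) +
        algebraMap K K' ((y ^ 2 + y + 1) * W ^ 2)) := by
    simp only [map_add, map_mul, map_pow, map_one]
    linear_combination (algebraMap K K' y * algebraMap K K' W * T - algebraMap K K' V -
      (algebraMap K K' y * algebraMap K K' W ^ 2 + algebraMap K K' W ^ 2 + algebraMap K K' W)) *
      CharTwo.two_eq_zero (R := K')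
  rw [this]
  exact Q.v.map_add_le hT (Q.v.map_add_le ((Place.v_le_one_iff hQ).2 h4) h7)

/-- V and c have the same simple pole at P, so T² and z² have the same value at Q, and z⁻¹ is a
parameter there. -/
theorem IsArtinSchreier.isParam_inv_of_ramified {z : K'} {c : K} (h : IsArtinSchreier K z c)
    (hc : P.IsParam c⁻¹) (hQ : Q.under K = P) {V : K} {T : K'} (hV : P.IsParam V⁻¹)
    (hT : Q.v (T ^ 2 + T + algebraMap K K' V) ≤ 1) : Q.IsParam T⁻¹ := by
  have hVc : P.v (V / c) = 1 := by
    have h1 := hc.v_eq hV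
    rw [map_inv₀, map_inv₀, inv_inj] at h1
    rw [map_div₀, h1, div_self]
    exact (zero_lt_one.trans hc.one_lt_v).ne'
  obtain ⟨hz1, hzc⟩ := h.one_lt_v_of_ramified hc hQ
  have hz2 : 1 < Q.v z ^ 2 := one_lt_pow₀ hz1 two_ne_zero
  rw [← Place.v_eq_one_iff hQ, map_div₀, map_div₀, hzc,
    div_eq_one_iff_eq (zero_lt_one.trans hz2).ne'] at hVc
  have h2 : Q.v (T ^ 2 + T) = Q.v z ^ 2 := by
    have : T ^ 2 + T = (T ^ 2 + T + algebraMap K K' V) - algebraMap K K' V := by ring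
    rw [this, Q.v.map_sub_eq_of_lt_right (by rw [hVc]; exact hT.trans_lt hz2), hVc]
  have hT1 : 1 < Q.v T := by
    rw [← not_le, ← valuation_sq_add_le_one, h2, not_le]
    exact hz2
  rw [valuation_sq_add_of_one_lt _ hT1] at h2
  refine (h.isParam_of_ramified hc hQ).congr ?_
  rw [map_inv₀, map_inv₀, (pow_left_inj₀ zero_le zero_le two_ne_zero).1 h2]

end Extension

end Stages

/-! ### The projective line -/

section RationalFunctionField

open Polynomial

variable {k K : Type*} [Field k] [Field K] [Algebra k K]

theorem Place.v_aeval_le (P : Place k K) {x : K} (hx : P.v x ≤ 1) (p : k[X]) :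
    P.v (aeval x p) ≤ 1 := by
  rw [aeval_eq_sum_range]
  refine P.v.map_sum_le fun i _ => ?_
  rw [Algebra.smul_def, map_mul, map_pow]
  exact mul_le_one' (P.v_algebraMap_le _) (pow_le_one₀ zero_le hx)

theorem Place.v_aeval_of_one_lt (P : Place k K) {x : K} (hx : 1 < P.v x) {p : k[X]} (hp : p ≠ 0) :
    P.v (aeval x p) = P.v x ^ p.natDegree := by
  have : P.v.IsTrivialOn k := ⟨fun a ha => P.v_algebraMap ha⟩
  exact Polynomial.valuation_aeval_eq_valuation_X_pow_natDegree_of_one_lt_valuation_X x hx hp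

/-- A nonconstant polynomial in a transcendental element vanishes at some place. -/
theorem exists_place_aeval_lt {x : K} (hx : Transcendental k x) {p : k[X]} (hp0 : p ≠ 0)
    (hp : ¬ IsUnit p) : ∃ P : Place k K, P.v x ≤ 1 ∧ P.v (aeval x p) < 1 := by
  let A : Subring K := (aeval x : k[X] →ₐ[k] K).toRingHom.range
  have hA : ∀ q : k[X], aeval x q ∈ A := fun q => ⟨q, rfl⟩
  let I : Ideal A := Ideal.span {⟨aeval x p, hA p⟩}
  have hinj := transcendental_iff_injective.1 hx
  have hI : I ≠ ⊤ := by
    rw [Ideal.ne_top_iff_one, Ideal.mem_span_singleton]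
    rintro ⟨⟨_, q, rfl⟩, hq⟩
    have h1 : 1 = aeval x p * aeval x q := congrArg Subtype.val hq
    rw [← map_mul, ← map_one (aeval x : k[X] →ₐ[k] K)] at h1
    exact hp (IsUnit.of_mul_eq_one q (hinj h1).symm)
  obtain ⟨V, hAV, hIV⟩ := I.image_subset_nonunits_valuationSubring hI
  have hlt : V.valuation (aeval x p) < 1 :=
    V.mem_nonunits_iff.1 (hIV ⟨⟨aeval x p, hA p⟩, Ideal.mem_span_singleton_self _, rfl⟩)
  refine ⟨⟨V, fun a => hAV ?_, fun hV => ?_⟩, ?_, hlt⟩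
  · simpa using hA (C a)
  · have h0 : aeval x p ≠ 0 := by
      rw [Ne, map_eq_zero_iff _ hinj]
      exact hp0
    have h1 : (aeval x p)⁻¹ ∈ V := by
      rw [hV]
      exact ValuationSubring.mem_top _
    rw [← V.valuation_le_one_iff, map_inv₀, inv_le_one₀ (by simpa [zero_lt_iff] using h0)] at h1
    exact absurd hlt (not_lt.2 h1)
  · exact (V.valuation_le_one_iff x).2 (hAV (by simpa using hA X))

/-- `K` is the rational function field in the variable `x`. -/
structure IsCoordinate (k : Type*) {K : Type*} [Field k] [Field K] [Algebra k K] (x : K) :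
    Prop where
  transcendental : Transcendental k x
  adjoin_eq_top : IntermediateField.adjoin k {x} = ⊤

variable {x : K}

namespace IsCoordinate

theorem ne_zero (h : IsCoordinate k x) : x ≠ 0 := by
  rintro rfl
  exact h.transcendental isAlgebraic_zero

theorem inv (h : IsCoordinate k x) : IsCoordinate k x⁻¹ where
  transcendental := fun ha => h.transcendental (by simpa using ha.inv)
  adjoin_eq_top := by
    rw [eq_top_iff, ← h.adjoin_eq_top, IntermediateField.adjoin_simple_le_iff]
    simpa using inv_mem (IntermediateField.mem_adjoin_simple_self k x⁻¹)

theorem exists_div (h : IsCoordinate k x) (f : K) : ∃ r s : k[X], f = aeval x r / aeval x s :=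
  (IntermediateField.mem_adjoin_simple_iff k f).1 (by rw [h.adjoin_eq_top]; trivial)

theorem aeval_ne_zero (h : IsCoordinate k x) {p : k[X]} (hp : p ≠ 0) : aeval x p ≠ 0 := by
  rw [Ne, map_eq_zero_iff _ (transcendental_iff_injective.1 h.transcendental)]
  exact hp

/-- The polynomials vanishing at P form a prime ideal; it is nonzero because otherwise every
quotient of polynomials would be regular at P. -/
theorem exists_irreducible (h : IsCoordinate k x) {P : Place k K} (hP : P.v x ≤ 1) :
    ∃ p : k[X], Irreducible p ∧ ∀ q, P.v (aeval x q) < 1 ↔ p ∣ q := by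
  let I : Ideal k[X] :=
    { carrier := {q | P.v (aeval x q) < 1}
      add_mem' := fun {a b} ha hb => by
        rw [Set.mem_ofPred_eq, map_add]
        exact P.v.map_add_lt ha hb
      zero_mem' := by simp
      smul_mem' := fun a b hb => by
        rw [Set.mem_ofPred_eq, smul_eq_mul, map_mul, map_mul]
        exact mul_lt_one_of_le_one_of_lt_one (P.v_aeval_le hP a) hb }
  have hIbot : I ≠ ⊥ := by
    intro hI
    obtain ⟨f, hf⟩ := P.exists_one_lt
    obtain ⟨r, s, rfl⟩ := h.exists_div f
    have hs0 : s ≠ 0 := by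
      rintro rfl
      simp at hf
    have hs : P.v (aeval x s) = 1 := by
      refine (P.v_aeval_le hP s).eq_of_not_lt fun hlt => hs0 ?_
      have : s ∈ I := hlt
      rwa [hI] at this
    rw [map_div₀, hs, div_one] at hf
    exact absurd hf (not_lt.2 (P.v_aeval_le hP r))
  have hI : I.IsPrime := by
    refine Ideal.isPrime_iff.2 ⟨?_, fun {a b} hab => ?_⟩
    · rw [Ideal.ne_top_iff_one]
      intro h1
      have h2 : P.v (aeval x (1 : k[X])) < 1 := h1
      simp at h2
    · by_contra! hcon
      have h1 : P.v (aeval x a) = 1 := (P.v_aeval_le hP a).eq_of_not_lt hcon.1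
      have h2 : P.v (aeval x b) = 1 := (P.v_aeval_le hP b).eq_of_not_lt hcon.2
      have h3 : P.v (aeval x (a * b)) < 1 := hab
      rw [map_mul, map_mul, h1, h2, mul_one] at h3
      exact lt_irrefl _ h3
  refine ⟨Submodule.IsPrincipal.generator I,
    (Submodule.IsPrincipal.prime_generator_of_isPrime I hIbot).irreducible, fun q => ?_⟩
  rw [← Submodule.IsPrincipal.mem_iff_generator_dvd]
  rfl

variable {P : Place k K} {p : k[X]}

theorem v_eq_one_of_not_dvd (hP : P.v x ≤ 1) (hp : ∀ q, P.v (aeval x q) < 1 ↔ p ∣ q) {q : k[X]}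
    (hq : ¬ p ∣ q) : P.v (aeval x q) = 1 :=
  (P.v_aeval_le hP q).eq_of_not_lt fun hlt => hq ((hp q).1 hlt)

theorem isParam (h : IsCoordinate k x) (hP : P.v x ≤ 1) (hirr : Irreducible p)
    (hp : ∀ q, P.v (aeval x q) < 1 ↔ p ∣ q) : P.IsParam (aeval x p) := by
  have hv : ∀ q : k[X], q ≠ 0 → ∃ n : ℕ, P.v (aeval x q) = P.v (aeval x p) ^ n := by
    intro q hq
    obtain ⟨q', hq', hdvd⟩ :=
      (FiniteMultiplicity.of_prime_left hirr.prime hq).exists_eq_pow_mul_and_not_dvd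
    refine ⟨multiplicity p q, ?_⟩
    conv_lhs =>
      rw [hq', map_mul, map_pow, map_mul, map_pow, v_eq_one_of_not_dvd hP hp hdvd, mul_one]
  refine ⟨(hp p).2 dvd_rfl, fun f hf => ?_⟩
  obtain ⟨r, s, rfl⟩ := h.exists_div f
  have hr : r ≠ 0 := by rintro rfl; simp at hf
  have hs : s ≠ 0 := by rintro rfl; simp at hf
  obtain ⟨m, hm⟩ := hv r hr
  obtain ⟨n, hn⟩ := hv s hs
  refine ⟨m - n, ?_⟩
  have h0 : P.v (aeval x p) ≠ 0 := by
    rw [Ne, map_eq_zero]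
    exact h.aeval_ne_zero hirr.ne_zero
  rw [map_div₀, hm, hn, zpow_sub₀ h0, zpow_natCast, zpow_natCast]

theorem exists_div_not_dvd (h : IsCoordinate k x) (hP : P.v x ≤ 1) (hirr : Irreducible p)
    (hp : ∀ q, P.v (aeval x q) < 1 ↔ p ∣ q) {f : K} (hf : P.v f ≤ 1) :
    ∃ r s : k[X], ¬ p ∣ s ∧ f = aeval x r / aeval x s := by
  obtain ⟨r, s, rfl⟩ := h.exists_div f
  by_cases hr : r = 0
  · exact ⟨0, 1, fun h1 => hirr.not_isUnit (isUnit_of_dvd_one h1), by simp [hr]⟩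
  by_cases hs : s = 0
  · exact ⟨0, 1, fun h1 => hirr.not_isUnit (isUnit_of_dvd_one h1), by simp [hs]⟩
  obtain ⟨r', hr', hrd⟩ :=
    (FiniteMultiplicity.of_prime_left hirr.prime hr).exists_eq_pow_mul_and_not_dvd
  obtain ⟨s', hs', hsd⟩ :=
    (FiniteMultiplicity.of_prime_left hirr.prime hs).exists_eq_pow_mul_and_not_dvd
  set m := multiplicity p r
  set n := multiplicity p s
  have hpar := h.isParam hP hirr hp
  have hmn : n ≤ m := by
    rw [hr', hs', map_mul, map_mul, map_pow, map_pow, map_div₀, map_mul, map_mul, map_pow, map_pow,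
      v_eq_one_of_not_dvd hP hp hrd, v_eq_one_of_not_dvd hP hp hsd, mul_one, mul_one,
      ← zpow_natCast, ← zpow_natCast, ← zpow_sub₀ hpar.v_pos.ne', hpar.zpow_le_one] at hf
    omega
  refine ⟨p ^ (m - n) * r', s', hsd, ?_⟩
  have h1 : aeval x p ≠ 0 := h.aeval_ne_zero hirr.ne_zero
  have h2 : aeval x s' ≠ 0 := h.aeval_ne_zero fun h0 => hsd (h0 ▸ dvd_zero p)
  rw [hr', hs', show p ^ m = p ^ n * p ^ (m - n) by rw [← pow_add, Nat.add_sub_cancel' hmn]]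
  simp only [map_mul, map_pow]
  field_simp

theorem eq_of_irreducible (h : IsCoordinate k x) {P' : Place k K} (hP : P.v x ≤ 1)
    (hP' : P'.v x ≤ 1) (hirr : Irreducible p) (hp : P.v (aeval x p) < 1)
    (hp' : P'.v (aeval x p) < 1) : P = P' := by
  have key : ∀ P : Place k K, P.v x ≤ 1 → P.v (aeval x p) < 1 →
      ∀ q, P.v (aeval x q) < 1 ↔ p ∣ q := by
    intro P hP hlt q
    obtain ⟨p', hirr', hp'⟩ := h.exists_irreducible hP
    rw [hp'] at hlt ⊢
    exact (hirr'.associated_of_dvd hirr hlt).dvd_iff_dvd_left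
  have hle : ∀ P P' : Place k K, P.v x ≤ 1 → P.v (aeval x p) < 1 → P'.v x ≤ 1 →
      P'.v (aeval x p) < 1 → ∀ f ∈ P.ring, f ∈ P'.ring := by
    intro P P' hP hp hP' hp' f hf
    obtain ⟨r, s, hs, rfl⟩ := h.exists_div_not_dvd hP hirr (key P hP hp) (Place.mem_ring.1 hf)
    rw [Place.mem_ring, map_div₀, v_eq_one_of_not_dvd hP' (key P' hP' hp') hs, div_one]
    exact P'.v_aeval_le hP' r
  exact Place.eq_of_ring_eq (SetLike.ext fun f =>
    ⟨hle P P' hP hp hP' hp' f, hle P' P hP' hp' hP hp f⟩)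

/-- The denominator is invertible modulo p by Bézout. -/
theorem exists_residue (h : IsCoordinate k x) (hP : P.v x ≤ 1) (hirr : Irreducible p)
    (hp : ∀ q, P.v (aeval x q) < 1 ↔ p ∣ q) {f : K} (hf : P.v f ≤ 1) :
    ∃ q : k[X], P.v (f - aeval x q) < 1 := by
  obtain ⟨r, s, hs, rfl⟩ := h.exists_div_not_dvd hP hirr hp hf
  obtain ⟨a, b, hab⟩ := (hirr.coprime_iff_not_dvd.2 hs : IsCoprime p s)
  have hs0 : aeval x s ≠ 0 := h.aeval_ne_zero fun h0 => hs (h0 ▸ dvd_zero p)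
  refine ⟨r * b, ?_⟩
  have h1 : aeval x a * aeval x p + aeval x b * aeval x s = 1 := by
    rw [← map_mul, ← map_mul, ← map_add, hab, map_one]
  have h2 : aeval x r / aeval x s - aeval x (r * b) = aeval x (r * a * p) / aeval x s := by
    simp only [map_mul]
    field_simp
    linear_combination -aeval x r * h1
  rw [h2, map_div₀, v_eq_one_of_not_dvd hP hp hs, div_one, hp]
  exact dvd_mul_left p _

theorem degree_eq (h : IsCoordinate k x) (hP : P.v x ≤ 1) (hirr : Irreducible p)
    (hp : ∀ q, P.v (aeval x q) < 1 ↔ p ∣ q) :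
    Module.Finite k (ResidueField P.ring) ∧ P.degree = p.natDegree := by
  have : IsScalarTower k P.ring K := IsScalarTower.of_algebraMap_eq fun _ => rfl
  let x₀ : P.ring := ⟨x, Place.mem_ring.2 hP⟩
  let φ : k[X] →ₐ[k] ResidueField P.ring := aeval (residue P.ring x₀)
  have hφ : ∀ q, φ q = residue P.ring (aeval x₀ q) := fun q =>
    aeval_algebraMap_apply (ResidueField P.ring) x₀ q
  have hcoe : ∀ q : k[X], ((aeval x₀ q : P.ring) : K) = aeval x q := fun q =>
    (aeval_algebraMap_apply K x₀ q).symm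
  have hsurj : Function.Surjective φ := by
    intro c
    obtain ⟨f, rfl⟩ := residue_surjective c
    obtain ⟨q, hq⟩ := h.exists_residue hP hirr hp (P.ring.valuation_le_one f)
    refine ⟨q, ?_⟩
    rw [hφ, eq_comm, Place.residue_eq_iff, hcoe]
    exact hq
  have hker : RingHom.ker φ = Ideal.span {p} := by
    ext q
    rw [RingHom.mem_ker, hφ, Place.residue_eq_zero_iff, hcoe, hp, Ideal.mem_span_singleton]
  have e : (k[X] ⧸ Ideal.span {p}) ≃ₗ[k] ResidueField P.ring :=
    ((Ideal.quotientEquivAlgOfEq k hker.symm).trans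
      (Ideal.quotientKerAlgEquivOfSurjective hsurj)).toLinearEquiv
  have hdeg : Module.finrank k (k[X] ⧸ Ideal.span {p}) = p.natDegree :=
    finrank_quotient_span_eq_natDegree
  have hfin : Module.Finite k (k[X] ⧸ Ideal.span {p}) :=
    Module.finite_of_finrank_pos (by rw [hdeg]; exact hirr.natDegree_pos)
  exact ⟨Module.Finite.equiv e, by rw [Place.degree, ← e.finrank_eq, hdeg]⟩

/-- The point defined by an irreducible polynomial. -/
theorem exists_place (h : IsCoordinate k x) (hirr : Irreducible p) :
    ∃ P : Place k K, (∀ P' : Place k K, P'.v x ≤ 1 ∧ P'.v (aeval x p) < 1 ↔ P' = P) ∧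
      P.degree = p.natDegree ∧ P.IsParam (aeval x p) := by
  obtain ⟨P, hP, hlt⟩ := exists_place_aeval_lt h.transcendental hirr.ne_zero hirr.not_isUnit
  obtain ⟨p', hirr', hp'⟩ := h.exists_irreducible hP
  have hp : ∀ q, P.v (aeval x q) < 1 ↔ p ∣ q := by
    intro q
    rw [hp'] at hlt ⊢
    exact (hirr'.associated_of_dvd hirr hlt).dvd_iff_dvd_left
  refine ⟨P, fun P' => ⟨fun hP' => h.eq_of_irreducible hP'.1 hP hirr hP'.2 hlt, ?_⟩,
    (h.degree_eq hP hirr hp).2, h.isParam hP hirr hp⟩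
  rintro rfl
  exact ⟨hP, hlt⟩

/-- The pole of x is the zero of the coordinate x⁻¹. -/
theorem exists_place_infty (h : IsCoordinate k x) :
    ∃ P : Place k K, (∀ P' : Place k K, 1 < P'.v x ↔ P' = P) ∧
      P.degree = 1 ∧ P.IsParam x⁻¹ := by
  obtain ⟨P, hP, hdeg, hpar⟩ := h.inv.exists_place (p := X) irreducible_X
  rw [aeval_X] at hpar
  refine ⟨P, fun P' => ?_, by rw [hdeg, natDegree_X], hpar⟩
  rw [← hP, aeval_X, map_inv₀, inv_lt_one₀ (by simpa [zero_lt_iff] using h.ne_zero)]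
  refine ⟨fun h1 => ⟨?_, h1⟩, fun h1 => h1.2⟩
  exact (inv_lt_one_of_one_lt₀ h1).le

theorem isCurve (h : IsCoordinate k x) : IsCurve k K := by
  have hinf : ∀ P : Place k K, 1 < P.v x → P.v x⁻¹ ≤ 1 := fun P hP => by
    rw [map_inv₀]
    exact (inv_lt_one_of_one_lt₀ hP).le
  refine ⟨fun P => ?_, fun P => ?_, fun f => ?_⟩
  · rcases le_or_gt (P.v x) 1 with hP | hP
    · obtain ⟨p, hirr, hp⟩ := h.exists_irreducible hP
      exact ⟨_, h.isParam hP hirr hp⟩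
    · obtain ⟨p, hirr, hp⟩ := h.inv.exists_irreducible (hinf P hP)
      exact ⟨_, h.inv.isParam (hinf P hP) hirr hp⟩
  · rcases le_or_gt (P.v x) 1 with hP | hP
    · obtain ⟨p, hirr, hp⟩ := h.exists_irreducible hP
      exact (h.degree_eq hP hirr hp).1
    · obtain ⟨p, hirr, hp⟩ := h.inv.exists_irreducible (hinf P hP)
      exact (h.inv.degree_eq (hinf P hP) hirr hp).1
  · have hfin : ∀ s : k[X], s ≠ 0 → {P : Place k K | P.v x ≤ 1 ∧ P.v (aeval x s) < 1}.Finite := by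
      intro s
      induction s using WfDvdMonoid.induction_on_irreducible with
      | zero => intro h0; exact absurd rfl h0
      | unit s hs =>
        intro _
        convert Set.finite_empty
        ext P
        simp only [Set.mem_ofPred_eq, Set.mem_empty_iff_false, iff_false, not_and, not_lt]
        intro hP
        obtain ⟨c, hc, rfl⟩ := Polynomial.isUnit_iff.1 hs
        rw [aeval_C, P.v_algebraMap hc.ne_zero]
      | mul s q hs hq ih =>
        intro h0
        obtain ⟨P₀, hP₀, -⟩ := h.exists_place hq
        refine ((Set.finite_singleton P₀).union (ih hs)).subset fun P hP => ?_
        by_contra hcon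
        rw [Set.mem_union, not_or, Set.mem_singleton_iff, ← hP₀] at hcon
        obtain ⟨hcon1, hcon2⟩ := hcon
        have h1 : P.v (aeval x q) = 1 :=
          (P.v_aeval_le hP.1 q).eq_of_not_lt fun hlt => hcon1 ⟨hP.1, hlt⟩
        have h2 : P.v (aeval x s) = 1 :=
          (P.v_aeval_le hP.1 s).eq_of_not_lt fun hlt => hcon2 ⟨hP.1, hlt⟩
        have h3 := hP.2
        rw [map_mul, map_mul, h1, h2, mul_one] at h3
        exact lt_irrefl _ h3
    obtain ⟨r, s, rfl⟩ := h.exists_div f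
    by_cases hs : s = 0
    · subst hs
      convert Set.finite_empty
      ext P
      simp only [map_zero, div_zero, Set.mem_ofPred_eq, Set.mem_empty_iff_false, iff_false, not_not]
      exact P.ring.zero_mem
    obtain ⟨P₀, hP₀, -⟩ := h.exists_place_infty
    refine ((Set.finite_singleton P₀).union (hfin s hs)).subset fun P hP => ?_
    by_contra hcon
    rw [Set.mem_union, not_or, Set.mem_singleton_iff, ← hP₀, not_lt] at hcon
    obtain ⟨hcon1, hcon2⟩ := hcon
    have h2 : P.v (aeval x s) = 1 :=
      (P.v_aeval_le hcon1 s).eq_of_not_lt fun hlt => hcon2 ⟨hcon1, hlt⟩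
    apply hP
    rw [Place.mem_ring, map_div₀, h2, div_one]
    exact P.v_aeval_le hcon1 r

/-- The only functions without poles on the projective line are the constants. -/
theorem exists_eq_algebraMap (h : IsCoordinate k x) {f : K} (hf : ∀ P : Place k K, P.v f ≤ 1) :
    ∃ c : k, f = algebraMap k K c := by
  -- A nonconstant f is transcendental, so f⁻¹ vanishes at some place, and f has a pole there.
  by_contra! hcon
  have htr : Transcendental k f := by
    have hmem : f ∈ IntermediateField.adjoin k {x} := by rw [h.adjoin_eq_top]; trivial
    let e := RatFunc.algEquivOfTranscendental x h.transcendental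
    obtain ⟨F, hF⟩ := e.surjective ⟨f, hmem⟩
    have h1 : Transcendental k F := by
      apply RatFunc.transcendental_of_ne_C
      rintro ⟨c, rfl⟩
      apply hcon c
      have h2 : e (algebraMap k (RatFunc k) c) = ⟨f, hmem⟩ := hF
      rw [AlgEquiv.commutes] at h2
      exact (congrArg Subtype.val h2).symm
    intro halg
    apply h1
    have h3 : IsAlgebraic k (e F) := by
      rw [hF]
      exact (isAlgebraic_algHom_iff (IntermediateField.val _) Subtype.val_injective).1 halg
    exact (isAlgebraic_algHom_iff e.toAlgHom e.injective).1 h3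
  have hinv : Transcendental k f⁻¹ := fun ha => htr (by simpa using ha.inv)
  obtain ⟨P, -, hP⟩ := exists_place_aeval_lt hinv X_ne_zero not_isUnit_X
  rw [aeval_X, map_inv₀] at hP
  have hf0 : f ≠ 0 := by
    rintro rfl
    exact htr isAlgebraic_zero
  rw [inv_lt_one₀ (by simpa [zero_lt_iff] using hf0)] at hP
  exact absurd hP (not_lt.2 (hf P))

theorem ell_zero (h : IsCoordinate k x) :
    Module.Finite k (0 : Divisor k K).riemannRochSpace ∧ (0 : Divisor k K).ell = 1 := by
  have h1 : (0 : Divisor k K).riemannRochSpace = LinearMap.range (Algebra.linearMap k K) := by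
    ext f
    rw [mem_riemannRochSpace h.isCurve]
    simp only [Finsupp.coe_zero, Pi.zero_apply, zpow_zero, mul_one]
    constructor
    · intro hf
      obtain ⟨c, rfl⟩ := h.exists_eq_algebraMap fun P => by
        obtain ⟨t, ht⟩ := h.isCurve.exists_isParam P
        exact hf P t ht
      exact ⟨c, rfl⟩
    · rintro ⟨c, rfl⟩ P t _
      exact P.v_algebraMap_le c
  have e : k ≃ₗ[k] (0 : Divisor k K).riemannRochSpace :=
    (LinearEquiv.ofInjective (Algebra.linearMap k K) (algebraMap k K).injective).trans
      (LinearEquiv.ofEq _ _ h1.symm)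
  exact ⟨Module.Finite.equiv e, by rw [Divisor.ell, ← e.finrank_eq, Module.finrank_self]⟩

/-- The projective line has genus zero. -/
theorem hasGenus (h : IsCoordinate k x) : HasGenus k K 0 := by
  have hC := h.isCurve
  obtain ⟨P₀, hP₀, hdeg₀, hpar₀⟩ := h.exists_place_infty
  have key : ∀ D : Divisor k K, 0 ≤ D → Module.Finite k D.riemannRochSpace ∧
      (D.ell : ℤ) = D.degree + 1 := by
    intro D hD
    refine Divisor.induction_ge (p := fun D : Divisor k K => Module.Finite k D.riemannRochSpace ∧
      (D.ell : ℤ) = D.degree + 1) ⟨h.ell_zero.1, ?_⟩ ?_ hD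
    · rw [h.ell_zero.2, Divisor.degree_zero]
      rfl
    intro D hD P ⟨hfin, hell⟩
    refine ⟨(finite_riemannRochSpace_add_single hC P hfin).1, ?_⟩
    suffices hsuff : (D + Finsupp.single P 1).ell = D.ell + P.degree by
      rw [hsuff, Divisor.degree_add, Divisor.degree_single]
      push_cast
      rw [hell]
      ring
    have hregular : ∀ (Q : Place k K) (f t : K), Q ≠ P → Q.v f ≤ 1 → Q.IsParam t →
        Q.v f * Q.v t ^ ((D + Finsupp.single P 1 : Divisor k K) Q) ≤ 1 := by
      intro Q f t hQ hf ht
      rw [Finsupp.add_apply, Finsupp.single_eq_of_ne hQ, add_zero]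
      exact mul_le_one' hf (ht.zpow_le_one.2 (hD Q))
    have hn : 0 ≤ D P := hD P
    obtain ⟨n, hn⟩ := Int.eq_ofNat_of_zero_le hn
    have hnP : (D + Finsupp.single P 1 : Divisor k K) P = ((n + 1 : ℕ) : ℤ) := by
      rw [Finsupp.add_apply, Finsupp.single_eq_same, hn]
      rfl
    rcases le_or_gt (P.v x) 1 with hP | hP
    · obtain ⟨p, hirr, hp⟩ := h.exists_irreducible hP
      have hpar := h.isParam hP hirr hp
      rw [ell_add_single_eq hC hpar hfin]
      intro c
      obtain ⟨f, rfl⟩ := residue_surjective c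
      obtain ⟨q, hq⟩ := h.exists_residue hP hirr hp (P.ring.valuation_le_one f)
      have hqr : P.v (f - aeval x (q % p)) < 1 := by
        have : (f : K) - aeval x (q % p) = (f - aeval x q) + aeval x (p * (q / p)) := by
          nth_rewrite 2 [← EuclideanDomain.div_add_mod q p]
          rw [map_add]
          ring
        rw [this]
        exact P.v.map_add_lt hq ((hp _).2 (dvd_mul_right _ _))
      set r := q % p
      have hpow : aeval x p ^ (n + 1) ≠ 0 := pow_ne_zero _ hpar.ne_zero
      -- Reducing modulo p gives deg r < deg p, so the quotient has its only pole at P and is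
      -- regular at infinity.
      have hmem : aeval x r / aeval x p ^ (n + 1) ∈
          (D + Finsupp.single P 1).riemannRochSpace := by
        rw [mem_riemannRochSpace hC]
        intro Q t ht
        by_cases hQP : Q = P
        · subst hQP
          rw [hnP, hpar.v_eq ht, zpow_natCast, ← map_pow Q.v, ← map_mul, div_mul_cancel₀ _ hpow]
          exact Q.v_aeval_le hP r
        refine hregular Q _ t hQP ?_ ht
        rw [map_div₀, map_pow]
        rcases le_or_gt (Q.v x) 1 with hQ | hQ
        · have : Q.v (aeval x p) = 1 := (Q.v_aeval_le hQ p).eq_of_not_lt fun hlt =>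
            hQP (h.eq_of_irreducible hQ hP hirr hlt hpar.1)
          rw [this, one_pow, div_one]
          exact Q.v_aeval_le hQ r
        · rcases eq_or_ne r 0 with h0 | h0
          · rw [h0]
            simp
          rw [Q.v_aeval_of_one_lt hQ h0, Q.v_aeval_of_one_lt hQ hirr.ne_zero, ← pow_mul]
          refine div_le_one_of_le₀ (pow_le_pow_right₀ hQ.le ?_) zero_le
          have hlt : r.natDegree < p.natDegree :=
            natDegree_lt_natDegree h0 (EuclideanDomain.mod_lt q hirr.ne_zero)
          nlinarith
      refine ⟨⟨_, hmem⟩, ?_⟩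
      change residue P.ring _ = _
      rw [eq_comm, Place.residue_eq_iff]
      change P.v (f - aeval x r / aeval x p ^ (n + 1) * aeval x p ^ (D P + 1)) < 1
      rw [hn, show ((n : ℕ) : ℤ) + 1 = ((n + 1 : ℕ) : ℤ) from rfl, zpow_natCast,
        div_mul_cancel₀ _ hpow]
      exact hqr
    · obtain rfl := (hP₀ P).1 hP
      rw [ell_add_single_eq hC hpar₀ hfin]
      have hx' : P.v x⁻¹ ≤ 1 := hpar₀.1.le
      obtain ⟨p, hirr, hp⟩ := h.inv.exists_irreducible hx'
      intro c
      obtain ⟨f, rfl⟩ := residue_surjective c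
      have hpX : p ∣ X := (hp X).1 (by rw [aeval_X]; exact hpar₀.1)
      obtain ⟨q, hq⟩ := h.inv.exists_residue hx' hirr hp (P.ring.valuation_le_one f)
      have hqc : P.v (f - algebraMap k K (q.coeff 0)) < 1 := by
        have : (f : K) - algebraMap k K (q.coeff 0) =
            (f - aeval x⁻¹ q) + aeval x⁻¹ (q - C (q.coeff 0)) := by
          rw [map_sub, aeval_C]
          ring
        rw [this]
        refine P.v.map_add_lt hq ((hp _).2 (hpX.trans ?_))
        rw [X_dvd_iff]
        simp
      have hx0 := h.ne_zero
      have hmem : algebraMap k K (q.coeff 0) * x ^ (n + 1) ∈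
          (D + Finsupp.single P 1).riemannRochSpace := by
        rw [mem_riemannRochSpace hC]
        intro Q t ht
        by_cases hQP : Q = P
        · subst hQP
          rw [hnP, hpar₀.v_eq ht, zpow_natCast, ← map_pow, ← map_mul, mul_assoc, ← mul_pow,
            mul_inv_cancel₀ hx0, one_pow, mul_one]
          exact Q.v_algebraMap_le _
        refine hregular Q _ t hQP ?_ ht
        rw [map_mul, map_pow]
        exact mul_le_one' (Q.v_algebraMap_le _)
          (pow_le_one₀ zero_le (not_lt.1 fun hQ => hQP ((hP₀ Q).1 hQ)))
      refine ⟨⟨_, hmem⟩, ?_⟩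
      change residue P.ring _ = _
      rw [eq_comm, Place.residue_eq_iff]
      change P.v (f - algebraMap k K (q.coeff 0) * x ^ (n + 1) * x⁻¹ ^ (D P + 1)) < 1
      rw [hn, show ((n : ℕ) : ℤ) + 1 = ((n + 1 : ℕ) : ℤ) from rfl, zpow_natCast, mul_assoc,
        ← mul_pow, mul_inv_cancel₀ hx0, one_pow, mul_one]
      exact hqc
  intro D
  refine ⟨D ⊔ 0, le_sup_left, (key _ le_sup_right).1, ?_⟩
  rw [(key _ le_sup_right).2]
  ring

end IsCoordinate

end RationalFunctionField

/-! ### Total degrees of finite sets of points -/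

section DegreeSums

variable {k K : Type*} [Field k] [Field K] [Algebra k K]

/-- `S` is a finite set of points of total degree `n`. -/
def HasDegree (S : Set (Place k K)) (n : ℕ) : Prop :=
  ∃ F : Finset (Place k K), (∀ P, P ∈ F ↔ P ∈ S) ∧ ∑ P ∈ F, P.degree = n

theorem HasDegree.congr {S T : Set (Place k K)} {n : ℕ} (h : HasDegree S n)
    (hST : ∀ P, P ∈ T ↔ P ∈ S) : HasDegree T n := by
  obtain ⟨F, hF, hn⟩ := h
  exact ⟨F, fun P => by rw [hF, hST], hn⟩

theorem hasDegree_empty : HasDegree (∅ : Set (Place k K)) 0 := ⟨∅, by simp, by simp⟩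

theorem hasDegree_singleton {S : Set (Place k K)} {Q : Place k K} (h : ∀ P, P ∈ S ↔ P = Q) :
    HasDegree S Q.degree := ⟨{Q}, by simp [h], by simp⟩

theorem HasDegree.union {S T : Set (Place k K)} {m n : ℕ} (hS : HasDegree S m)
    (hT : HasDegree T n) (hST : ∀ P ∈ S, P ∉ T) : HasDegree (S ∪ T) (m + n) := by
  classical
  obtain ⟨F, hF, rfl⟩ := hS
  obtain ⟨G, hG, rfl⟩ := hT
  refine ⟨F ∪ G, fun P => by rw [Finset.mem_union, hF, hG, Set.mem_union], ?_⟩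
  refine Finset.sum_union (Finset.disjoint_left.2 fun P hP => ?_)
  rw [hG]
  exact hST P ((hF P).1 hP)

theorem HasDegree.biUnion {S : ℕ → Set (Place k K)} {d : ℕ → ℕ} (N : ℕ)
    (hS : ∀ n < N, HasDegree (S n) (d n)) (hdisj : ∀ m n, m < n → n < N → ∀ P ∈ S m, P ∉ S n) :
    HasDegree {P | ∃ n < N, P ∈ S n} (∑ n ∈ Finset.range N, d n) := by
  induction N with
  | zero => exact hasDegree_empty.congr (by simp)
  | succ N ih =>
    rw [Finset.sum_range_succ]
    refine ((ih (fun n hn => hS n (hn.trans N.lt_succ_self)) fun m n hmn hn =>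
      hdisj m n hmn (hn.trans N.lt_succ_self)).union (hS N N.lt_succ_self) ?_).congr ?_
    · rintro P ⟨n, hn, hP⟩
      exact hdisj n N hn N.lt_succ_self P hP
    · intro P
      rw [Set.mem_union, Set.mem_ofPred_eq, Set.mem_ofPred_eq]
      constructor
      · rintro ⟨n, hn, hP⟩
        rcases Nat.lt_succ_iff_lt_or_eq.1 hn with hn | rfl
        exacts [Or.inl ⟨n, hn, hP⟩, Or.inr hP]
      · rintro (⟨n, hn, hP⟩ | hP)
        exacts [⟨n, hn.trans N.lt_succ_self, hP⟩, ⟨N, N.lt_succ_self, hP⟩]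

theorem HasDegree.exists_divisor {S : Set (Place k K)} {n : ℕ} (h : HasDegree S n) :
    ∃ E : Divisor k K, (∀ P ∈ S, E P = 1) ∧ (∀ P ∉ S, E P = 0) ∧ E.degree = n := by
  classical
  obtain ⟨F, hF, rfl⟩ := h
  refine ⟨Finsupp.indicator F fun _ _ => 1, fun P hP => ?_, fun P hP => ?_, ?_⟩
  · exact Finsupp.indicator_of_mem ((hF P).2 hP) _
  · exact Finsupp.indicator_of_notMem (fun h => hP ((hF P).1 h)) _
  · rw [Divisor.degree, Finsupp.sum_of_support_subset _ (Finsupp.support_indicator_subset _ _) _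
      (by simp)]
    push_cast
    refine Finset.sum_congr rfl fun P hP => ?_
    rw [Finsupp.indicator_of_mem hP, one_mul]

variable {K' : Type*} [Field K'] [Algebra k K'] [Algebra K K'] [IsScalarTower k K K']
  [Algebra.IsAlgebraic K K']

theorem HasDegree.of_fibers {S : Set (Place k K)} {T : Set (Place k K')} {m n : ℕ}
    (hS : HasDegree S n) (hT : ∀ Q ∈ T, Q.under K ∈ S)
    (h : ∀ P ∈ S, HasDegree {Q : Place k K' | Q.under K = P ∧ Q ∈ T} (m * P.degree)) :
    HasDegree T (m * n) := by
  classical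
  obtain ⟨F, hF, rfl⟩ := hS
  have h' : ∀ P, ∃ G : Finset (Place k K'), P ∈ S →
      (∀ Q, Q ∈ G ↔ (Q.under K = P ∧ Q ∈ T)) ∧ ∑ Q ∈ G, Q.degree = m * P.degree := by
    intro P
    by_cases hP : P ∈ S
    · obtain ⟨G, hG, hG'⟩ := h P hP
      exact ⟨G, fun _ => ⟨hG, hG'⟩⟩
    · exact ⟨∅, fun hP' => absurd hP' hP⟩
  choose G hG using h'
  refine ⟨F.biUnion G, fun Q => ?_, ?_⟩
  · rw [Finset.mem_biUnion]
    constructor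
    · rintro ⟨P, hP, hQ⟩
      exact (((hG P ((hF P).1 hP)).1 Q).1 hQ).2
    · intro hQ
      exact ⟨Q.under K, (hF _).2 (hT Q hQ), ((hG _ (hT Q hQ)).1 Q).2 ⟨rfl, hQ⟩⟩
  · rw [Finset.sum_biUnion, Finset.mul_sum]
    · exact Finset.sum_congr rfl fun P hP => (hG P ((hF P).1 hP)).2
    · intro P hP P' hP' hne
      rw [Function.onFun, Finset.disjoint_left]
      intro Q hQ hQ'
      exact hne ((((hG P ((hF P).1 hP)).1 Q).1 hQ).1.symm.trans
        (((hG P' ((hF P').1 hP')).1 Q).1 hQ').1)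

theorem IsFiber.hasDegree_one {P : Place k K} {z : K'} (h : IsFiber P z 1) :
    HasDegree {Q : Place k K' | Q.under K = P} (2 * P.degree) := by
  obtain ⟨S, hS, hd⟩ := h.exists_finset
  exact ⟨S, hS, by rw [← hd, one_mul]⟩

theorem IsFiber.hasDegree_two {P : Place k K} {z : K'} (h : IsFiber P z 2) :
    HasDegree {Q : Place k K' | Q.under K = P} P.degree := by
  obtain ⟨S, hS, hd⟩ := h.exists_finset
  exact ⟨S, hS, by omega⟩

end DegreeSums

/-! ### Zeros and poles of x + 1 + 1/x -/

section Values

set_option linter.unusedSectionVars false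

variable {k K : Type*} [Field k] [Field K] [Algebra k K] [CharP K 2] {P : Place k K} {x : K}

theorem Place.v_inv_lt_one {x : K} (hx : 1 < P.v x) : P.v (1 / x) < 1 := by
  rw [one_div, map_inv₀]
  exact inv_lt_one_of_one_lt₀ hx

theorem Place.one_lt_v_inv {x : K} (hx0 : x ≠ 0) (hx : P.v x < 1) : 1 < P.v (1 / x) := by
  rw [one_div, map_inv₀]
  exact (one_lt_inv₀ (by simpa [zero_lt_iff] using hx0)).2 hx

/-- At a pole of `x`, the function `x + 1 + 1 / x` agrees with `x` up to a regular function. -/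
theorem Place.v_add_self_of_pole (hx : 1 < P.v x) : P.v (x + (x + 1 + 1 / x)) ≤ 1 := by
  have : x + (x + 1 + 1 / x) = 1 + 1 / x := by
    linear_combination x * CharTwo.two_eq_zero (R := K)
  rw [this]
  exact P.v.map_add_le (by simp) (Place.v_inv_lt_one hx).le

/-- At a zero of `x`, the function `x + 1 + 1 / x` agrees with `1 / x` up to a regular function. -/
theorem Place.v_add_inv_of_zero (hx : P.v x < 1) : P.v (1 / x + (x + 1 + 1 / x)) ≤ 1 := by
  have : 1 / x + (x + 1 + 1 / x) = x + 1 := by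
    linear_combination 1 / x * CharTwo.two_eq_zero (R := K)
  rw [this]
  exact P.v.map_add_le hx.le (by simp)

theorem Place.one_lt_of_add_le {f g : K} (h : P.v (f + g) ≤ 1) (hf : 1 < P.v f) : 1 < P.v g := by
  have : g = (f + g) - f := by ring
  rw [this, P.v.map_sub_eq_of_lt_right (h.trans_lt hf)]
  exact hf

theorem Place.one_lt_v_of_ne_one (hx0 : x ≠ 0) (hx : P.v x ≠ 1) : 1 < P.v (x + 1 + 1 / x) := by
  rcases lt_or_gt_of_ne hx with h | h
  · exact Place.one_lt_of_add_le (Place.v_add_inv_of_zero h) (Place.one_lt_v_inv hx0 h)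
  · exact Place.one_lt_of_add_le (Place.v_add_self_of_pole h) h

theorem Place.v_le_one_of_eq_one (hx : P.v x = 1) : P.v (x + 1 + 1 / x) ≤ 1 := by
  refine P.v.map_add_le (P.v.map_add_le hx.le (by simp)) ?_
  rw [one_div, map_inv₀, hx, inv_one]

/-- From x + 1 + 1/x = (x² + x + 1)/x: below a point where the next coordinate is 0 or 1, x is a
primitive cube root of unity. -/
theorem Place.v_lt_one_iff_cyclotomic (hx0 : x ≠ 0) :
    P.v (x + 1 + 1 / x) < 1 ↔ P.v (x ^ 2 + x + 1) < 1 := by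
  have hxe : x ^ 2 + x + 1 = (x + 1 + 1 / x) * x := by field_simp
  constructor
  · intro h
    have hx : P.v x = 1 := by
      by_contra hne
      exact absurd h (not_lt.2 (Place.one_lt_v_of_ne_one hx0 hne).le)
    rwa [hxe, map_mul, hx, mul_one]
  · intro h
    have hx1 := Place.v_eq_one_of_cyclotomic h
    rwa [hxe, map_mul, hx1, mul_one] at h

theorem Place.v_eq_one_of_add_one (h : P.v (x + 1) < 1) : P.v x = 1 := by
  have : x = (x + 1) - 1 := by ring
  rw [this, P.v.map_sub_eq_of_lt_right (by rwa [map_one]), map_one]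

/-- From x + 1 + 1/x + 1 = (x + 1)²/x: below a cube root of unity lies x = 1. The square is the
source of the bound by s² in the chains. -/
theorem Place.v_add_one_lt_one_iff (hx0 : x ≠ 0) :
    P.v (x + 1 + 1 / x + 1) < 1 ↔ P.v (x + 1) < 1 := by
  have hxe : (x + 1) ^ 2 = (x + 1 + 1 / x + 1) * x := by
    field_simp
    ring
  constructor
  · intro h
    have hx : P.v x = 1 := by
      by_contra hne
      have h1 := Place.one_lt_v_of_ne_one hx0 hne
      rw [P.v.map_add_eq_of_lt_left (by rwa [map_one])] at h
      exact absurd h (not_lt.2 h1.le)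
    have h2 : P.v (x + 1) ^ 2 < 1 := by rwa [← map_pow, hxe, map_mul, hx, mul_one]
    exact (pow_lt_one_iff_of_nonneg zero_le two_ne_zero).1 h2
  · intro h
    have h2 : P.v ((x + 1) ^ 2) < 1 := by
      rw [map_pow]
      exact pow_lt_one₀ zero_le h two_ne_zero
    rwa [hxe, map_mul, Place.v_eq_one_of_add_one h, mul_one] at h2

end Values

/-! ### Ramification pattern and degree count -/

/-- Whether a point at which `x_n` vanishes is ramified between the levels `n + b` and
`n + b + 1`. -/
def Ramifies (n b : ℕ) : Prop := Even b ∨ n / 2 ≤ b / 2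

/-- The total degree of the points of level `i` at which `x_n` vanishes. -/
def zeroDegree (i n : ℕ) : ℕ := 2 ^ ((n + 1) / 2 + min (n / 2) ((i - n) / 2))

open Classical in
/-- The total degree of the points of level `i` that are ramified in level `i + 1`. -/
def ramifiedDegree (i : ℕ) : ℕ :=
  1 + ∑ n ∈ Finset.range (i + 1), if Ramifies n (i - n) then zeroDegree i n else 0

/-- The genus of level `i`, as given by the Riemann–Hurwitz recursion. -/
def towerGenus : ℕ → ℤ
  | 0 => 0
  | i + 1 => 2 * towerGenus i - 1 + ramifiedDegree i

theorem zeroDegree_succ_of_ramifies {i n : ℕ} (hn : n ≤ i) (h : Ramifies n (i - n)) :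
    zeroDegree (i + 1) n = zeroDegree i n := by
  unfold zeroDegree
  congr 2
  rcases h with ⟨m, hm⟩ | h <;> omega

/-- For odd i − n with (i − n)/2 < n/2 the minimum in the exponent grows by one; in all other cases
it is unchanged. -/
theorem zeroDegree_succ_of_not_ramifies {i n : ℕ} (hn : n ≤ i) (h : ¬ Ramifies n (i - n)) :
    zeroDegree (i + 1) n = 2 * zeroDegree i n := by
  unfold zeroDegree Ramifies at *
  rw [← pow_succ']
  congr 1
  rw [not_or, Nat.not_even_iff_odd] at h
  obtain ⟨⟨m, hm⟩, h⟩ := h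
  omega

section Tower

variable {k K : Type*} [Field k] [Field K] [Algebra k K]

/-- The stage reached `b` steps after the first zero `x_n`. -/
def Place.Stage (P : Place k K) (n b : ℕ) (V : K) : Prop :=
  (Even b → P.EvenStage (n / 2 - b / 2) V) ∧ (¬ Even b → P.OddStage (n / 2 - b / 2) V)

theorem Place.Stage.congr [CharP K 2] {P : Place k K} {n b : ℕ} {V V' : K} (h : P.Stage n b V)
    (h' : P.v (V + V') ≤ 1) : P.Stage n b V' :=
  ⟨fun hb => (h.1 hb).congr h', fun hb => (h.2 hb).congr h'⟩

theorem Place.Stage.exists_ramified [CharP K 2] {P : Place k K} {n b : ℕ} {V : K}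
    (h : P.Stage n b V) (hr : Ramifies n b) : ∃ w : K, P.IsParam (V + (w ^ 2 + w))⁻¹ := by
  by_cases hb : Even b
  · exact (h.1 hb).exists_ramified
  · have h1 := h.2 hb
    rw [Nat.sub_eq_zero_of_le (hr.resolve_left hb)] at h1
    exact ⟨0, by simpa [Place.OddStage] using h1⟩

theorem Place.Stage.exists_unramified [CharP K 2] {P : Place k K} {n b : ℕ} {V : K}
    (h : P.Stage n b V) (hr : ¬ Ramifies n b) : ∃ w : K, P.v (V + (w ^ 2 + w)) ≤ 1 := by
  rw [Ramifies, not_or, not_le] at hr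
  have h1 := h.2 hr.1
  obtain ⟨r, hr'⟩ := Nat.exists_eq_succ_of_ne_zero (Nat.sub_pos_of_lt hr.2).ne'
  rw [hr'] at h1
  exact h1.exists_unramified

variable {K' : Type*} [Field K'] [Algebra k K'] [Algebra K K'] [IsScalarTower k K K']
  [Algebra.IsAlgebraic K K'] [CharP K 2] [CharP K' 2] {P : Place k K} {Q : Place k K'}

/-- For even b the chain keeps its length and becomes odd. For odd b it is already used up, and a
simple pole stays simple. -/
theorem Place.Stage.succ_of_ramifies {n b : ℕ} {V : K} {T : K'} (h : P.Stage n b V)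
    (hr : Ramifies n b) (hQ : Q.under K = P)
    (hpar : ∀ (V : K) (T : K'), P.IsParam V⁻¹ → Q.v (T ^ 2 + T + algebraMap K K' V) ≤ 1 →
      Q.IsParam T⁻¹)
    (hT : Q.v (T ^ 2 + T + algebraMap K K' V) ≤ 1) : Q.Stage n (b + 1) T := by
  by_cases hb : Even b
  · refine ⟨fun hb' => absurd hb (Nat.even_add_one.1 hb'), fun _ => ?_⟩
    have hdiv : (b + 1) / 2 = b / 2 := by
      obtain ⟨m, rfl⟩ := hb
      omega
    rw [hdiv]
    exact (h.1 hb).oddStage hQ hpar hT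
  · refine ⟨fun _ => ?_, fun hb' => absurd (Nat.even_add_one.2 hb) hb'⟩
    have hle := hr.resolve_left hb
    have h1 := h.2 hb
    rw [Nat.sub_eq_zero_of_le hle] at h1
    rw [Nat.sub_eq_zero_of_le (hle.trans (Nat.div_le_div_right (Nat.le_succ b)))]
    exact hpar V T h1 hT

/-- Here b is odd, so b/2 grows by one and exactly one link is consumed. -/
theorem Place.Stage.succ_of_not_ramifies {n b : ℕ} {V : K} {T : K'} (h : P.Stage n b V)
    (hr : ¬ Ramifies n b) (hQ : Q.under K = P)
    (hpar : ∀ t, P.IsParam t → Q.IsParam (algebraMap K K' t))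
    (hT : Q.v (T ^ 2 + T + algebraMap K K' V) ≤ 1) : Q.Stage n (b + 1) T := by
  rw [Ramifies, not_or, not_le] at hr
  have h1 := h.2 hr.1
  refine ⟨fun _ => ?_, fun hb' => absurd (Nat.even_add_one.2 hr.1) hb'⟩
  have hdiv : n / 2 - b / 2 = (n / 2 - (b + 1) / 2) + 1 := by
    obtain ⟨m, rfl⟩ := Nat.not_even_iff_odd.1 hr.1
    omega
  rw [hdiv] at h1
  exact h1.evenStage hQ hpar hT

end Tower

/-! ### The inductive description of one level -/

/-- What is known about the points of the curve with function field `K = k(x_0, …, x_i)`. -/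
structure TowerLevel (k : Type*) {K : Type*} [Field k] [Field K] [Algebra k K] (i : ℕ)
    (x : ℕ → K) : Prop where
  isCurve : IsCurve k K
  hasGenus : HasGenus k K (towerGenus i)
  ne_zero : ∀ j ≤ i, x j ≠ 0
  equation : ∀ j < i, x (j + 1) ^ 2 + x (j + 1) = x j + 1 + 1 / x j
  degree_pole : HasDegree {P : Place k K | 1 < P.v (x 0)} 1
  isParam_pole : ∀ P : Place k K, 1 < P.v (x 0) → P.IsParam (x i)⁻¹
  degree_one : HasDegree {P : Place k K | P.v (x i + 1) < 1} (2 ^ ((i + 1) / 2))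
  stage_one : ∀ P : Place k K, P.v (x i + 1) < 1 → P.EvenStage (i / 2) (x i + 1)⁻¹
  degree_cyclotomic : HasDegree {P : Place k K | P.v (x i ^ 2 + x i + 1) < 1} (2 ^ ((i + 2) / 2))
  stage_cyclotomic : ∀ P : Place k K, P.v (x i ^ 2 + x i + 1) < 1 →
    P.EvenStage ((i + 1) / 2) (x i + 1 + 1 / x i)⁻¹
  degree_zero : ∀ n ≤ i, HasDegree {P : Place k K | P.v (x n) < 1} (zeroDegree i n)
  stage_zero : ∀ n ≤ i, ∀ P : Place k K, P.v (x n) < 1 → P.Stage n (i - n) (x i + 1 + 1 / x i)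

namespace TowerLevel

variable {k K : Type*} [Field k] [Field K] [Algebra k K] [CharP K 2] {i : ℕ} {x : ℕ → K}

/-- A zero or pole of x_j is a pole of x_j + 1 + 1/x_j, hence of x_{j+1}, and so on. In particular
at most one coordinate vanishes at a point. -/
theorem one_lt_of_ne_one (h : TowerLevel k i x) {P : Place k K} {j : ℕ} (hj : j ≤ i)
    (hv : P.v (x j) ≠ 1) {m : ℕ} (hjm : j < m) (hm : m ≤ i) : 1 < P.v (x m) := by
  induction m, hjm using Nat.le_induction with
  | base =>
    have h1 := Place.one_lt_v_of_ne_one (h.ne_zero j hj) hv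
    rwa [← h.equation j hm, ← not_le, valuation_sq_add_le_one, not_le] at h1
  | succ m hjm ih =>
    have h1 := Place.one_lt_v_of_ne_one (h.ne_zero m (Nat.le_of_succ_le hm))
      (ih (Nat.le_of_succ_le hm)).ne'
    rwa [← h.equation m hm, ← not_le, valuation_sq_add_le_one, not_le] at h1

theorem ne_one_of_ne_one (h : TowerLevel k i x) {P : Place k K} {j : ℕ} (hj : j ≤ i)
    (hv : P.v (x j) ≠ 1) : P.v (x i) ≠ 1 := by
  rcases hj.eq_or_lt with rfl | hlt
  · exact hv
  · exact (h.one_lt_of_ne_one hj hv hlt le_rfl).ne'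

theorem one_lt_of_ne_one' (h : TowerLevel k i x) {P : Place k K} {j : ℕ} (hj : j ≤ i)
    (hv : P.v (x j) ≠ 1) : 1 < P.v (x i + 1 + 1 / x i) :=
  Place.one_lt_v_of_ne_one (h.ne_zero i le_rfl) (h.ne_one_of_ne_one hj hv)

theorem exists_zero_of_one_lt (h : TowerLevel k i x) {P : Place k K}
    (hP : 1 < P.v (x i + 1 + 1 / x i)) : 1 < P.v (x 0) ∨ ∃ n ≤ i, P.v (x n) < 1 := by
  by_contra! hcon
  have key : ∀ j ≤ i, P.v (x j) = 1 := by
    intro j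
    induction j with
    | zero => exact fun hj => le_antisymm hcon.1 (hcon.2 0 hj)
    | succ j ih =>
      intro hj
      refine le_antisymm ?_ (hcon.2 _ hj)
      rw [← valuation_sq_add_le_one, h.equation j hj]
      exact Place.v_le_one_of_eq_one (ih (Nat.le_of_succ_le hj))
  exact absurd hP (not_lt.2 (Place.v_le_one_of_eq_one (key i le_rfl)))

theorem isParam_inv_pole (h : TowerLevel k i x) {P : Place k K} (hP : 1 < P.v (x 0)) :
    P.IsParam (x i + 1 + 1 / x i)⁻¹ := by
  have h1 := h.isParam_pole P hP
  exact h1.inv_congr (Place.v_add_self_of_pole h1.one_lt_v)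

/-- The points that ramify in the next level. -/
def ramified (k : Type*) {K : Type*} [Field k] [Field K] [Algebra k K] (i : ℕ) (x : ℕ → K) :
    Set (Place k K) :=
  {P | 1 < P.v (x 0)} ∪ {P | ∃ n < i + 1, P.v (x n) < 1 ∧ Ramifies n (i - n)}

theorem eq_of_zeros (h : TowerLevel k i x) {P : Place k K} {m n : ℕ} (hm : m ≤ i) (hn : n ≤ i)
    (hPm : P.v (x m) < 1) (hPn : P.v (x n) < 1) : m = n := by
  by_contra hne
  rcases lt_or_gt_of_ne hne with hlt | hlt
  · exact absurd (h.one_lt_of_ne_one hm hPm.ne hlt hn) (not_lt.2 hPn.le)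
  · exact absurd (h.one_lt_of_ne_one hn hPn.ne hlt hm) (not_lt.2 hPm.le)

theorem not_zero_of_pole (h : TowerLevel k i x) {P : Place k K} {n : ℕ} (hn : n ≤ i)
    (hP : 1 < P.v (x 0)) : ¬ P.v (x n) < 1 := by
  intro hPn
  rcases Nat.eq_zero_or_pos n with rfl | hpos
  · exact absurd hP (not_lt.2 hPn.le)
  · exact absurd (h.one_lt_of_ne_one (Nat.zero_le i) hP.ne' hpos hn) (not_lt.2 hPn.le)

theorem hasDegree_ramified (h : TowerLevel k i x) :
    HasDegree (ramified k i x) (ramifiedDegree i) := by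
  classical
  refine h.degree_pole.union (HasDegree.biUnion
    (S := fun n => {P : Place k K | P.v (x n) < 1 ∧ Ramifies n (i - n)}) (i + 1)
    (fun n hn => ?_) ?_) ?_
  · split_ifs with hr
    · exact (h.degree_zero n (Nat.lt_succ_iff.1 hn)).congr (by simp [hr])
    · exact hasDegree_empty.congr (by simp [hr])
  · rintro m n hmn hn P ⟨hPm, -⟩ ⟨hPn, -⟩
    exact hmn.ne (h.eq_of_zeros (by omega) (by omega) hPm hPn)
  · rintro P hP ⟨n, hn, hPn, -⟩
    exact h.not_zero_of_pole (Nat.lt_succ_iff.1 hn) hP hPn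

theorem notMem_ramified_of_zero (h : TowerLevel k i x) {P : Place k K} {n : ℕ} (hn : n ≤ i)
    (hP : P.v (x n) < 1) (hr : ¬ Ramifies n (i - n)) : P ∉ ramified k i x := by
  rintro (h2 | ⟨m, hm, h2, hr'⟩)
  · exact h.not_zero_of_pole hn h2 hP
  · rw [h.eq_of_zeros (Nat.lt_succ_iff.1 hm) hn h2 hP] at hr'
    exact hr hr'

/-- The local shape of the next Artin–Schreier equation. -/
theorem exists_standard (h : TowerLevel k i x) (P : Place k K) : ∃ w : K,
    (P ∈ ramified k i x → P.IsParam (x i + 1 + 1 / x i + (w ^ 2 + w))⁻¹) ∧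
    (P ∉ ramified k i x → P.v (x i + 1 + 1 / x i + (w ^ 2 + w)) ≤ 1) ∧
    (P.v (x i + 1 + 1 / x i) ≤ 1 → w = 0 ∧ P ∉ ramified k i x) := by
  rcases le_or_gt (P.v (x i + 1 + 1 / x i)) 1 with hP | hP
  · have hnot : P ∉ ramified k i x := by
      rintro (h1 | ⟨n, hn, h1, -⟩)
      · exact absurd (h.one_lt_of_ne_one' (Nat.zero_le i) h1.ne') (not_lt.2 hP)
      · exact absurd (h.one_lt_of_ne_one' (Nat.lt_succ_iff.1 hn) h1.ne) (not_lt.2 hP)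
    exact ⟨0, fun h1 => absurd h1 hnot, fun _ => by simpa using hP, fun _ => ⟨rfl, hnot⟩⟩
  · have hP' := not_le.2 hP
    rcases h.exists_zero_of_one_lt hP with h1 | ⟨n, hn, h1⟩
    · refine ⟨0, fun _ => ?_, fun h2 => absurd (Or.inl h1) h2, fun h2 => absurd h2 hP'⟩
      simpa using h.isParam_inv_pole h1
    · have hst := h.stage_zero n hn P h1
      by_cases hr : Ramifies n (i - n)
      · obtain ⟨w, hw⟩ := hst.exists_ramified hr
        exact ⟨w, fun _ => hw, fun h2 => absurd (Or.inr ⟨n, Nat.lt_succ_of_le hn, h1, hr⟩) h2,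
          fun h2 => absurd h2 hP'⟩
      · obtain ⟨w, hw⟩ := hst.exists_unramified hr
        exact ⟨w, fun h2 => absurd h2 (h.notMem_ramified_of_zero hn h1 hr), fun _ => hw,
          fun h2 => absurd h2 hP'⟩

/-- Every step really has degree 2: if y were some r in K, then r² + r would have even pole order at
the point over x_0 = ∞, where x_i + 1 + 1/x_i has a simple pole. -/
theorem isArtinSchreier (h : TowerLevel k i x) {K' : Type*} [Field K'] [Algebra K K'] {y : K'}
    (hy : y ^ 2 + y = algebraMap K K' (x i + 1 + 1 / x i))
    (hspan : ∀ f : K', ∃ a b : K, f = algebraMap K K' a + algebraMap K K' b * y) :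
    IsArtinSchreier K y (x i + 1 + 1 / x i) := by
  refine ⟨hy, hspan, fun a b hab => ?_⟩
  by_cases hb : b = 0
  · subst hb
    simpa using hab
  exfalso
  have hyr : y = algebraMap K K' (-a / b) := by
    have hb' : algebraMap K K' b ≠ 0 := by simpa using hb
    rw [map_div₀, map_neg]
    field_simp
    linear_combination hab
  rw [hyr, ← map_pow, ← map_add] at hy
  have hr := (algebraMap K K').injective hy
  set r := -a / b
  obtain ⟨F, hF, hdeg⟩ := h.degree_pole
  have hne : F.Nonempty := by
    by_contra hne
    rw [Finset.not_nonempty_iff_eq_empty] at hne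
    rw [hne, Finset.sum_empty] at hdeg
    exact zero_ne_one hdeg
  obtain ⟨P, hPF⟩ := hne
  have hP : 1 < P.v (x 0) := (hF P).1 hPF
  have hpar := h.isParam_inv_pole hP
  have hu := hpar.one_lt_v
  rw [← hr] at hpar hu
  have hr1 : 1 < P.v r := by rwa [← not_le, ← valuation_sq_add_le_one, not_le]
  have hr0 : r ≠ 0 := by
    intro h0
    rw [h0, map_zero] at hr1
    exact absurd hr1 (not_lt.2 zero_le_one)
  obtain ⟨n, hn⟩ := hpar.2 r hr0
  have h2 := valuation_sq_add_of_one_lt _ hr1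
  have h3 : P.v (r ^ 2 + r) = P.v (r ^ 2 + r)⁻¹ ^ (-1 : ℤ) := by
    rw [map_inv₀, zpow_neg_one, inv_inv]
  have h4 : (P.v (r ^ 2 + r)⁻¹ ^ n) ^ 2 = P.v (r ^ 2 + r)⁻¹ ^ (n * 2) := by
    rw [zpow_mul]
    norm_cast
  rw [h3, hn, h4, hpar.zpow_inj] at h2
  omega

end TowerLevel

/-! ### Passage from one level to the next -/

namespace TowerLevel

set_option linter.unusedSectionVars false

variable {k K K' : Type*} [Field k] [Field K] [Field K'] [Algebra k K] [Algebra k K']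
  [Algebra K K'] [IsScalarTower k K K'] [CharP K 2] [CharP K' 2] [Algebra.IsAlgebraic K K']
  {i : ℕ} {x : ℕ → K} {y : K'} {P : Place k K} {Q : Place k K'}

theorem isParam_inv_of_mem_ramified (h : TowerLevel k i x)
    (hA : IsArtinSchreier K y (x i + 1 + 1 / x i)) (hP : P ∈ ramified k i x) (hQ : Q.under K = P)
    (V : K) (T : K') (hV : P.IsParam V⁻¹) (hT : Q.v (T ^ 2 + T + algebraMap K K' V) ≤ 1) :
    Q.IsParam T⁻¹ := by
  obtain ⟨w, hw, -, -⟩ := h.exists_standard P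
  exact (hA.shift w).isParam_inv_of_ramified (hw hP) hQ hV hT

theorem isParam_of_notMem_ramified (h : TowerLevel k i x)
    (hA : IsArtinSchreier K y (x i + 1 + 1 / x i)) (hP : P ∉ ramified k i x) (hQ : Q.under K = P)
    (t : K) (ht : P.IsParam t) : Q.IsParam (algebraMap K K' t) := by
  obtain ⟨w, -, hw, -⟩ := h.exists_standard P
  exact (hA.shift w).isParam_of_unramified (hw hP) hQ ht

theorem hasDegree_fiber_of_mem_ramified (h : TowerLevel k i x)
    (hA : IsArtinSchreier K y (x i + 1 + 1 / x i)) (hP : P ∈ ramified k i x) :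
    HasDegree {Q : Place k K' | Q.under K = P} P.degree := by
  obtain ⟨w, hw, -, -⟩ := h.exists_standard P
  exact (IsFiber.of_ramified (hA.shift w) (hw hP)
    (h.isCurve.finite_residueField P)).hasDegree_two

theorem hasDegree_fiber_of_notMem_ramified (h : TowerLevel k i x)
    (hA : IsArtinSchreier K y (x i + 1 + 1 / x i)) (hP : P ∉ ramified k i x) :
    HasDegree {Q : Place k K' | Q.under K = P} (2 * P.degree) := by
  obtain ⟨w, -, hw, -⟩ := h.exists_standard P
  exact (IsFiber.of_unramified (hA.shift w) (hw hP)
    (h.isCurve.finite_residueField P)).hasDegree_one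

theorem notMem_ramified_of_le (h : TowerLevel k i x) (hP : P.v (x i + 1 + 1 / x i) ≤ 1) :
    P ∉ ramified k i x := by
  obtain ⟨w, -, -, hw⟩ := h.exists_standard P
  exact (hw hP).2

theorem isCurve_and_hasGenus_succ (h : TowerLevel k i x)
    (hA : IsArtinSchreier K y (x i + 1 + 1 / x i)) :
    IsCurve k K' ∧ HasGenus k K' (towerGenus (i + 1)) := by
  classical
  choose w hram hunr hw0 using h.exists_standard
  obtain ⟨E, hE1, hE0, hEd⟩ := h.hasDegree_ramified.exists_divisor
  let e : Place k K → ℕ := fun P => if P ∈ ramified k i x then 2 else 1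
  have hF : ∀ P : Place k K, IsFiber P (y + algebraMap K K' (w P)) (e P) := by
    intro P
    by_cases hP : P ∈ ramified k i x
    · simp only [e, hP, if_true]
      exact IsFiber.of_ramified (hA.shift _) (hram P hP) (h.isCurve.finite_residueField P)
    · simp only [e, hP, if_false]
      exact IsFiber.of_unramified (hA.shift _) (hunr P hP) (h.isCurve.finite_residueField P)
  refine ⟨h.isCurve.of_isFiber hA hF, ?_⟩
  rw [towerGenus, ← hEd]
  refine HasGenus.of_isFiber h.isCurve h.hasGenus hA hF (fun P => ?_) ?_ fun P => ?_
  · by_cases hP : P ∈ ramified k i x <;> simp [e, hP]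
  -- The shift w was chosen to be 0 wherever the equation is already regular, so its support is
  -- finite.
  · refine (h.isCurve.finite_poles (x i + 1 + 1 / x i)).subset fun P hP hmem => hP ?_
    exact (hw0 P (Place.mem_ring.1 hmem)).1
  · by_cases hP : P ∈ ramified k i x
    · simp [e, hP, hE1 P hP]
    · simp [e, hP, hE0 P hP]

theorem v_lt_one_of_v_lt_one (hA : IsArtinSchreier K y (x i + 1 + 1 / x i)) (hQ : Q.under K = P)
    (hy : Q.v y < 1) : P.v (x i + 1 + 1 / x i) < 1 := by
  rw [← Place.v_lt_one_iff hQ, ← hA.equation]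
  refine Q.v.map_add_lt ?_ hy
  rw [map_pow]
  exact pow_lt_one₀ zero_le hy two_ne_zero

theorem ne_zero_of_isArtinSchreier {z : K'} {c : K} (hA : IsArtinSchreier K z c) : z ≠ 0 := by
  intro h0
  exact one_ne_zero (hA.eq_zero 0 1 (by simp [h0])).2

/-- Over each point where x_i is a cube root of unity exactly one point has y = 0, of the same
degree. Replacing y by y + 1 counts the points with y = 1. -/
theorem hasDegree_split (h : TowerLevel k i x)
    (hA : IsArtinSchreier K y (x i + 1 + 1 / x i)) :
    HasDegree {Q : Place k K' | Q.v y < 1} (2 ^ ((i + 2) / 2)) := by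
  rw [← one_mul (2 ^ ((i + 2) / 2))]
  refine h.degree_cyclotomic.of_fibers (fun Q hQ => ?_) fun P hP => ?_
  · exact (Place.v_lt_one_iff_cyclotomic (h.ne_zero i le_rfl)).1 (v_lt_one_of_v_lt_one hA rfl hQ)
  · obtain ⟨Q, hQ, hd⟩ := sum_degree_split hA
      ((Place.v_lt_one_iff_cyclotomic (h.ne_zero i le_rfl)).2 hP)
      (h.isCurve.finite_residueField P)
    rw [one_mul, ← hd]
    exact hasDegree_singleton hQ

/-- Here y (y + 1) equals x_i + 1 + 1/x_i, and the chain of its inverse lifts because the point is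
unramified. -/
theorem evenStage_split (h : TowerLevel k i x) (hA : IsArtinSchreier K y (x i + 1 + 1 / x i))
    (hy : Q.v y < 1) : Q.EvenStage ((i + 1) / 2) (y * (y + 1))⁻¹ := by
  have h1 := v_lt_one_of_v_lt_one hA rfl hy
  have h2 := (h.stage_cyclotomic _ ((Place.v_lt_one_iff_cyclotomic (h.ne_zero i le_rfl)).1 h1)).map
    rfl (h.isParam_of_notMem_ramified hA (h.notMem_ramified_of_le h1.le) rfl)
  rw [map_inv₀, ← hA.equation] at h2
  rwa [mul_add, mul_one, ← sq]

theorem evenStage_one_succ (h : TowerLevel k i x) (hA : IsArtinSchreier K y (x i + 1 + 1 / x i))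
    (hy : Q.v (y + 1) < 1) : Q.EvenStage ((i + 1) / 2) (y + 1)⁻¹ := by
  have h1 := h.evenStage_split hA.add_one hy
  have hy0 := ne_zero_of_isArtinSchreier hA
  have hy1 := ne_zero_of_isArtinSchreier hA.add_one
  refine h1.congr ?_
  have h2 := CharTwo.two_eq_zero (R := K')
  have : ((y + 1) * (y + 1 + 1))⁻¹ + (y + 1)⁻¹ = y⁻¹ := by
    have : y + 1 + 1 = y := by linear_combination h2
    rw [this]
    field_simp
    ring
  rw [this, map_inv₀, Place.v_eq_one_of_add_one hy, inv_one]

theorem stage_zero_succ_self (h : TowerLevel k i x)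
    (hA : IsArtinSchreier K y (x i + 1 + 1 / x i)) (hy : Q.v y < 1) :
    Q.Stage (i + 1) 0 (y + 1 + 1 / y) := by
  have h1 := h.evenStage_split hA hy
  have hy0 := ne_zero_of_isArtinSchreier hA
  have hy1 := ne_zero_of_isArtinSchreier hA.add_one
  have h2 := CharTwo.two_eq_zero (R := K')
  refine ⟨fun _ => h1.congr ?_, fun h => absurd Even.zero h⟩
  have h3 : (y * (y + 1))⁻¹ + (y + 1 + 1 / y) = (y + 1) + (y + 1)⁻¹ := by
    field_simp
    linear_combination h2
  have h4 : Q.v (y + 1) = 1 := by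
    rw [Q.v.map_add_eq_of_lt_right (by rwa [map_one]), map_one]
  rw [h3]
  refine Q.v.map_add_le h4.le ?_
  rw [map_inv₀, h4, inv_one]

theorem v_cyclotomic_lt_one_iff (h : TowerLevel k i x)
    (hA : IsArtinSchreier K y (x i + 1 + 1 / x i)) (hQ : Q.under K = P) :
    Q.v (y ^ 2 + y + 1) < 1 ↔ P.v (x i + 1) < 1 := by
  rw [hA.equation, ← map_one (algebraMap K K'), ← map_add, Place.v_lt_one_iff hQ,
    Place.v_add_one_lt_one_iff (h.ne_zero i le_rfl)]

theorem hasDegree_cyclotomic_succ (h : TowerLevel k i x)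
    (hA : IsArtinSchreier K y (x i + 1 + 1 / x i)) :
    HasDegree {Q : Place k K' | Q.v (y ^ 2 + y + 1) < 1} (2 ^ ((i + 1 + 2) / 2)) := by
  rw [show 2 ^ ((i + 1 + 2) / 2) = 2 * 2 ^ ((i + 1) / 2) by
    rw [← pow_succ', show (i + 1 + 2) / 2 = (i + 1) / 2 + 1 by omega]]
  refine h.degree_one.of_fibers (fun Q hQ => (h.v_cyclotomic_lt_one_iff hA rfl).1 hQ)
    fun P hP => ?_
  have hP' : P ∉ ramified k i x :=
    h.notMem_ramified_of_le (Place.v_le_one_of_eq_one (Place.v_eq_one_of_add_one hP))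
  refine (h.hasDegree_fiber_of_notMem_ramified hA hP').congr fun Q => ?_
  exact ⟨fun hQ => hQ.1, fun hQ => ⟨hQ, (h.v_cyclotomic_lt_one_iff hA hQ).2 hP⟩⟩

/-- A new link arises here. With X = x_i and W = 1/(X + 1) the equation reads (y² + y + 1) X = (X +
1)², so the inverse of y + 1 + 1/y = (X + 1)²/(X y) is y (W² + W). -/
theorem evenStage_cyclotomic_succ (h : TowerLevel k i x)
    (hA : IsArtinSchreier K y (x i + 1 + 1 / x i)) (hy : Q.v (y ^ 2 + y + 1) < 1) :
    Q.EvenStage ((i + 1 + 1) / 2) (y + 1 + 1 / y)⁻¹ := by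
  have hP := (h.v_cyclotomic_lt_one_iff hA rfl).1 hy
  have hx1 := Place.v_eq_one_of_add_one hP
  have hP' := h.notMem_ramified_of_le (Place.v_le_one_of_eq_one hx1)
  have hx0 : algebraMap K K' (x i) ≠ 0 := by simpa using h.ne_zero i le_rfl
  have hy0 := ne_zero_of_isArtinSchreier hA
  have h2 := CharTwo.two_eq_zero (R := K')
  set X := algebraMap K K' (x i) with hX
  have hXv : Q.v X = 1 := (Place.v_eq_one_iff rfl).2 hx1
  have hs : Q.v (X + 1) < 1 := by
    rw [← Place.v_lt_one_iff (Q := Q) rfl] at hP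
    simpa using hP
  have hyX : (y ^ 2 + y + 1) * X = (X + 1) ^ 2 := by
    have := hA.equation
    rw [map_add, map_add, map_div₀, map_one, ← hX] at this
    rw [this]
    field_simp
    ring
  have hst := (h.stage_one _ hP).map (Q := Q) rfl (h.isParam_of_notMem_ramified hA hP' rfl)
  rw [map_inv₀, map_add, map_one, ← hX] at hst
  rw [show (i + 1 + 1) / 2 = i / 2 + 1 by omega]
  refine ⟨y, X + 1, (X + 1)⁻¹, hs, ?_, ?_, ?_, hst⟩
  · rw [← map_pow, ← hyX, map_mul, hXv, mul_one]
  · rcases eq_or_ne (X + 1) 0 with h0 | h0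
    · simp [h0]
    · simp [mul_inv_cancel₀ h0]
  -- The degenerate case X + 1 = 0 need not be excluded: both terms are then 0, since 0⁻¹ = 0.
  · rcases eq_or_ne (X + 1) 0 with h0 | h0
    · have : y + 1 + 1 / y = 0 := by
        have h3 : y ^ 2 + y + 1 = 0 := by
          simpa [h0, hx0] using hyX
        field_simp
        linear_combination h3
      rw [this, h0]
      simp
    · have h3 : y ^ 2 + y + 1 ≠ 0 := fun h3 => h0 (by simpa [h3] using hyX.symm)
      have h4 : y + 1 + 1 / y = (X + 1) ^ 2 / (X * y) := by
        rw [← hyX]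
        field_simp
      have h5 : ((X + 1) ^ 2 / (X * y))⁻¹ + y * ((X + 1)⁻¹ ^ 2 + (X + 1)⁻¹) = 0 := by
        field_simp
        linear_combination (y * (X + 1)) * h2
      rw [h4, h5, map_zero]
      exact zero_le_one

theorem stage_zero_succ (h : TowerLevel k i x) (hA : IsArtinSchreier K y (x i + 1 + 1 / x i))
    {n : ℕ} (hn : n ≤ i) (hQ : Q.under K = P) (hP : P.v (x n) < 1) :
    Q.Stage n (i + 1 - n) (y + 1 + 1 / y) := by
  have hT : Q.v (y ^ 2 + y + algebraMap K K' (x i + 1 + 1 / x i)) ≤ 1 := by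
    rw [hA.equation, CharTwo.add_self_eq_zero, map_zero]
    exact zero_le_one
  have hy : 1 < Q.v y := by
    have h1 := h.one_lt_of_ne_one' hn hP.ne
    rw [← not_le, ← Place.v_le_one_iff hQ, ← hA.equation, valuation_sq_add_le_one, not_le] at h1
    exact h1
  rw [Nat.sub_add_comm hn]
  refine Place.Stage.congr ?_ (Place.v_add_self_of_pole hy)
  have hst := h.stage_zero n hn P hP
  by_cases hr : Ramifies n (i - n)
  · exact hst.succ_of_ramifies hr hQ (h.isParam_inv_of_mem_ramified hA
      (Or.inr ⟨n, Nat.lt_succ_of_le hn, hP, hr⟩) hQ) hT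
  · refine hst.succ_of_not_ramifies hr hQ (h.isParam_of_notMem_ramified hA ?_ hQ) hT
    exact h.notMem_ramified_of_zero hn hP hr

theorem hasDegree_zero_succ (h : TowerLevel k i x) (hA : IsArtinSchreier K y (x i + 1 + 1 / x i))
    {n : ℕ} (hn : n ≤ i) :
    HasDegree {Q : Place k K' | Q.v (algebraMap K K' (x n)) < 1} (zeroDegree (i + 1) n) := by
  by_cases hr : Ramifies n (i - n)
  · rw [zeroDegree_succ_of_ramifies hn hr, ← one_mul (zeroDegree i n)]
    refine (h.degree_zero n hn).of_fibers (fun Q hQ => (Place.v_lt_one_iff rfl).1 hQ)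
      fun P hP => ?_
    rw [one_mul]
    refine (h.hasDegree_fiber_of_mem_ramified hA
      (Or.inr ⟨n, Nat.lt_succ_of_le hn, hP, hr⟩)).congr fun Q => ?_
    exact ⟨fun hQ => hQ.1, fun hQ => ⟨hQ, (Place.v_lt_one_iff hQ).2 hP⟩⟩
  · rw [zeroDegree_succ_of_not_ramifies hn hr]
    refine (h.degree_zero n hn).of_fibers (fun Q hQ => (Place.v_lt_one_iff rfl).1 hQ)
      fun P hP => ?_
    refine (h.hasDegree_fiber_of_notMem_ramified hA
      (h.notMem_ramified_of_zero hn hP hr)).congr fun Q => ?_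
    exact ⟨fun hQ => hQ.1, fun hQ => ⟨hQ, (Place.v_lt_one_iff hQ).2 hP⟩⟩

theorem hasDegree_pole_succ (h : TowerLevel k i x)
    (hA : IsArtinSchreier K y (x i + 1 + 1 / x i)) :
    HasDegree {Q : Place k K' | 1 < Q.v (algebraMap K K' (x 0))} 1 := by
  rw [← one_mul 1]
  have hiff : ∀ {Q : Place k K'} {P : Place k K}, Q.under K = P →
      (1 < Q.v (algebraMap K K' (x 0)) ↔ 1 < P.v (x 0)) := by
    intro Q P hQ
    rw [← not_le, Place.v_le_one_iff hQ, not_le]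
  refine h.degree_pole.of_fibers (fun Q hQ => (hiff rfl).1 hQ) fun P hP => ?_
  rw [one_mul]
  refine (h.hasDegree_fiber_of_mem_ramified hA (Or.inl hP)).congr fun Q => ?_
  exact ⟨fun hQ => hQ.1, fun hQ => ⟨hQ, (hiff hQ).2 hP⟩⟩

theorem isParam_pole_succ (h : TowerLevel k i x)
    (hA : IsArtinSchreier K y (x i + 1 + 1 / x i))
    (hQ : 1 < Q.v (algebraMap K K' (x 0))) : Q.IsParam y⁻¹ := by
  have hP : 1 < (Q.under K).v (x 0) := by
    rwa [← not_le, Place.v_le_one_iff rfl, not_le] at hQ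
  refine h.isParam_inv_of_mem_ramified hA (Or.inl hP) rfl _ _ (h.isParam_inv_pole hP) ?_
  rw [hA.equation, CharTwo.add_self_eq_zero, map_zero]
  exact zero_le_one

/-- Passage to the next level of the tower. -/
theorem succ (h : TowerLevel k i x) (hA : IsArtinSchreier K y (x i + 1 + 1 / x i)) {x' : ℕ → K'}
    (hx' : ∀ j ≤ i, x' j = algebraMap K K' (x j)) (hy : x' (i + 1) = y) :
    TowerLevel k (i + 1) x' where
  isCurve := (h.isCurve_and_hasGenus_succ hA).1
  hasGenus := (h.isCurve_and_hasGenus_succ hA).2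
  ne_zero j hj := by
    rcases Nat.le_succ_iff.1 hj with hj | rfl
    · rw [hx' j hj]
      simpa using h.ne_zero j hj
    · rw [hy]
      exact ne_zero_of_isArtinSchreier hA
  equation j hj := by
    rcases Nat.lt_succ_iff_lt_or_eq.1 hj with hj | rfl
    · rw [hx' (j + 1) hj, hx' j hj.le]
      simpa using congrArg (algebraMap K K') (h.equation j hj)
    · rw [hy, hx' j le_rfl, hA.equation]
      simp
  degree_pole := by
    rw [hx' 0 (Nat.zero_le i)]
    exact h.hasDegree_pole_succ hA
  isParam_pole Q hQ := by
    rw [hx' 0 (Nat.zero_le i)] at hQ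
    rw [hy]
    exact h.isParam_pole_succ hA hQ
  degree_one := by
    rw [hy]
    exact h.hasDegree_split hA.add_one
  stage_one Q hQ := by
    rw [hy] at hQ ⊢
    exact h.evenStage_one_succ hA hQ
  degree_cyclotomic := by
    rw [hy]
    exact h.hasDegree_cyclotomic_succ hA
  stage_cyclotomic Q hQ := by
    rw [hy] at hQ ⊢
    exact h.evenStage_cyclotomic_succ hA hQ
  degree_zero n hn := by
    rcases Nat.le_succ_iff.1 hn with hn | rfl
    · rw [hx' n hn]
      exact h.hasDegree_zero_succ hA hn
    · rw [hy, zeroDegree, Nat.sub_self, Nat.zero_div, Nat.min_zero, add_zero]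
      exact h.hasDegree_split hA
  stage_zero n hn Q hQ := by
    rw [hy]
    rcases Nat.le_succ_iff.1 hn with hn | rfl
    · rw [hx' n hn] at hQ
      exact h.stage_zero_succ hA hn rfl ((Place.v_lt_one_iff rfl).1 hQ)
    · rw [hy] at hQ
      rw [Nat.sub_self]
      exact h.stage_zero_succ_self hA hQ

end TowerLevel

/-! ### Level zero -/

section Base

open Polynomial

variable {k K : Type*} [Field k] [Field K] [Algebra k K] {x : K}

theorem IsCoordinate.hasDegree_linear (h : IsCoordinate k x) (a : k) :
    HasDegree {P : Place k K | P.v (x + algebraMap k K a) < 1} 1 ∧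
      ∀ P : Place k K, P.v (x + algebraMap k K a) < 1 → P.IsParam (x + algebraMap k K a) := by
  have hd : (X + C a).natDegree = 1 := natDegree_X_add_C a
  have hirr : Irreducible (X + C a) := irreducible_of_degree_eq_one (degree_X_add_C a)
  obtain ⟨P, hP, hdeg, hpar⟩ := h.exists_place hirr
  rw [hd] at hdeg
  simp only [map_add, aeval_X, aeval_C] at hP hpar
  have key : ∀ P' : Place k K, P'.v (x + algebraMap k K a) < 1 ↔ P' = P := by
    intro P'
    rw [← hP]
    refine ⟨fun h1 => ⟨?_, h1⟩, fun h1 => h1.2⟩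
    have : x = (x + algebraMap k K a) - algebraMap k K a := by ring
    rw [this]
    exact P'.v.map_sub_le h1.le (P'.v_algebraMap_le a)
  refine ⟨hdeg ▸ hasDegree_singleton key, fun P' hP' => ?_⟩
  rw [(key P').1 hP']
  exact hpar

variable [CharP K 2]

/-- Either one point of degree 2 or, if k contains a cube root of unity ω, the two points x = ω and
x = ω + 1. The total degree is 2 in both cases, so the count does not depend on k. -/
theorem IsCoordinate.hasDegree_cyclotomic (h : IsCoordinate k x) :
    HasDegree {P : Place k K | P.v (x ^ 2 + x + 1) < 1} 2 ∧
      ∀ P : Place k K, P.v (x ^ 2 + x + 1) < 1 → P.IsParam (x ^ 2 + x + 1) := by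
  have hd : (X ^ 2 + X + 1 : k[X]).natDegree = 2 := by compute_degree!
  by_cases hirr : Irreducible (X ^ 2 + X + 1 : k[X])
  · obtain ⟨P, hP, hdeg, hpar⟩ := h.exists_place hirr
    rw [hd] at hdeg
    simp only [map_add, map_pow, aeval_X, map_one] at hP hpar
    have key : ∀ P' : Place k K, P'.v (x ^ 2 + x + 1) < 1 ↔ P' = P := by
      intro P'
      rw [← hP]
      exact ⟨fun h1 => ⟨(Place.v_eq_one_of_cyclotomic h1).le, h1⟩, fun h1 => h1.2⟩
    have hS := hasDegree_singleton (S := {P : Place k K | P.v (x ^ 2 + x + 1) < 1}) key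
    rw [hdeg] at hS
    refine ⟨hS, fun P' hP' => ?_⟩
    rw [(key P').1 hP']
    exact hpar
  · have hm : (X ^ 2 + X + 1 : k[X]).Monic := by monicity!
    rw [hm.irreducible_iff_roots_eq_zero_of_degree_le_three hd.ge (hd.le.trans (by norm_num))]
      at hirr
    obtain ⟨ω, hω⟩ := Multiset.exists_mem_of_ne_zero hirr
    have hroot : ω ^ 2 + ω + 1 = 0 := by simpa using (mem_roots'.1 hω).2
    have hroot' : algebraMap k K ω ^ 2 + algebraMap k K ω + 1 = 0 := by
      simpa using congrArg (algebraMap k K) hroot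
    have h2 := CharTwo.two_eq_zero (R := K)
    obtain ⟨hS, hSp⟩ := h.hasDegree_linear ω
    obtain ⟨hT, hTp⟩ := h.hasDegree_linear (ω + 1)
    rw [map_add, map_one] at hT hTp
    set a := algebraMap k K ω
    have hfac : x ^ 2 + x + 1 = (x + a) * (x + (a + 1)) := by
      linear_combination hroot' - (x * a + a ^ 2 + a) * h2
    have hab : ∀ P : Place k K, P.v (x + a) < 1 → P.v (x + (a + 1)) = 1 := by
      intro P hP
      rw [← add_assoc, P.v.map_add_eq_of_lt_right (by rwa [map_one]), map_one]
    have hba : ∀ P : Place k K, P.v (x + (a + 1)) < 1 → P.v (x + a) = 1 := by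
      intro P hP
      have : x + a = (x + (a + 1)) - 1 := by ring
      rw [this, P.v.map_sub_eq_of_lt_right (by rwa [map_one]), map_one]
    have hor : ∀ P : Place k K, P.v (x ^ 2 + x + 1) < 1 ↔
        P.v (x + a) < 1 ∨ P.v (x + (a + 1)) < 1 := by
      intro P
      rw [hfac, map_mul]
      constructor
      · intro hP
        by_contra! hcon
        exact absurd hP (not_lt.2 (one_le_mul hcon.1 hcon.2))
      · rintro (hP | hP)
        · rwa [hab P hP, mul_one]
        · rwa [hba P hP, one_mul]
    refine ⟨(hS.union hT fun P hP hP' => ?_).congr hor, fun P hP => ?_⟩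
    · exact absurd hP' (not_lt.2 (hab P hP).ge)
    · rcases (hor P).1 hP with hP | hP
      · refine (hSp P hP).congr ?_
        rw [hfac, map_mul, hab P hP, mul_one]
      · refine (hTp P hP).congr ?_
        rw [hfac, map_mul, hba P hP, one_mul]

theorem IsCoordinate.towerLevel {x : ℕ → K} (h : IsCoordinate k (x 0)) : TowerLevel k 0 x := by
  obtain ⟨P, hP, hdeg, hpar⟩ := h.exists_place_infty
  have h0 := h.hasDegree_linear 0
  have h1 := h.hasDegree_linear 1
  have hq := h.hasDegree_cyclotomic
  rw [map_zero, add_zero] at h0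
  rw [map_one] at h1
  refine ⟨h.isCurve, h.hasGenus, ?_, fun j hj => absurd hj (Nat.not_lt_zero j),
    hdeg ▸ hasDegree_singleton hP, ?_, h1.1, ?_, hq.1, ?_, ?_, ?_⟩
  · intro j hj
    rw [Nat.le_zero.1 hj]
    exact h.ne_zero
  · intro P' hP'
    rw [(hP P').1 hP']
    exact hpar
  · intro P' hP'
    change P'.IsParam _
    rw [inv_inv]
    exact h1.2 P' hP'
  · intro P' hP'
    change P'.IsParam _
    rw [inv_inv]
    refine (hq.2 P' hP').congr ?_
    have hx := h.ne_zero
    have : x 0 ^ 2 + x 0 + 1 = (x 0 + 1 + 1 / x 0) * x 0 := by field_simp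
    rw [this, map_mul, Place.v_eq_one_of_cyclotomic hP', mul_one]
  · intro n hn
    obtain rfl := Nat.le_zero.1 hn
    exact h0.1
  · intro n hn P' hP'
    obtain rfl := Nat.le_zero.1 hn
    refine ⟨fun _ => ?_, fun hb => absurd Even.zero hb⟩
    change P'.IsParam _
    refine Place.IsParam.inv_congr (V := 1 / x 0) ?_ (Place.v_add_inv_of_zero hP')
    rw [one_div, inv_inv]
    exact h0.2 P' hP'

end Base

/-! ### Induction along the tower -/

section Induction

/-- The function field of level `i` has the local structure described by `TowerLevel`. -/
theorem towerLevel {k : Type*} [Field k] [CharP k 2] (i : ℕ) {K : Type*} [Field K] [Algebra k K]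
    (x : ℕ → K) (ht : Transcendental k (x 0))
    (heq : ∀ j < i, x (j + 1) ^ 2 + x (j + 1) = x j + 1 + 1 / x j)
    (htop : IntermediateField.adjoin k (x '' Set.Iic i) = ⊤) : TowerLevel k i x := by
  induction i generalizing K with
  | zero =>
    have : CharP K 2 := charP_of_injective_algebraMap (algebraMap k K).injective 2
    refine IsCoordinate.towerLevel ⟨ht, ?_⟩
    rw [← htop]
    congr 1
    ext f
    simp [eq_comm]
  | succ i ih =>
    let F := IntermediateField.adjoin k (x '' Set.Iic i)
    have hmem : ∀ j ≤ i, x j ∈ F := fun j hj =>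
      IntermediateField.subset_adjoin k _ (Set.mem_image_of_mem x hj)
    -- The value 0 past i is a default; level i involves only indices up to i.
    let x₀ : ℕ → F := fun j => if h : j ≤ i then ⟨x j, hmem j h⟩ else 0
    have hx₀ : ∀ j ≤ i, x j = algebraMap F K (x₀ j) := by
      intro j hj
      simp only [x₀, dif_pos hj]
      rfl
    have : CharP K 2 := charP_of_injective_algebraMap (algebraMap k K).injective 2
    have : CharP F 2 := charP_of_injective_algebraMap (algebraMap k F).injective 2
    have h : TowerLevel k i x₀ := by
      refine ih x₀ ?_ (fun j hj => ?_) ?_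
      · rw [hx₀ 0 (Nat.zero_le i)] at ht
        exact (transcendental_algebraMap_iff (algebraMap F K).injective).1 ht
      · refine (algebraMap F K).injective ?_
        have := heq j (hj.trans i.lt_succ_self)
        rw [hx₀ (j + 1) hj, hx₀ j hj.le] at this
        simpa using this
      · apply IntermediateField.lift_injective
        rw [IntermediateField.lift_adjoin, IntermediateField.lift_top, ← Set.image_comp]
        have : (F.val ∘ x₀) '' Set.Iic i = x '' Set.Iic i :=
          Set.image_congr fun j hj => (hx₀ j hj).symm
        exact congrArg (IntermediateField.adjoin k) this
    have hy : x (i + 1) ^ 2 + x (i + 1) = algebraMap F K (x₀ i + 1 + 1 / x₀ i) := by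
      rw [heq i i.lt_succ_self, hx₀ i le_rfl]
      simp
    have hy_int : IsIntegral F (x (i + 1)) := by
      refine ⟨Polynomial.X ^ 2 + Polynomial.X - Polynomial.C (x₀ i + 1 + 1 / x₀ i), by monicity!, ?_⟩
      rw [Polynomial.eval₂_sub, Polynomial.eval₂_add, Polynomial.eval₂_pow, Polynomial.eval₂_X,
        Polynomial.eval₂_C, hy, sub_self]
    have hadj : Algebra.adjoin F {x (i + 1)} = ⊤ := by
      rw [← IntermediateField.adjoin_simple_toSubalgebra_of_isAlgebraic hy_int.isAlgebraic]
      rw [← IntermediateField.top_toSubalgebra]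
      congr 1
      apply IntermediateField.restrictScalars_injective k
      rw [IntermediateField.restrictScalars_top, eq_top_iff, ← htop,
        IntermediateField.adjoin_le_iff]
      rintro _ ⟨j, hj, rfl⟩
      rcases Nat.le_succ_iff.1 hj with hj | rfl
      · rw [hx₀ j hj]
        exact IntermediateField.algebraMap_mem _ (x₀ j)
      · exact IntermediateField.mem_adjoin_simple_self F _
    have hspan : ∀ f : K, ∃ a b : F, f = algebraMap F K a + algebraMap F K b * x (i + 1) := by
      intro f
      have hf : f ∈ Algebra.adjoin F {x (i + 1)} := by
        rw [hadj]
        trivial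
      induction hf using Algebra.adjoin_induction with
      | mem f hf => exact ⟨0, 1, by simpa using hf⟩
      | algebraMap a => exact ⟨a, 0, by simp⟩
      | add f g _ _ hf hg =>
        obtain ⟨a, b, rfl⟩ := hf
        obtain ⟨c, d, rfl⟩ := hg
        exact ⟨a + c, b + d, by rw [map_add, map_add]; ring⟩
      | mul f g _ _ hf hg =>
        obtain ⟨a, b, rfl⟩ := hf
        obtain ⟨c, d, rfl⟩ := hg
        refine ⟨a * c + b * d * (x₀ i + 1 + 1 / x₀ i), a * d + b * c - b * d, ?_⟩
        rw [map_add, map_mul, map_mul (algebraMap F K) (b * d), ← hy, map_sub, map_add, map_mul,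
          map_mul, map_mul]
        ring
    have hA := h.isArtinSchreier hy hspan
    have := hA.isAlgebraic
    exact h.succ hA hx₀ rfl

end Induction

/-! ### Solving the recursion -/

section Numerics

/-- Shifting n by 2 and i by 4 lengthens the chain and i − n by matching amounts: `Ramifies` is
unchanged and each degree is multiplied by 4. Of the remaining terms, n = 0 and n = 1 add 1 and 2,
completing the leading 1 to 4; n = i + 3 does not ramify; n = i + 4 gives the power of 2. -/
theorem ramifiedDegree_add_four (i : ℕ) :
    ramifiedDegree (i + 4) = 4 * ramifiedDegree i + 2 ^ ((i + 5) / 2) := by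
  classical
  unfold ramifiedDegree
  rw [Finset.sum_range_succ, Finset.sum_range_succ, Finset.sum_range_succ', Finset.sum_range_succ']
  have h1 : ∀ n ∈ Finset.range (i + 1),
      (if Ramifies (n + 1 + 1) (i + 4 - (n + 1 + 1)) then zeroDegree (i + 4) (n + 1 + 1) else 0) =
        4 * if Ramifies n (i - n) then zeroDegree i n else 0 := by
    intro n hn
    have hn' := Finset.mem_range_succ_iff.1 hn
    have hb : i + 4 - (n + 1 + 1) = i - n + 2 := by omega
    have hr : Ramifies (n + 1 + 1) (i + 4 - (n + 1 + 1)) ↔ Ramifies n (i - n) := by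
      rw [hb]
      unfold Ramifies
      rw [Nat.even_add]
      simp only [even_two, iff_true]
      refine or_congr Iff.rfl ?_
      omega
    have hz : zeroDegree (i + 4) (n + 1 + 1) = 4 * zeroDegree i n := by
      unfold zeroDegree
      rw [show 4 = 2 ^ 2 by norm_num, ← pow_add]
      congr 1
      omega
    rw [if_congr hr hz rfl, mul_ite, mul_zero]
  rw [Finset.sum_congr rfl h1, ← Finset.mul_sum]
  have h2 : Ramifies (0 + 1) (i + 4 - (0 + 1)) := Or.inr (by omega)
  have h3 : Ramifies 0 (i + 4 - 0) := Or.inr (by omega)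
  have h4 : ¬ Ramifies (i + 3) (i + 4 - (i + 3)) := by
    rw [show i + 4 - (i + 3) = 1 by omega]
    rintro (h | h)
    · exact absurd h (by decide)
    · omega
  have h5 : Ramifies (i + 4) (i + 4 - (i + 4)) := by
    rw [Nat.sub_self]
    exact Or.inl Even.zero
  rw [if_pos h2, if_pos h3, if_neg h4, if_pos h5]
  have h6 : zeroDegree (i + 4) (0 + 1) = 2 := by simp [zeroDegree]
  have h7 : zeroDegree (i + 4) 0 = 1 := by simp [zeroDegree]
  have h8 : zeroDegree (i + 4) (i + 4) = 2 ^ ((i + 5) / 2) := by simp [zeroDegree]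
  rw [h6, h7, h8]
  ring

theorem ramifiedDegree_zero : ramifiedDegree 0 = 2 := by
  simp [ramifiedDegree, Ramifies, zeroDegree]

theorem ramifiedDegree_one : ramifiedDegree 1 = 4 := by
  simp [ramifiedDegree, Ramifies, zeroDegree, Finset.sum_range_succ]

theorem ramifiedDegree_two : ramifiedDegree 2 = 6 := by
  simp [ramifiedDegree, Ramifies, zeroDegree, Finset.sum_range_succ]

theorem ramifiedDegree_three : ramifiedDegree 3 = 8 := by
  simp [ramifiedDegree, Ramifies, zeroDegree, Finset.sum_range_succ]

theorem ramifiedDegree_even (a : ℕ) : ramifiedDegree (2 * a) = 2 ^ a * (a + 2 - a / 2) := by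
  induction a using Nat.twoStepInduction with
  | zero => exact ramifiedDegree_zero
  | one => exact ramifiedDegree_two
  | more a ih _ =>
    rw [show 2 * (a + 2) = 2 * a + 4 by ring, ramifiedDegree_add_four, ih,
      show (2 * a + 5) / 2 = a + 2 by omega, show a + 2 + 2 - (a + 2) / 2 = a + 2 - a / 2 + 1 by omega]
    ring

theorem ramifiedDegree_odd (a : ℕ) : ramifiedDegree (2 * a + 1) = 2 ^ (a + 1) * (2 + a / 2) := by
  induction a using Nat.twoStepInduction with
  | zero => exact ramifiedDegree_one
  | one => exact ramifiedDegree_three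
  | more a ih _ =>
    rw [show 2 * (a + 2) + 1 = 2 * a + 1 + 4 by ring, ramifiedDegree_add_four, ih,
      show (2 * a + 1 + 5) / 2 = a + 3 by omega, show (a + 2) / 2 = a / 2 + 1 by omega]
    ring

theorem towerGenus_odd_of_even {a : ℕ} (h : towerGenus (2 * a) = 4 ^ (a + 1) + 1 - (a + 5) * 2 ^ a) :
    towerGenus (2 * a + 1) = 2 * 4 ^ (a + 1) + 1 - (a + 8 + (a / 2 : ℕ)) * 2 ^ a := by
  rw [towerGenus, h, ramifiedDegree_even]
  push_cast [Nat.cast_sub (show a / 2 ≤ a + 2 by omega)]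
  ring

/-- The term with a / 2 at the odd level cancels against that in `ramifiedDegree_odd`, so no floor
survives at even levels. -/
theorem towerGenus_even (a : ℕ) : towerGenus (2 * a) = 4 ^ (a + 1) + 1 - (a + 5) * 2 ^ a := by
  induction a with
  | zero => simp [towerGenus]
  | succ a ih =>
    rw [show 2 * (a + 1) = 2 * a + 1 + 1 by ring, towerGenus, towerGenus_odd_of_even ih,
      ramifiedDegree_odd]
    push_cast
    ring

theorem towerGenus_odd (a : ℕ) :
    towerGenus (2 * a + 1) = 2 * 4 ^ (a + 1) + 1 - (a + 8 + (a / 2 : ℕ)) * 2 ^ a :=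
  towerGenus_odd_of_even (towerGenus_even a)

end Numerics

end CurveTower

end

theorem mainTheorem2 (k : Type*) [Field k] [Algebra (ZMod 2) k] [Algebra.IsAlgebraic (ZMod 2) k]
    (K : Type*) [Field K] [Algebra k K] (i : ℕ) (x : Fin (i + 1) → K)
    (hx : CurveTower.IsTowerFunctionField k i x) :
    ∃ g : ℤ, CurveTower.IsGenus k K g ∧
      (Even i → (g : ℚ) = 2 ^ (i + 2) + 1 - ((i : ℚ) + 10) * (2 : ℚ) ^ ((i : ℤ) / 2 - 1)) ∧
      (Odd i → (g : ℚ) = 2 ^ (i + 2) + 1 -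
        ((i : ℚ) + 2 * ((i / 4 : ℕ) : ℚ) + 15) * (2 : ℚ) ^ (((i : ℤ) - 3) / 2)) := by
  have : CharP k 2 := charP_of_injective_algebraMap (algebraMap (ZMod 2) k).injective 2
  -- The extension of x to all natural numbers wraps around modulo i + 1, which is harmless as only
  -- indices up to i occur.
  have hlevel : CurveTower.TowerLevel k i fun j : ℕ => x (Fin.ofNat (i + 1) j) := by
    have hval : ∀ j : Fin (i + 1), Fin.ofNat (i + 1) (j : ℕ) = j := fun j => by simp
    refine CurveTower.towerLevel i _ ?_ (fun j hj => ?_) ?_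
    · exact hx.transcendental
    · have h1 := hval (Fin.succ ⟨j, hj⟩)
      have h2 := hval (Fin.castSucc ⟨j, hj⟩)
      have h3 := hx.equation ⟨j, hj⟩
      rw [← h1, ← h2] at h3
      exact h3
    · rw [← hx.adjoin_eq_top]
      congr 1
      ext f
      constructor
      · rintro ⟨j, -, rfl⟩
        exact ⟨_, rfl⟩
      · rintro ⟨j, rfl⟩
        exact ⟨j, Nat.lt_succ_iff.1 j.2, congrArg x (hval j)⟩
  refine ⟨CurveTower.towerGenus i, hlevel.hasGenus.isGenus hlevel.isCurve, ?_, ?_⟩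
  · rintro ⟨a, rfl⟩
    rw [← two_mul, CurveTower.towerGenus_even,
      -- The exponent is −1 at i = 0, and likewise at i = 1 below, hence the integer powers of a
      -- rational.
      show ((2 * a : ℕ) : ℤ) / 2 - 1 = (a : ℤ) - 1 by omega, zpow_sub_one₀ two_ne_zero,
      zpow_natCast, show (2 : ℚ) ^ (2 * a + 2) = 4 ^ (a + 1) by
        rw [show 2 * a + 2 = 2 * (a + 1) by ring, pow_mul]; norm_num]
    push_cast
    ring
  · rintro ⟨a, rfl⟩
    rw [CurveTower.towerGenus_odd, show (((2 * a + 1 : ℕ) : ℤ) - 3) / 2 = (a : ℤ) - 1 by omega,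
      zpow_sub_one₀ two_ne_zero, zpow_natCast, show (2 * a + 1) / 4 = a / 2 by omega,
      show (2 : ℚ) ^ (2 * a + 1 + 2) = 2 * 4 ^ (a + 1) by
        rw [show 2 * a + 1 + 2 = 2 * (a + 1) + 1 by ring, pow_succ', pow_mul]; norm_num]
    generalize a / 2 = m
    push_cast
    ring
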